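/- All Lie superalgebras are over $\mathbb{C}$, possibly infinite-dimensional, and $\mathcal{U}$ denotes the universal enveloping superalgebra. **Setting.** Let $Q$ be an abelian group. A *triangular decomposition* $\mathfrak{g}=\mathfrak{n}^-\oplus\mathfrak{h}\oplus\mathfrak{n}^+$ is given by a $Q$-grading $\mathfrak{g}=\bigoplus_{\alpha\in Q}\mathfrak{g}_\alpha$ of the Lie superalgebra $\mathfrak{g}$ (for instance by the weights of $\operatorname{ad}\mathfrak{h}_{\bar 0}$) and a set $\Delta^+\subset Q$ of positive roots such that $\mathfrak{h}=\mathfrak{g}_0$, $\mathfrak{n}^{\pm}=\bigoplus_{\alpha\in\Delta^+}\mathfrak{g}_{\pm\alpha}$, $\mathfrak{g}_\alpha=0$ unless $\alpha\in\Delta^+\cup\{0\}\cup(-\Delta^+)$, the spaces $\mathfrak{g}_{\pm\alpha}$ $(\alpha\in\Delta^+)$ and $\mathfrak{h}_{\bar 1}$ are finite-dimensional, and every $\nu\in Q$ can be written as a sum of positive roots (with multiplicities, up to order) in only finitely many ways. It is assumed that $[\mathfrak{h}_{\bar 0},\mathfrak{h}]=0$. **Shapovalov maps.** Put $A=S(\mathfrak{h}_{\bar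 0})=\mathcal{U}(\mathfrak{h}_{\bar 0})$, $R=\mathcal{U}(\mathfrak{h})$, $\mathfrak{b}^\pm=\mathfrak{h}+\mathfrak{n}^\pm$, and let $\mathrm{HC}:\mathcal{U}(\mathfrak{g})\to R$ be the Harish-Chandra projection along $\mathcal{U}(\mathfrak{g})=R\oplus(\mathfrak{n}^-\mathcal{U}(\mathfrak{g})+\mathcal{U}(\mathfrak{g})\mathfrak{n}^+)$. For $\nu\in Q$ put $$\mathcal{M}_{-\nu}=\mathcal{U}(\mathfrak{b}^-)_{-\nu},\qquad \mathcal{N}_{-\nu}=\operatorname{Hom}_{R}(\mathcal{U}(\mathfrak{b}^+)_{\nu},R)\quad(\text{homomorphisms of left }R\text{-modules}).$$ These are the components of degree $-\nu$ of the induced module $\operatorname{Ind}(R)$ and of the coinduced module $\operatorname{Coind}(R)$; they are $R$-bimodules, with $(rF)(v)=F(vr)$ and $(Fr)(v)=F(v)r$ on $\mathcal{N}_{-\nu}$, and they are free of finite rank over $A$ acting on the right. The *Shapovalov map* $S_\nu:\mathcal{M}_{-\nu}\to\mathcal{N}_{-\nu}$ is $S_\nu(u)(v)=\mathrm{HC}(vu)$.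 **Reduced norm.** View $\mathcal{M}_{-\nu}$ and $\mathcal{N}_{-\nu}$ as non-graded left modules over the superalgebra tensor product $\tilde R=R\otimes R$, where, for $x\in\mathfrak{h}$, $(x\otimes 1)v=xv$ and $(1\otimes x)v=-(-1)^{p(x)p(v)}vx$. A *reduced norm* on $\operatorname{End}_{\tilde R}(\mathcal{M}_{-\nu})$ is a map $\operatorname{Norm}:\operatorname{End}_{\tilde R}(\mathcal{M}_{-\nu})\to A$ with $\operatorname{Norm}(\mathrm{id})=1$, $\operatorname{Norm}(\phi\phi')=\operatorname{Norm}(\phi)\operatorname{Norm}(\phi')$ and $\det_A\phi=\operatorname{Norm}(\phi)^{2^{\dim\mathfrak{h}_{\bar 1}}}$. One puts $$\operatorname{Norm}S_\nu:=\operatorname{Norm}(\Psi^{-1}\circ S_\nu)\in A$$ for a (not necessarily even) isomorphism $\Psi:\mathcal{M}_{-\nu}\to\mathcal{N}_{-\nu}$ of $\tilde R$-modules and a reduced norm on $\operatorname{End}_{\tilde R}(\mathcal{M}_{-\nu})$, whenever these exist (as they do for the $Q$-type Lie superalgebras). This element is defined up to a factor in $\mathbb{C}^*$. **Theorem.** Let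 $\mathfrak{g}=\mathfrak{n}^-\oplus\mathfrak{h}\oplus\mathfrak{n}^+$ and $\mathfrak{g}'=\mathfrak{n}'^-\oplus\mathfrak{h}'\oplus\mathfrak{n}'^+$ be Lie superalgebras with triangular decompositions as above, with respect to the same group $Q$, such that $[\mathfrak{h}_{\bar 0},\mathfrak{h}]=0$ and $[\mathfrak{h}'_{\bar 0},\mathfrak{h}']=0$. Let $\psi:\mathfrak{g}\to\mathfrak{g}'$ be a homomorphism of Lie superalgebras that respects the $Q$-gradings and restricts to bijections $\mathfrak{n}^{+}\to\mathfrak{n}'^{+}$ and $\mathfrak{n}^-\to\mathfrak{n}'^-$. Denote also by $\psi$ the induced homomorphism $S(\mathfrak{h}_{\bar 0})\to S(\mathfrak{h}'_{\bar 0})$, and let $S_\nu$, $S'_\nu$ be the Shapovalov maps of $\mathfrak{g}$, $\mathfrak{g}'$. Then for every $\nu\in Q$ for which the reduced norms $\operatorname{Norm}S_\nu$ and $\operatorname{Norm}S'_\nu$ are defined one has $$\operatorname{Norm}S'_\nu=\psi(\operatorname{Norm}S_\nu)$$ up to a factor in $\mathbb{C}^*$ (for any choices in the definitions of the two norms). 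-/

import Mathlib

/-- The sign `(-1)^{ij}` of two parities. -/
noncomputable def superSign (i j : ZMod 2) : ℂ := if i = 1 ∧ j = 1 then -1 else 1

/-- A complex Lie superalgebra: `parity 0` and `parity 1` are the even and the odd part. -/
class LieSuperalgebra (g : Type*) [AddCommGroup g] [Module ℂ g] where
  parity : ZMod 2 → Submodule ℂ g
  isCompl_parity : IsCompl (parity 0) (parity 1)
  bracket : g →ₗ[ℂ] g →ₗ[ℂ] g
  bracket_mem : ∀ {i j : ZMod 2} {x y : g},
    x ∈ parity i → y ∈ parity j → bracket x y ∈ parity (i + j)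
  skew : ∀ {i j : ZMod 2} {x y : g}, x ∈ parity i → y ∈ parity j →
    bracket x y = -(superSign i j • bracket y x)
  jacobi : ∀ {i j : ZMod 2} {x y : g} (z : g), x ∈ parity i → y ∈ parity j →
    bracket x (bracket y z) =
      bracket (bracket x y) z + superSign i j • bracket y (bracket x z)

namespace LieSuperalgebra

section Enveloping

variable (g : Type*) [AddCommGroup g] [Module ℂ g] [LieSuperalgebra g]

/-- The relations `x y - (-1)^{p(x)p(y)} y x = [x, y]`. -/
inductive EnvRel : TensorAlgebra ℂ g → TensorAlgebra ℂ g → Prop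
  | of {i j : ZMod 2} {x y : g} (hx : x ∈ parity (g := g) i) (hy : y ∈ parity (g := g) j) :
      EnvRel (TensorAlgebra.ι ℂ x * TensorAlgebra.ι ℂ y
          - superSign i j • (TensorAlgebra.ι ℂ y * TensorAlgebra.ι ℂ x))
        (TensorAlgebra.ι ℂ (bracket x y))

/-- The universal enveloping algebra `U(g)` of a Lie superalgebra. -/
def Env : Type _ := RingQuot (EnvRel g)

noncomputable instance : Ring (Env g) := inferInstanceAs (Ring (RingQuot (EnvRel g)))

noncomputable instance : Algebra ℂ (Env g) :=
  inferInstanceAs (Algebra ℂ (RingQuot (EnvRel g)))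

/-- The canonical map `g → U(g)`. -/
noncomputable def ι : g →ₗ[ℂ] Env g :=
  (RingQuot.mkAlgHom ℂ (EnvRel g)).toLinearMap ∘ₗ TensorAlgebra.ι ℂ

variable {g}

theorem ι_mul_ι {i j : ZMod 2} {x y : g} (hx : x ∈ parity (g := g) i)
    (hy : y ∈ parity (g := g) j) :
    ι g x * ι g y = superSign i j • (ι g y * ι g x) + ι g (bracket x y) := by
  have h := RingQuot.mkAlgHom_rel ℂ (EnvRel.of hx hy)
  simp only [map_sub, map_mul, map_smul] at h
  rw [sub_eq_iff_eq_add'] at h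
  exact h

/-- The universal property of `U(g)`. -/
noncomputable def envLift {B : Type*} [Ring B] [Algebra ℂ B] (f : g →ₗ[ℂ] B)
    (hf : ∀ {i j : ZMod 2} {x y : g}, x ∈ parity (g := g) i → y ∈ parity (g := g) j →
      f x * f y - superSign i j • (f y * f x) = f (bracket x y)) : Env g →ₐ[ℂ] B :=
  RingQuot.liftAlgHom ℂ ⟨TensorAlgebra.lift ℂ f, by
    intro a b h
    induction h with
    | of hx hy => simpa using hf hx hy⟩

theorem envLift_ι {B : Type*} [Ring B] [Algebra ℂ B] (f : g →ₗ[ℂ] B)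
    (hf : ∀ {i j : ZMod 2} {x y : g}, x ∈ parity (g := g) i → y ∈ parity (g := g) j →
      f x * f y - superSign i j • (f y * f x) = f (bracket x y)) (x : g) :
    envLift f hf (ι g x) = f x := by
  have : envLift f hf (RingQuot.mkAlgHom ℂ (EnvRel g) (TensorAlgebra.ι ℂ x)) = f x := by
    refine (RingQuot.liftAlgHom_mkAlgHom_apply ℂ _ _ _).trans ?_
    simp
  exact this

variable (g) in
/-- The parity involution of `g`: the identity on the even part, `-1` on the odd part. -/
noncomputable def parityInv : g →ₗ[ℂ] g :=
  Submodule.projection _ _ (isCompl_parity (g := g))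
    - Submodule.projection _ _ (isCompl_parity (g := g)).symm

theorem parityInv_even {x : g} (hx : x ∈ parity (g := g) 0) : parityInv g x = x := by
  simp [parityInv, Submodule.projection_apply_of_mem_left _ hx,
    (Submodule.projection_apply_eq_zero_iff (isCompl_parity (g := g)).symm).2 hx]

theorem parityInv_odd {x : g} (hx : x ∈ parity (g := g) 1) : parityInv g x = -x := by
  simp [parityInv, Submodule.projection_apply_of_mem_left _ hx,
    (Submodule.projection_apply_eq_zero_iff (isCompl_parity (g := g))).2 hx]

theorem parity_cases (i : ZMod 2) : i = 0 ∨ i = 1 := by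
  revert i
  decide

theorem parityInv_apply {i : ZMod 2} {x : g} (hx : x ∈ parity (g := g) i) :
    parityInv g x = superSign 1 i • x := by
  rcases parity_cases i with rfl | rfl
  · simpa [superSign] using parityInv_even hx
  · simpa [superSign] using parityInv_odd hx

theorem superSign_add (i j : ZMod 2) :
    superSign 1 (i + j) = superSign 1 i * superSign 1 j := by
  rcases parity_cases i with rfl | rfl <;> rcases parity_cases j with rfl | rfl <;>
    simp [superSign, CharTwo.add_self_eq_zero]

theorem parityInv_rel {i j : ZMod 2} {x y : g} (hx : x ∈ parity (g := g) i)
    (hy : y ∈ parity (g := g) j) :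
    (ι g ∘ₗ parityInv g) x * (ι g ∘ₗ parityInv g) y
        - superSign i j • ((ι g ∘ₗ parityInv g) y * (ι g ∘ₗ parityInv g) x) =
      (ι g ∘ₗ parityInv g) (bracket x y) := by
  simp only [LinearMap.comp_apply, parityInv_apply hx, parityInv_apply hy,
    parityInv_apply (bracket_mem hx hy), map_smul, superSign_add, smul_mul_smul_comm]
  rw [ι_mul_ι hx hy, smul_add, smul_comm (superSign i j), mul_comm (superSign 1 j)]
  simp

variable (g) in
/-- The parity involution of `U(g)`: it is `(-1)^{p(u)}` on homogeneous elements `u`. -/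
noncomputable def envParity : Env g →ₐ[ℂ] Env g :=
  envLift (ι g ∘ₗ parityInv g) parityInv_rel

theorem envParity_ι (x : g) : envParity g (ι g x) = ι g (parityInv g x) :=
  envLift_ι _ parityInv_rel x

end Enveloping

/-- Homomorphisms of Lie superalgebras (even linear maps that respect the bracket). -/
structure Hom (g g' : Type*) [AddCommGroup g] [Module ℂ g] [LieSuperalgebra g]
    [AddCommGroup g'] [Module ℂ g'] [LieSuperalgebra g'] extends g →ₗ[ℂ] g' where
  map_parity : ∀ {i : ZMod 2} {x : g}, x ∈ parity (g := g) i →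
    toLinearMap x ∈ parity (g := g') i
  map_bracket : ∀ x y : g, toLinearMap (bracket x y) = bracket (toLinearMap x) (toLinearMap y)

instance (g g' : Type*) [AddCommGroup g] [Module ℂ g] [LieSuperalgebra g]
    [AddCommGroup g'] [Module ℂ g'] [LieSuperalgebra g'] :
    CoeFun (Hom g g') (fun _ => g → g') := ⟨fun f => f.toLinearMap⟩

/-- A triangular decomposition `g = n⁻ ⊕ h ⊕ n⁺` with `[h_0, h] = 0`, given by a grading of `g`
by an abelian group `Q` (the root lattice) and a set `pos = Δ⁺ ⊆ Q` of positive roots: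
`h` is the component of degree `0`, and `n⁺` (`n⁻`) is the sum of the components whose degree
is a positive (negative) root. The standard example is the grading by the weights of the adjoint
action of `h_0`. -/
structure TriangularDecomposition (g : Type*) [AddCommGroup g] [Module ℂ g] [LieSuperalgebra g]
    (Q : Type*) [AddCommGroup Q] where
  /-- the homogeneous components of the `Q`-grading -/
  wt : Q → Submodule ℂ g
  iSupIndep_wt : iSupIndep wt
  iSup_wt : ⨆ α, wt α = ⊤
  bracket_mem_wt : ∀ {α β : Q} {x y : g}, x ∈ wt α → y ∈ wt β → bracket x y ∈ wt (α + β)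
  /-- each component is a graded subspace with respect to the parity -/
  wt_graded : ∀ α, wt α = (wt α ⊓ parity 0) ⊔ (wt α ⊓ parity 1)
  /-- the positive roots -/
  pos : Set Q
  root_cases : ∀ α, wt α ≠ ⊥ → α = 0 ∨ α ∈ pos ∨ -α ∈ pos
  /-- each element of `Q` is a sum of positive roots in finitely many ways only;
  in particular no nonempty sum of positive roots vanishes -/
  finite_partitions : ∀ ν : Q,
    {m : Q →₀ ℕ | (m.support : Set Q) ⊆ pos ∧ m.sum (fun α k => k • α) = ν}.Finite
  finite_root : ∀ α, α ∈ pos ∨ -α ∈ pos → Module.Finite ℂ (wt α)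
  finite_odd_cartan : Module.Finite ℂ (wt 0 ⊓ parity 1 : Submodule ℂ g)
  /-- `[h_0, h] = 0` -/
  cartan_comm : ∀ {x y : g}, x ∈ wt 0 ⊓ parity 0 → y ∈ wt 0 → bracket x y = 0

namespace TriangularDecomposition

variable {g : Type*} [AddCommGroup g] [Module ℂ g] [LieSuperalgebra g]
  {Q : Type*} [AddCommGroup Q] (D : TriangularDecomposition g Q)

/-- the Cartan subalgebra `h` -/
def h : Submodule ℂ g := D.wt 0

/-- the even part `h_0` of `h` -/
def hEven : Submodule ℂ g := D.wt 0 ⊓ parity 0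

/-- the odd part `h_1` of `h` -/
def hOdd : Submodule ℂ g := D.wt 0 ⊓ parity 1

/-- `n⁺` -/
def nplus : Submodule ℂ g := ⨆ α ∈ D.pos, D.wt α

/-- `n⁻` -/
def nminus : Submodule ℂ g := ⨆ α ∈ D.pos, D.wt (-α)

theorem hEven_comm {x y : g} (hx : x ∈ D.hEven) (hy : y ∈ D.h) :
    ι g x * ι g y = ι g y * ι g x := by
  have key : ∀ {j : ZMod 2} {z : g}, z ∈ D.wt 0 → z ∈ parity (g := g) j →
      ι g x * ι g z = ι g z * ι g x := by
    intro j z hz hj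
    rw [ι_mul_ι hx.2 hj, D.cartan_comm hx hz]
    simp [superSign]
  have hy' : y ∈ (D.wt 0 ⊓ parity 0) ⊔ (D.wt 0 ⊓ parity 1) := D.wt_graded 0 ▸ hy
  obtain ⟨y0, h0, y1, h1, rfl⟩ := Submodule.mem_sup.1 hy'
  simp only [map_add, mul_add, add_mul, key h0.1 h0.2, key h1.1 h1.2]

/-- The polynomial algebra `A = S(h_0)`. -/
abbrev A : Type _ := SymmetricAlgebra ℂ D.hEven

/-- The subalgebra of `U(g)` generated by `h_0`; it is commutative. -/
noncomputable def evenSub : Subalgebra ℂ (Env g) :=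
  Algebra.adjoin ℂ (Set.range fun x : D.hEven => ι g (x : g))

noncomputable instance : CommRing D.evenSub :=
  { (inferInstance : Ring D.evenSub) with
    mul_comm := fun a b =>
      (Algebra.isMulCommutative_adjoin ℂ (by
        rintro _ ⟨x, rfl⟩ _ ⟨y, rfl⟩
        exact D.hEven_comm x.2 y.2.1)).is_comm.comm a b }

/-- The canonical homomorphism `A = S(h_0) = U(h_0) → U(g)`. -/
noncomputable def toEnv : D.A →ₐ[ℂ] Env g :=
  D.evenSub.val.comp (SymmetricAlgebra.lift
    ((ι g ∘ₗ D.hEven.subtype).codRestrict (Subalgebra.toSubmodule D.evenSub)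
      fun x => Algebra.subset_adjoin ⟨x, rfl⟩))

theorem toEnv_ι (x : D.hEven) : D.toEnv (SymmetricAlgebra.ι ℂ D.hEven x) = ι g (x : g) := by
  simp only [toEnv, AlgHom.comp_apply, SymmetricAlgebra.lift_ι_apply]
  rfl

theorem toEnv_comm (a : D.A) {x : g} (hx : x ∈ D.h) :
    D.toEnv a * ι g x = ι g x * D.toEnv a := by
  change Commute _ _
  induction a using SymmetricAlgebra.induction with
  | algebraMap r => rw [AlgHom.commutes]; exact Algebra.commute_algebraMap_left _ _
  | ι y => rw [toEnv_ι]; exact D.hEven_comm y.2 hx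
  | mul a b ha hb => rw [map_mul]; exact ha.mul_left hb
  | add a b ha hb => rw [map_add]; exact ha.add_left hb

theorem envParity_toEnv (a : D.A) : envParity g (D.toEnv a) = D.toEnv a := by
  induction a using SymmetricAlgebra.induction with
  | algebraMap r => simp
  | ι y => rw [toEnv_ι, envParity_ι, parityInv_even y.2.2]
  | mul a b ha hb => rw [map_mul, map_mul, ha, hb]
  | add a b ha hb => rw [map_add, map_add, ha, hb]

/-- `U(g)` as a right `A`-module (written as a module over the commutative ring `A`). -/
noncomputable instance instModuleA : Module D.A (Env g) where
  smul a u := u * D.toEnv a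
  one_smul u := by change u * D.toEnv 1 = u; simp
  mul_smul a b u := by
    change u * D.toEnv (a * b) = u * D.toEnv b * D.toEnv a
    rw [mul_comm a b, map_mul, mul_assoc]
  smul_zero a := by change (0 : Env g) * D.toEnv a = 0; simp
  smul_add a u v := add_mul u v _
  add_smul a b u := by
    change u * D.toEnv (a + b) = u * D.toEnv a + u * D.toEnv b
    rw [map_add, mul_add]
  zero_smul u := by change u * D.toEnv 0 = 0; simp

theorem smul_def (a : D.A) (u : Env g) : a • u = u * D.toEnv a := rfl

instance : IsScalarTower ℂ D.A (Env g) :=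
  ⟨fun c a u => by simp [smul_def]⟩

instance : SMulCommClass ℂ D.A (Env g) :=
  ⟨fun c a u => by simp [smul_def]⟩

/-- Products `x_1 ⋯ x_k` in `U(g)` of total degree `ν` whose factors `x_i` lie in `h` or in
components with degree in `T`. -/
inductive IsMonomial (T : Set Q) : Q → Env g → Prop
  | one : IsMonomial T 0 1
  | mul {α ν : Q} {x : g} {u : Env g} (hα : α = 0 ∨ α ∈ T) (hx : x ∈ D.wt α)
      (hu : IsMonomial T ν u) : IsMonomial T (α + ν) (ι g x * u)

/-- The component of degree `ν` of the subalgebra of `U(g)` generated by `h` and by the `g_α`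
with `α ∈ T`. -/
noncomputable def comp (T : Set Q) (ν : Q) : Submodule D.A (Env g) :=
  Submodule.span D.A {u | D.IsMonomial T ν u}

/-- `R = U(h)` -/
noncomputable abbrev R : Submodule D.A (Env g) := D.comp ∅ 0

/-- `U(b⁺)_ν`, where `b⁺ = h ⊕ n⁺` -/
noncomputable abbrev P (ν : Q) : Submodule D.A (Env g) := D.comp D.pos ν

/-- `M_{-ν} = Ind(R)_{-ν} = U(b⁻)_{-ν}`, where `b⁻ = h ⊕ n⁻` -/
noncomputable abbrev M (ν : Q) : Submodule D.A (Env g) := D.comp {α | -α ∈ D.pos} (-ν)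

section Stability

variable {D} {T : Set Q} {ν : Q} {u : Env g} {x : g}

theorem IsMonomial.mul_right (hu : D.IsMonomial T ν u) (hx : x ∈ D.h) :
    D.IsMonomial T ν (u * ι g x) := by
  induction hu with
  | one => simpa using IsMonomial.mul (Or.inl rfl) hx (IsMonomial.one (D := D) (T := T))
  | mul hα hy _ ih => rw [mul_assoc]; exact IsMonomial.mul hα hy ih

theorem parityInv_mem_wt {α : Q} (hx : x ∈ D.wt α) : parityInv g x ∈ D.wt α := by
  have hx' : x ∈ (D.wt α ⊓ parity 0) ⊔ (D.wt α ⊓ parity 1) := D.wt_graded α ▸ hx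
  obtain ⟨x0, h0, x1, h1, rfl⟩ := Submodule.mem_sup.1 hx'
  rw [map_add, parityInv_even h0.2, parityInv_odd h1.2]
  exact add_mem h0.1 (neg_mem h1.1)

theorem IsMonomial.envParity (hu : D.IsMonomial T ν u) :
    D.IsMonomial T ν (envParity g u) := by
  induction hu with
  | one => rw [map_one]; exact .one
  | mul hα hy _ ih =>
    rw [map_mul, envParity_ι]
    exact IsMonomial.mul hα (parityInv_mem_wt hy) ih

theorem comp_map (f : Env g →ₗ[D.A] Env g)
    (hf : ∀ u, D.IsMonomial T ν u → D.IsMonomial T ν (f u)) :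
    ∀ u ∈ D.comp T ν, f u ∈ D.comp T ν := by
  intro u hu
  have : D.comp T ν ≤ (D.comp T ν).comap f :=
    Submodule.span_le.2 fun u hu => Submodule.subset_span (hf u hu)
  exact this hu

end Stability

/-- left multiplication by `x` on `U(g)` -/
noncomputable def lmulU (x : g) : Env g →ₗ[D.A] Env g where
  toFun u := ι g x * u
  map_add' := mul_add _
  map_smul' a u := by simp [smul_def, mul_assoc]

/-- right multiplication by `x ∈ h` on `U(g)` -/
noncomputable def rmulU (x : D.h) : Env g →ₗ[D.A] Env g where
  toFun u := u * ι g (x : g)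
  map_add' u v := add_mul u v _
  map_smul' a u := by simp [smul_def, mul_assoc, D.toEnv_comm a x.2]

/-- the parity involution on `U(g)` -/
noncomputable def parU : Env g →ₗ[D.A] Env g where
  toFun u := envParity g u
  map_add' := map_add _
  map_smul' a u := by simp [smul_def, D.envParity_toEnv]

/-- left multiplication by `x ∈ h` -/
noncomputable def lmul (T : Set Q) (ν : Q) (x : D.h) : D.comp T ν →ₗ[D.A] D.comp T ν :=
  (D.lmulU x).restrict (comp_map _ fun u hu => by
    simpa [lmulU] using IsMonomial.mul (Or.inl rfl) x.2 hu)

/-- right multiplication by `x ∈ h` -/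
noncomputable def rmul (T : Set Q) (ν : Q) (x : D.h) : D.comp T ν →ₗ[D.A] D.comp T ν :=
  (D.rmulU x).restrict (comp_map _ fun _ hu => hu.mul_right x.2)

/-- the parity involution `u ↦ (-1)^{p(u)} u` -/
noncomputable def par (T : Set Q) (ν : Q) : D.comp T ν →ₗ[D.A] D.comp T ν :=
  D.parU.restrict (comp_map _ fun _ hu => hu.envParity)

/-- `N_{-ν} = Coind(R)_{-ν}`: the homomorphisms of left `h`-modules `U(b⁺)_ν → R`.
`A` acts through the right multiplication on `R`. -/
noncomputable def N (ν : Q) : Submodule D.A (D.P ν →ₗ[ℂ] D.R) where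
  carrier := {F | ∀ (x : D.h) (v : D.P ν), F (D.lmul _ _ x v) = D.lmul _ _ x (F v)}
  add_mem' {F G} hF hG x v := by simp [hF x v, hG x v]
  zero_mem' x v := by simp
  smul_mem' a F hF x v := by simp [hF x v]

/-- `n⁻ U(g) + U(g) n⁺`, which is stable under right multiplication by `A`
because `[h, n⁺] ⊆ n⁺`. -/
noncomputable def hcKernel : Submodule D.A (Env g) :=
  Submodule.span D.A ({w | ∃ y ∈ D.nminus, ∃ u : Env g, w = ι g y * u} ∪
    {w | ∃ x ∈ D.nplus, ∃ u : Env g, w = u * ι g x})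

open Classical in
/-- The Harish-Chandra projection `U(g) → R = U(h)` along the decomposition
`U(g) = U(h) ⊕ (n⁻ U(g) + U(g) n⁺)`. (This decomposition is part of the
Poincaré-Birkhoff-Witt theorem, so that the second case does not occur.) -/
noncomputable def HC : Env g →ₗ[D.A] D.R :=
  if H : IsCompl D.R D.hcKernel then Submodule.projectionOnto _ _ H else 0

theorem nminus_comm {x : g} (hx : x ∈ D.h) {y : g} (hy : y ∈ D.nminus) (u : Env g) :
    ι g x * (ι g y * u) ∈ D.hcKernel := by
  have mem : ∀ {z : g} {v : Env g}, z ∈ D.nminus → ι g z * v ∈ D.hcKernel := fun hz =>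
    Submodule.subset_span (Or.inl ⟨_, hz, _, rfl⟩)
  have hom : ∀ {i j : ZMod 2} {x y : g} {α : Q}, x ∈ D.wt 0 → x ∈ parity (g := g) i →
      α ∈ D.pos → y ∈ D.wt (-α) → y ∈ parity (g := g) j →
      ι g x * (ι g y * u) ∈ D.hcKernel := by
    intro i j x y α hx hi hα hy hj
    have hle : D.wt (-α) ≤ D.nminus := le_iSup₂_of_le α hα le_rfl
    have hb : bracket x y ∈ D.wt (-α) := by simpa using D.bracket_mem_wt hx hy
    have e : ι g x * (ι g y * u) =
        ι g y * (superSign i j • (ι g x * u)) + ι g (bracket x y) * u := by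
      rw [← mul_assoc, ι_mul_ι hi hj, add_mul, smul_mul_assoc, mul_smul_comm, mul_assoc]
    rw [e]
    exact add_mem (mem (hle hy)) (mem (hle hb))
  have half : ∀ {i : ZMod 2} {x : g}, x ∈ D.wt 0 → x ∈ parity (g := g) i →
      ι g x * (ι g y * u) ∈ D.hcKernel := by
    intro i x hx hi
    unfold nminus at hy
    induction hy using Submodule.iSup_induction' with
    | mem α y hy =>
      induction hy using Submodule.iSup_induction' with
      | mem hα y hy =>
        have hy' : y ∈ (D.wt (-α) ⊓ parity 0) ⊔ (D.wt (-α) ⊓ parity 1) :=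
          D.wt_graded (-α) ▸ hy
        obtain ⟨y0, h0, y1, h1, rfl⟩ := Submodule.mem_sup.1 hy'
        rw [map_add, add_mul, mul_add]
        exact add_mem (hom hx hi hα h0.1 h0.2) (hom hx hi hα h1.1 h1.2)
      | zero => simp
      | add a b _ _ ha hb => rw [map_add, add_mul, mul_add]; exact add_mem ha hb
    | zero => simp
    | add a b _ _ ha hb => rw [map_add, add_mul, mul_add]; exact add_mem ha hb
  have hx' : x ∈ (D.wt 0 ⊓ parity 0) ⊔ (D.wt 0 ⊓ parity 1) := D.wt_graded 0 ▸ hx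
  obtain ⟨x0, h0, x1, h1, rfl⟩ := Submodule.mem_sup.1 hx'
  rw [map_add, add_mul]
  exact add_mem (half h0.1 h0.2) (half h1.1 h1.2)

theorem HC_lmul (x : D.h) (w : Env g) : D.HC (ι g (x : g) * w) = D.lmul _ _ x (D.HC w) := by
  have hker : D.hcKernel ≤ D.hcKernel.comap (D.lmulU (x : g)) := by
    refine Submodule.span_le.2 ?_
    rintro _ (⟨y, hy, u, rfl⟩ | ⟨y, hy, u, rfl⟩)
    · exact D.nminus_comm x.2 hy u
    · exact Submodule.subset_span (Or.inr ⟨y, hy, ι g (x : g) * u, (mul_assoc _ _ _).symm⟩)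
  unfold HC
  split_ifs with H
  · obtain ⟨r, hr, k, hk, rfl⟩ := Submodule.mem_sup.1
      (show w ∈ D.R ⊔ D.hcKernel from H.sup_eq_top ▸ Submodule.mem_top)
    have hxr : ι g (x : g) * r = (D.lmul ∅ 0 x ⟨r, hr⟩ : Env g) := rfl
    have hxk : ι g (x : g) * k ∈ D.hcKernel := hker hk
    rw [mul_add, map_add, map_add, map_add, hxr, Submodule.projectionOnto_apply_left,
      Submodule.projectionOnto_apply_of_mem_left H hr,
      (Submodule.projectionOnto_apply_eq_zero_iff H).2 hk,
      (Submodule.projectionOnto_apply_eq_zero_iff H).2 hxk]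
    simp
  · simp

/-- The Shapovalov map `S_ν : M_{-ν} → N_{-ν}`, `S(u)(v) = HC(v u)`. It is the component of degree
`-ν` of the `g`-homomorphism `Ind(R) → Coind(R)` adjoint to the identity of `R`. -/
noncomputable def S (ν : Q) : D.M ν →ₗ[D.A] D.N ν where
  toFun u :=
    ⟨{ toFun := fun v => D.HC ((v : Env g) * u)
       map_add' := fun v w => by simp [add_mul]
       map_smul' := fun c v => by
        have e : ((c • v : D.P ν) : Env g) * (u : Env g)
            = algebraMap ℂ D.A c • ((v : Env g) * (u : Env g)) := by
          rw [algebraMap_smul, Submodule.coe_smul_of_tower, smul_mul_assoc]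
        rw [e, map_smul, algebraMap_smul, RingHom.id_apply] },
      fun x v => by
        have e : ((D.lmul _ _ x v : D.P ν) : Env g) = ι g (x : g) * (v : Env g) := rfl
        simp only [LinearMap.coe_mk, AddHom.coe_mk]
        rw [e, mul_assoc, D.HC_lmul]⟩
  map_add' u w := by
    ext v
    simp [mul_add]
  map_smul' a u := by
    ext v
    have e : (v : Env g) * ((a • u : D.M ν) : Env g) = a • ((v : Env g) * (u : Env g)) :=
      (mul_assoc _ _ _).symm
    change ((D.HC ((v : Env g) * ((a • u : D.M ν) : Env g)) : D.R) : Env g)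
      = ((a • D.HC ((v : Env g) * (u : Env g)) : D.R) : Env g)
    rw [e, map_smul]

/-- An odd element of `h` as an element of `h`. -/
def oddToCartan (x : D.hOdd) : D.h := ⟨x, x.2.1⟩

/-- The operator `u ↦ -(-1)^{p(u)} u x` for `x ∈ h_1`. -/
noncomputable def twist (T : Set Q) (ν : Q) (x : D.hOdd) : D.comp T ν →ₗ[D.A] D.comp T ν :=
  -(D.rmul T ν (D.oddToCartan x) ∘ₗ D.par T ν)

/-- The action on `M_{-ν}` of the generators `x ⊗ 1` (`x ∈ h`) and `1 ⊗ x` (`x ∈ h_1`) of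
`U(h) ⊗ U(h)`, where `(x ⊗ 1) u = x u` and `(1 ⊗ x) u = -(-1)^{p(x)p(u)} u x`.
The generators `1 ⊗ x` with `x ∈ h_0` act through the `A`-module structure. -/
noncomputable def actM (ν : Q) : D.h ⊕ D.hOdd → Module.End D.A (D.M ν)
  | Sum.inl x => D.lmul _ _ x
  | Sum.inr x => D.twist _ _ x

theorem rmul_lmul (T : Set Q) (ν : Q) (x y : D.h) (u : D.comp T ν) :
    D.rmul T ν x (D.lmul T ν y u) = D.lmul T ν y (D.rmul T ν x u) :=
  Subtype.ext (mul_assoc _ _ _)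

/-- The parity involution on `h`. -/
noncomputable def parH (x : D.h) : D.h := ⟨parityInv g x, parityInv_mem_wt x.2⟩

theorem parityInv_parityInv (x : g) : parityInv g (parityInv g x) = x := by
  obtain ⟨x0, h0, x1, h1, rfl⟩ := Submodule.mem_sup.1
    (show x ∈ parity (g := g) 0 ⊔ parity (g := g) 1 from
      (isCompl_parity (g := g)).sup_eq_top ▸ Submodule.mem_top)
  simp [parityInv_even h0, parityInv_odd h1]

theorem par_lmul (T : Set Q) (ν : Q) (x : D.h) (u : D.comp T ν) :
    D.par T ν (D.lmul T ν x u) = D.lmul T ν (D.parH x) (D.par T ν u) := by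
  apply Subtype.ext
  change envParity g (ι g (x : g) * (u : Env g)) = ι g (parityInv g x) * envParity g u
  rw [map_mul, envParity_ι]

theorem parH_parH (x : D.h) : D.parH (D.parH x) = x :=
  Subtype.ext (parityInv_parityInv (x : g))

theorem twist_lmul (T : Set Q) (ν : Q) (x : D.hOdd) (y : D.h) (u : D.comp T ν) :
    D.twist T ν x (D.lmul T ν y u) = D.lmul T ν (D.parH y) (D.twist T ν x u) := by
  simp only [twist, LinearMap.neg_apply, LinearMap.comp_apply, par_lmul, rmul_lmul, map_neg]

/-- The action of `x ⊗ 1`, `x ∈ h`, on `N_{-ν}`: `(x F)(v) = F(v x)`. -/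
noncomputable def leftN (ν : Q) (x : D.h) : Module.End D.A (D.N ν) where
  toFun F := ⟨F.1 ∘ₗ (D.rmul _ _ x).restrictScalars ℂ, fun y v => by
    simp only [LinearMap.comp_apply, LinearMap.restrictScalars_apply, rmul_lmul]
    exact F.2 y _⟩
  map_add' F G := rfl
  map_smul' a F := rfl

/-- The action of `1 ⊗ x`, `x ∈ h_1`, on `N_{-ν}`: `((1 ⊗ x) F)(v) = -(-1)^{p(F)} F(v) x`. -/
noncomputable def rightN (ν : Q) (x : D.hOdd) : Module.End D.A (D.N ν) where
  toFun F := ⟨(D.twist ∅ 0 x).restrictScalars ℂ ∘ₗ F.1 ∘ₗ (D.par _ ν).restrictScalars ℂ,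
    fun y v => by
      simp only [LinearMap.comp_apply, LinearMap.restrictScalars_apply, par_lmul]
      rw [F.2, twist_lmul, parH_parH]⟩
  map_add' F G := Subtype.ext (LinearMap.ext fun _ => map_add (D.twist ∅ 0 x) _ _)
  map_smul' a F := Subtype.ext (LinearMap.ext fun _ => map_smul (D.twist ∅ 0 x) a _)

/-- The action on `N_{-ν}` of the generators of `U(h) ⊗ U(h)`, as for `actM`. -/
noncomputable def actN (ν : Q) : D.h ⊕ D.hOdd → Module.End D.A (D.N ν)
  | Sum.inl x => D.leftN ν x
  | Sum.inr x => D.rightN ν x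

/-- The monoid of (not necessarily even) endomorphisms of the `U(h) ⊗ U(h)`-module `M_{-ν}`. -/
noncomputable def EndRt (ν : Q) : Submonoid (Module.End D.A (D.M ν)) :=
  Submonoid.centralizer (Set.range (D.actM ν))

/-- A reduced norm on `End(M_{-ν})`: a multiplicative map to `A` that sends `id` to `1` and
satisfies `det φ = (Norm φ)^{2^{dim h_1}}`. -/
def IsNormMap (ν : Q) (Nm : D.EndRt ν →* D.A) : Prop :=
  ∀ φ : D.EndRt ν, LinearMap.det (φ : Module.End D.A (D.M ν)) =
    Nm φ ^ 2 ^ Module.finrank ℂ D.hOdd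

/-- `n = Norm S_ν`: for some isomorphism `Ψ : M_{-ν} → N_{-ν}` of (non-graded)
`U(h) ⊗ U(h)`-modules and some reduced norm on `End(M_{-ν})`, `n` is the reduced norm of
`Ψ⁻¹ ∘ S_ν`. This determines `n` up to a factor in `ℂ^*`. -/
def IsReducedNorm (ν : Q) (n : D.A) : Prop :=
  ∃ (Ψ : D.M ν ≃ₗ[D.A] D.N ν) (Nm : D.EndRt ν →* D.A) (φ : D.EndRt ν),
    (∀ s u, Ψ (D.actM ν s u) = D.actN ν s (Ψ u)) ∧ D.IsNormMap ν Nm ∧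
    (φ : Module.End D.A (D.M ν)) = Ψ.symm.toLinearMap ∘ₗ D.S ν ∧ n = Nm φ

variable {g' : Type*} [AddCommGroup g'] [Module ℂ g'] [LieSuperalgebra g']

/-- The homomorphism `S(h_0) → S(h'_0)` induced by a homomorphism `ψ : g → g'` that respects the
`Q`-gradings. -/
noncomputable def mapA (D : TriangularDecomposition g Q) (D' : TriangularDecomposition g' Q)
    (ψ : Hom g g') (hψ : ∀ (α : Q) (x : g), x ∈ D.wt α → ψ x ∈ D'.wt α) : D.A →ₐ[ℂ] D'.A :=
  SymmetricAlgebra.lift (SymmetricAlgebra.ι ℂ D'.hEven ∘ₗ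
    ψ.toLinearMap.restrict (p := D.hEven) (q := D'.hEven)
      fun _ hx => ⟨hψ 0 _ hx.1, ψ.map_parity hx.2⟩)

end TriangularDecomposition

end LieSuperalgebra

/-! Write d and d' for the dimensions of h_1 and h'_1. A basis u_j of the component of degree -ν of
U(n⁻) is a basis of M_{-ν} as a right U(h)-module, and a basis v_i of the component of degree ν of
U(n⁺) identifies N_{-ν} with a power of U(h) by evaluation at the v_i. In these coordinates S_ν is
left multiplication by the matrix B = (HC(v_i u_j)) over U(h) (`coordN_S_coordM`). Composing with an
isomorphism changes the determinant over A only by a unit of the polynomial algebra A, that is, by a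
nonzero constant. Hence (Norm S_ν)^(2^d) = det_A B up to a constant (`exists_det_eq_smul`).

The matrix is natural. Since ψ is bijective on n⁺ and n⁻, it maps the two bases to such bases for
g', and it commutes with HC (`chi_envMap`), so the matrix of S'_ν is ψ(B). The determinant over A is
not natural in the same way, because U(h) has rank 2^d over A (it is a Clifford algebra,
`finrank_H`), and d and d' may differ. What is natural is the normalized trace 2^(-d) tr_A of left
multiplications on U(h) (`traceH_mapH`): it is A-linear, takes the value 1 at 1, vanishes on odd
words in h_1 and satisfies T(rs) = T(sr), and these properties determine it. In characteristic zero
the traces of the powers of an operator determine its determinant, so det ψ(B)^(2^d) = ψ(det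
B)^(2^d') (`Matrix.det_pow_eq_of_trace_pow`, `det_mulVecAlg_mapH`). Therefore Norm S'_ν and ψ(Norm
S_ν) have proportional powers with exponent 2^(d+d'), and in a domain over ℂ they are then
proportional (`exists_eq_smul_of_pow_eq_smul`).

The Poincaré-Birkhoff-Witt theorem enters in this form: if g = a ⊕ b for subalgebras a and b, and W
is a b-module, then g acts on U(a) ⊗ W (`Splitting.induced`). Letting elements of U(g) act on a
vector 1 ⊗ w yields the independence of ordered products, the Harish-Chandra decomposition and the
injectivity of U(n^±) → U(g'). -/

/-! ### Eigenvalues, traces of powers and determinants -/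

-- Both sides are multiplicative in `p`, and over an algebraically closed field `p` is a constant
-- times a product of linear factors. For a linear factor the left side is, up to sign, a value of
-- the characteristic polynomial.
open Polynomial in
theorem Matrix.det_aeval_eq_prod_roots_charpoly {n K : Type*} [Fintype n] [DecidableEq n] [Field K]
    [IsAlgClosed K] (X : Matrix n n K) (p : K[X]) :
    (aeval X p).det = (X.charpoly.roots.map fun l => p.eval l).prod := by
  have hcard : X.charpoly.roots.card = Fintype.card n := by
    rw [← (IsAlgClosed.splits X.charpoly).natDegree_eq_card_roots, X.charpoly_natDegree_eq_dim]
  have hmul : ∀ p q : K[X], (aeval X p).det = (X.charpoly.roots.map fun l => p.eval l).prod →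
      (aeval X q).det = (X.charpoly.roots.map fun l => q.eval l).prod →
      (aeval X (p * q)).det = (X.charpoly.roots.map fun l => (p * q).eval l).prod := by
    intro p q hp hq
    simp only [map_mul, Matrix.det_mul, hp, hq, eval_mul, Multiset.prod_map_mul]
  have hC : ∀ c : K, (aeval X (C c)).det = (X.charpoly.roots.map fun l => (C c).eval l).prod := by
    intro c
    simp [Matrix.algebraMap_eq_diagonal, hcard]
  have hlin : ∀ a : K, (aeval X (C a - Polynomial.X)).det =
      (X.charpoly.roots.map fun l => (C a - Polynomial.X : K[X]).eval l).prod := by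
    intro a
    have h1 : (aeval X (C a - Polynomial.X)).det = X.charpoly.eval a := by
      rw [Matrix.eval_charpoly]
      simp [Matrix.algebraMap_eq_diagonal, Matrix.scalar_apply]
      rfl
    rw [h1]
    conv_lhs => rw [(IsAlgClosed.splits X.charpoly).eq_prod_roots_of_monic X.charpoly_monic]
    rw [eval_multiset_prod, Multiset.map_map]
    simp
  have hroot : ∀ a : K, (aeval X (Polynomial.X - C a)).det =
      (X.charpoly.roots.map fun l => (Polynomial.X - C a : K[X]).eval l).prod := by
    intro a
    have e : (Polynomial.X - C a : K[X]) = C (-1) * (C a - Polynomial.X) := by simp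
    rw [e]
    exact hmul _ _ (hC _) (hlin a)
  rw [(IsAlgClosed.splits p).eq_prod_roots]
  refine hmul _ _ (hC _) ?_
  induction p.roots using Multiset.induction with
  | empty => simp
  | cons a s ih => rw [Multiset.map_cons, Multiset.prod_cons]; exact hmul _ _ (hroot a) ih

-- The determinant of c - X^k, computed by the preceding formula for the polynomial c - T^k, is the
-- product of the c - l^k. So the characteristic polynomial of X^k has the roots l^k.
open Polynomial in
theorem Matrix.trace_pow_eq_sum_roots_charpoly {n K : Type*} [Fintype n] [DecidableEq n] [Field K]
    [IsAlgClosed K] (X : Matrix n n K) (k : ℕ) :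
    (X ^ k).trace = (X.charpoly.roots.map fun l => l ^ k).sum := by
  have h : (X ^ k).charpoly = ((X.charpoly.roots.map fun l => l ^ k).map
      fun a => Polynomial.X - C a).prod := by
    refine Polynomial.funext fun c => ?_
    have h1 := X.det_aeval_eq_prod_roots_charpoly (C c - Polynomial.X ^ k)
    rw [Matrix.eval_charpoly, eval_multiset_prod, Multiset.map_map, Multiset.map_map]
    have h2 : aeval X (C c - Polynomial.X ^ k) = Matrix.scalar n c - X ^ k := by
      simp [Matrix.algebraMap_eq_diagonal, Matrix.scalar_apply]
    rw [← h2, h1]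
    simp
  rw [Matrix.trace_eq_sum_roots_charpoly, h, roots_multiset_prod_X_sub_C]

/-- Distinct l define distinct characters k ↦ l^k of the monoid ℕ, and these are linearly
independent (Dedekind). So the multiplicities in `s` and `t` agree in `K`, hence as integers. The
case k = 0 is included, so l = 0 also gives a character, with 0^0 = 1. -/
theorem Multiset.map_pow_sum_injective {K : Type*} [Field K] [CharZero K] (s t : Multiset K)
    (h : ∀ k : ℕ, (s.map fun l => l ^ k).sum = (t.map fun l => l ^ k).sum) : s = t := by
  classical
  have hli := linearIndependent_monoidHom (Multiplicative ℕ) K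
  have hinj : Function.Injective (powersHom K) := (powersHom K).injective
  have hli2 := linearIndependent_iff'.1 (hli.comp _ hinj) (s.toFinset ∪ t.toFinset)
    (fun l => (s.count l : K) - t.count l) (by
      ext k
      have hk := h k.toAdd
      rw [Finset.sum_multiset_map_count, Finset.sum_multiset_map_count] at hk
      simp only [Finset.sum_apply, Pi.smul_apply, Function.comp_apply, powersHom_apply, smul_eq_mul,
        Pi.zero_apply, sub_mul, Finset.sum_sub_distrib, sub_eq_zero]
      rw [← Finset.sum_subset Finset.subset_union_left,
        ← Finset.sum_subset Finset.subset_union_right]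
      · simpa [nsmul_eq_mul] using hk
      · intro x _ hx
        rw [Multiset.mem_toFinset] at hx
        simp [Multiset.count_eq_zero_of_notMem hx]
      · intro x _ hx
        rw [Multiset.mem_toFinset] at hx
        simp [Multiset.count_eq_zero_of_notMem hx])
  ext l
  by_cases hl : l ∈ s.toFinset ∪ t.toFinset
  · exact_mod_cast sub_eq_zero.1 (hli2 l hl)
  · simp only [Finset.mem_union, Multiset.mem_toFinset, not_or] at hl
    rw [Multiset.count_eq_zero_of_notMem hl.1, Multiset.count_eq_zero_of_notMem hl.2]

/-- In characteristic zero the traces of the powers determine the determinant. -/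
theorem Matrix.det_pow_eq_of_trace_pow {m n A : Type*} [Fintype m] [DecidableEq m] [Fintype n]
    [DecidableEq n] [CommRing A] [IsDomain A] [CharZero A] (X : Matrix m m A) (Y : Matrix n n A)
    (a b : ℕ) (h : ∀ k : ℕ, a * (X ^ k).trace = b * (Y ^ k).trace) : X.det ^ a = Y.det ^ b := by
  let f : A →+* AlgebraicClosure (FractionRing A) :=
    (algebraMap (FractionRing A) _).comp (algebraMap A _)
  have hf : Function.Injective f :=
    (algebraMap (FractionRing A) _).injective.comp (IsFractionRing.injective A _)
  have : CharZero (AlgebraicClosure (FractionRing A)) :=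
    charZero_of_injective_ringHom (f := f) hf
  apply hf
  rw [map_pow, map_pow, RingHom.map_det, RingHom.map_det, Matrix.det_eq_prod_roots_charpoly,
    Matrix.det_eq_prod_roots_charpoly, ← Multiset.prod_nsmul, ← Multiset.prod_nsmul]
  -- It remains to identify the multiset of `a` copies of the eigenvalues of `X` with that of `b`
  -- copies of the eigenvalues of `Y`; their power sums agree by hypothesis.
  congr 1
  refine Multiset.map_pow_sum_injective _ _ fun k => ?_
  rw [Multiset.map_nsmul, Multiset.map_nsmul, Multiset.sum_nsmul, Multiset.sum_nsmul,
    ← Matrix.trace_pow_eq_sum_roots_charpoly, ← Matrix.trace_pow_eq_sum_roots_charpoly,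
    ← map_pow, ← map_pow, RingHom.mapMatrix_apply, RingHom.mapMatrix_apply]
  have := congrArg f (h k)
  simpa [AddMonoidHom.map_trace, nsmul_eq_mul] using this

/-! ### Matrices over a noncommutative algebra, acting by left multiplication -/

section MatrixAction

variable {A H I J : Type*} [CommRing A] [Ring H] [Algebra A H] [Fintype J]

/-- Left multiplication by a matrix with entries in a noncommutative algebra. -/
def Matrix.mulVecAlg (A : Type*) [CommRing A] [Algebra A H] (B : Matrix I J H) :
    (J → H) →ₗ[A] (I → H) where
  toFun r := B.mulVec r
  map_add' := B.mulVec_add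
  map_smul' a r := by
    ext i
    simp [Matrix.mulVec, dotProduct, Finset.smul_sum]

theorem Matrix.mulVecAlg_apply (B : Matrix I J H) (r : J → H) (i : I) :
    B.mulVecAlg A r i = ∑ j, B i j * r j := rfl

theorem Matrix.mulVecAlg_pow [DecidableEq J] (B : Matrix J J H) (k : ℕ) :
    (B ^ k).mulVecAlg A = (B.mulVecAlg A) ^ k := by
  induction k with
  | zero => ext r i; simp [Matrix.mulVecAlg]
  | succ k ih =>
    rw [pow_succ, pow_succ, ← ih]
    exact LinearMap.ext fun r => (Matrix.mulVec_mulVec r (B ^ k) B).symm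

/-- By cyclicity of the trace, a block (i, j) contributes through the composite of the inclusion of
coordinate i with the projection to coordinate j, which vanishes off the diagonal. -/
theorem Matrix.trace_mulVecAlg [DecidableEq J] [Module.Free A H] [Module.Finite A H]
    (B : Matrix J J H) :
    LinearMap.trace A (J → H) (B.mulVecAlg A) =
      ∑ j, LinearMap.trace A H (LinearMap.mulLeft A (B j j)) := by
  have h : B.mulVecAlg A = ∑ i, ∑ j, LinearMap.single A (fun _ : J => H) i ∘ₗ
      (LinearMap.mulLeft A (B i j) ∘ₗ LinearMap.proj j) := by
    refine LinearMap.ext fun r => funext fun i => ?_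
    simp [Matrix.mulVecAlg_apply, LinearMap.sum_apply, Finset.sum_apply, Pi.single_apply]
  rw [h, map_sum]
  refine Finset.sum_congr rfl fun i _ => ?_
  rw [map_sum, Finset.sum_eq_single i]
  · rw [LinearMap.trace_comp_comm']
    congr 1
    ext x
    simp
  · intro j _ hj
    rw [LinearMap.trace_comp_comm', LinearMap.comp_assoc]
    have : LinearMap.proj j ∘ₗ LinearMap.single A (fun _ : J => H) i = 0 := by
      ext x
      simp [hj]
    rw [this]
    simp
  · simp

/-- Determinants of matrix actions are compatible with a change of algebras that multiplies the
traces of left multiplications by a constant. -/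
theorem Matrix.det_mulVecAlg_map {A' H' : Type*} [CommRing A'] [IsDomain A'] [CharZero A']
    [Ring H'] [Algebra A' H'] [Module.Free A H] [Module.Finite A H] [Module.Free A' H']
    [Module.Finite A' H'] [DecidableEq J] (f : A →+* A') (φ : H →+* H') (N N' : ℕ)
    (hT : ∀ r : H, (N : A') * LinearMap.trace A' H' (LinearMap.mulLeft A' (φ r)) =
      N' * f (LinearMap.trace A H (LinearMap.mulLeft A r))) (B : Matrix J J H) :
    LinearMap.det ((B.map φ).mulVecAlg A') ^ N = f (LinearMap.det (B.mulVecAlg A)) ^ N' := by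
  classical
  let b := Module.Free.chooseBasis A (J → H)
  let b' := Module.Free.chooseBasis A' (J → H')
  rw [← LinearMap.det_toMatrix b, ← LinearMap.det_toMatrix b', RingHom.map_det]
  -- The k-th power of the operator of `B` is the operator of B^k, and its trace is a sum over the
  -- diagonal entries of B^k, to each of which `hT` applies.
  refine Matrix.det_pow_eq_of_trace_pow _ _ _ _ fun k => ?_
  rw [RingHom.mapMatrix_apply, ← Matrix.map_pow, ← AddMonoidHom.map_trace, LinearMap.toMatrix_pow,
    LinearMap.toMatrix_pow, ← LinearMap.trace_eq_matrix_trace, ← LinearMap.trace_eq_matrix_trace,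
    ← Matrix.mulVecAlg_pow, ← Matrix.mulVecAlg_pow, ← Matrix.map_pow, Matrix.trace_mulVecAlg,
    Matrix.trace_mulVecAlg, map_sum, Finset.mul_sum, Finset.mul_sum]
  exact Finset.sum_congr rfl fun j _ => hT _

end MatrixAction

/-! ### Tracial functionals on Clifford-type algebras -/

/-- A tracial functional on an algebra that is generated by anticommuting elements up to scalars,
and that vanishes on `1` and on words of odd length, vanishes on all words. -/
theorem eq_zero_of_tracial {H V B : Type*} [Ring H] [AddCommGroup B] [IsAddTorsionFree B]
    (x : V → H) (T : H →+ B) (Z : Subring H)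
    (hcomm : ∀ r s, T (r * s) = T (s * r))
    (hx : ∀ v w, x v * x w + x w * x v ∈ Z)
    (hZ : ∀ z ∈ Z, ∀ r, z * r = r * z)
    (hT : ∀ r, T r = 0 → ∀ z ∈ Z, T (z * r) = 0)
    (hone : T 1 = 0)
    (hodd : ∀ l : List V, Odd l.length → T (l.map x).prod = 0) (l : List V) :
    T (l.map x).prod = 0 := by
  induction hn : l.length using Nat.strong_induction_on generalizing l with
  | _ n ih =>
  rcases Nat.even_or_odd n with he | ho
  · cases l with
    | nil => simpa using hone
    | cons v l =>
      have hl : Odd l.length := by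
        rw [List.length_cons] at hn
        rw [← hn] at he
        exact Nat.not_even_iff_odd.1 (Nat.even_add_one.1 he)
      -- Moving `x v` to the right past one letter `x w` costs a sign: the anticommutator is central
      -- and leaves a word shorter by two, on which `T` vanishes by induction.
      have move : ∀ l₁ l₂ : List V, l₁.length + l₂.length + 1 = n →
          T (x v * (l₁.map x).prod * (l₂.map x).prod) =
            (-1 : ℤ) ^ l₁.length • T ((l₁.map x).prod * x v * (l₂.map x).prod) := by
        intro l₁
        induction l₁ using List.reverseRecOn with
        | nil => intro l₂ _; simp
        | append_singleton l₁ w ih₁ =>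
          intro l₂ h
          rw [List.length_append, List.length_singleton] at h
          have h1 := ih₁ (w :: l₂) (by rw [List.length_cons]; omega)
          have h2 := ih (l₁ ++ l₂).length (by rw [List.length_append]; omega) (l₁ ++ l₂) rfl
          have h3 := hT _ h2 _ (hx v w)
          rw [List.map_append, List.prod_append, ← mul_assoc, hZ _ (hx v w)] at h3
          have h4 : T ((l₁.map x).prod * x v * ((w :: l₂).map x).prod) =
              - T (((l₁ ++ [w]).map x).prod * x v * (l₂.map x).prod) := by
            rw [eq_neg_iff_add_eq_zero, ← map_add, ← h3]
            congr 1
            simp only [List.map_cons, List.prod_cons, List.map_append, List.prod_append,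
              List.map_nil, List.prod_nil, mul_one]
            noncomm_ring
          rw [h4] at h1
          rw [List.length_append, List.length_singleton, pow_succ]
          simpa [mul_assoc] using h1
      -- Past all the other letters, an odd number of them, the total sign is -1, and cyclicity
      -- brings `x v` back to the front. So the value of `T` on the word equals its own negative.
      have h1 := move l [] (by simpa using hn)
      rw [hl.neg_one_pow] at h1
      simp only [List.map_nil, List.prod_nil, mul_one, neg_smul, one_smul] at h1
      rw [hcomm (l.map x).prod] at h1
      rw [List.map_cons, List.prod_cons]
      exact self_eq_neg.1 h1
  · exact hodd l (hn ▸ ho)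

/-! ### Enveloping algebras: induction principles and functoriality -/

namespace LieSuperalgebra

section EnvelopingMaps

variable {g g' : Type*} [AddCommGroup g] [Module ℂ g] [LieSuperalgebra g]
  [AddCommGroup g'] [Module ℂ g'] [LieSuperalgebra g']

theorem exists_parity_add (x : g) :
    ∃ x0 ∈ parity (g := g) 0, ∃ x1 ∈ parity (g := g) 1, x = x0 + x1 := by
  obtain ⟨x0, h0, x1, h1, h⟩ := Submodule.mem_sup.1
    (show x ∈ parity (g := g) 0 ⊔ parity (g := g) 1 from
      (isCompl_parity (g := g)).sup_eq_top ▸ Submodule.mem_top)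
  exact ⟨x0, h0, x1, h1, h.symm⟩

/-- An additive predicate holds if it holds for homogeneous elements. -/
theorem parity_induction {p : g → Prop} (hadd : ∀ x y, p x → p y → p (x + y))
    (hom : ∀ (i : ZMod 2) (x : g), x ∈ parity (g := g) i → p x) (x : g) : p x := by
  obtain ⟨x0, h0, x1, h1, rfl⟩ := exists_parity_add x
  exact hadd _ _ (hom _ _ h0) (hom _ _ h1)

theorem superSign_comm (i j : ZMod 2) : superSign i j = superSign j i := by
  simp only [superSign, and_comm]

theorem superSign_mul_self (i j : ZMod 2) : superSign i j * superSign i j = 1 := by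
  unfold superSign
  split_ifs <;> simp

theorem mkAlgHom_surjective_env :
    Function.Surjective (RingQuot.mkAlgHom ℂ (EnvRel g) : TensorAlgebra ℂ g →ₐ[ℂ] Env g) :=
  RingQuot.mkAlgHom_surjective ℂ (EnvRel g)

theorem adjoin_range_ι : Algebra.adjoin ℂ (Set.range (ι g)) = ⊤ := by
  rw [eq_top_iff]
  rintro u -
  obtain ⟨t, rfl⟩ := mkAlgHom_surjective_env u
  induction t using TensorAlgebra.induction with
  | algebraMap r =>
    rw [AlgHom.commutes]
    exact Subalgebra.algebraMap_mem _ r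
  | ι x => exact Algebra.subset_adjoin ⟨x, rfl⟩
  | mul a b ha hb => rw [map_mul]; exact mul_mem ha hb
  | add a b ha hb => rw [map_add]; exact add_mem ha hb

/-- A subspace of `U(g)` that contains `1` and is stable under left multiplication by `g`
is everything. -/
theorem eq_top_of_ι_mul_mem (S : Submodule ℂ (Env g)) (h1 : 1 ∈ S)
    (hmul : ∀ (x : g) (u : Env g), u ∈ S → ι g x * u ∈ S) : S = ⊤ := by
  have key : ∀ t : Env g, t ∈ Algebra.adjoin ℂ (Set.range (ι g)) → ∀ u ∈ S, t * u ∈ S := by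
    intro t ht
    induction ht using Algebra.adjoin_induction with
    | mem t ht => obtain ⟨x, rfl⟩ := ht; exact hmul x
    | algebraMap r => intro u hu; rw [← Algebra.smul_def]; exact S.smul_mem r hu
    | add a b _ _ ha hb => intro u hu; rw [add_mul]; exact add_mem (ha u hu) (hb u hu)
    | mul a b _ _ ha hb => intro u hu; rw [mul_assoc]; exact ha _ (hb u hu)
  refine eq_top_iff.2 fun u _ => ?_
  simpa using key u ((adjoin_range_ι (g := g)).symm ▸ Algebra.mem_top) 1 h1

theorem env_induction {p : Env g → Prop} (one : p 1)
    (mul : ∀ (x : g) (u : Env g), p u → p (ι g x * u)) (add : ∀ u v, p u → p v → p (u + v))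
    (smul : ∀ (c : ℂ) (u : Env g), p u → p (c • u)) (u : Env g) : p u := by
  let S : Submodule ℂ (Env g) :=
    { carrier := {u | p u}
      add_mem' := fun {u v} hu hv => add u v hu hv
      zero_mem' := by simpa using smul 0 1 one
      smul_mem' := fun c u hu => smul c u hu }
  have h : u ∈ S := eq_top_of_ι_mul_mem S one mul ▸ Submodule.mem_top
  exact h

theorem env_hom_ext {B : Type*} [Semiring B] [Algebra ℂ B] {f₁ f₂ : Env g →ₐ[ℂ] B}
    (h : ∀ x, f₁ (ι g x) = f₂ (ι g x)) : f₁ = f₂ :=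
  AlgHom.ext_of_adjoin_eq_top (adjoin_range_ι (g := g)) fun _ ⟨x, hx⟩ => hx ▸ h x

theorem envMap_rel (f : Hom g g') {i j : ZMod 2} {x y : g} (hx : x ∈ parity (g := g) i)
    (hy : y ∈ parity (g := g) j) :
    (ι g' ∘ₗ f.toLinearMap) x * (ι g' ∘ₗ f.toLinearMap) y
        - superSign i j • ((ι g' ∘ₗ f.toLinearMap) y * (ι g' ∘ₗ f.toLinearMap) x) =
      (ι g' ∘ₗ f.toLinearMap) (bracket x y) := by
  simp only [LinearMap.comp_apply]
  rw [f.map_bracket, ι_mul_ι (f.map_parity hx) (f.map_parity hy), add_sub_cancel_left]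

/-- The homomorphism of enveloping algebras induced by a homomorphism. -/
noncomputable def envMap (f : Hom g g') : Env g →ₐ[ℂ] Env g' :=
  envLift (ι g' ∘ₗ f.toLinearMap) (envMap_rel f)

@[simp] theorem envMap_ι (f : Hom g g') (x : g) : envMap f (ι g x) = ι g' (f x) :=
  envLift_ι _ (envMap_rel f) x

end EnvelopingMaps

/-! ### Induced modules and the Poincaré-Birkhoff-Witt theorem for g = a ⊕ b -/

/-- A decomposition of `g` as a direct sum of two subalgebras `a` and `b`. -/
structure Splitting (a b g : Type*) [AddCommGroup a] [Module ℂ a] [LieSuperalgebra a]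
    [AddCommGroup b] [Module ℂ b] [LieSuperalgebra b]
    [AddCommGroup g] [Module ℂ g] [LieSuperalgebra g] where
  ia : Hom a g
  ib : Hom b g
  bij : Function.Bijective (ia.toLinearMap.coprod ib.toLinearMap)

namespace Splitting

variable {a b g : Type*} [AddCommGroup a] [Module ℂ a] [LieSuperalgebra a]
    [AddCommGroup b] [Module ℂ b] [LieSuperalgebra b]
    [AddCommGroup g] [Module ℂ g] [LieSuperalgebra g] (D : Splitting a b g)

noncomputable def equiv : (a × b) ≃ₗ[ℂ] g := LinearEquiv.ofBijective _ D.bij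

noncomputable def pa : g →ₗ[ℂ] a := LinearMap.fst ℂ a b ∘ₗ D.equiv.symm.toLinearMap

noncomputable def pb : g →ₗ[ℂ] b := LinearMap.snd ℂ a b ∘ₗ D.equiv.symm.toLinearMap

theorem ia_pa_add_ib_pb (z : g) : D.ia (D.pa z) + D.ib (D.pb z) = z :=
  D.equiv.apply_symm_apply z

theorem proj_eq {z : g} {x : a} {y : b} (h : D.ia x + D.ib y = z) : D.pa z = x ∧ D.pb z = y := by
  have : D.equiv.symm z = (x, y) := D.equiv.symm_apply_eq.2 h.symm
  simp [pa, pb, this]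

@[simp] theorem pa_ia (x : a) : D.pa (D.ia x) = x := (D.proj_eq (x := x) (y := 0) (by simp)).1
@[simp] theorem pb_ia (x : a) : D.pb (D.ia x) = 0 := (D.proj_eq (x := x) (y := 0) (by simp)).2
@[simp] theorem pa_ib (y : b) : D.pa (D.ib y) = 0 := (D.proj_eq (x := 0) (y := y) (by simp)).1
@[simp] theorem pb_ib (y : b) : D.pb (D.ib y) = y := (D.proj_eq (x := 0) (y := y) (by simp)).2

/-- Both inclusions are even, so the parts of the wrong parity of the two components of `z` add up
to the part of the wrong parity of `z`, which is 0. The decomposition of `z` is unique. -/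
theorem proj_mem {i : ZMod 2} {z : g} (hz : z ∈ parity (g := g) i) :
    D.pa z ∈ parity (g := a) i ∧ D.pb z ∈ parity (g := b) i := by
  have hd := (isCompl_parity (g := g)).disjoint
  rw [Submodule.disjoint_def] at hd
  obtain ⟨x0, hx0, x1, hx1, hx⟩ := exists_parity_add (D.pa z)
  obtain ⟨y0, hy0, y1, hy1, hy⟩ := exists_parity_add (D.pb z)
  have h0 : D.ia x0 + D.ib y0 ∈ parity (g := g) 0 :=
    add_mem (D.ia.map_parity hx0) (D.ib.map_parity hy0)
  have h1 : D.ia x1 + D.ib y1 ∈ parity (g := g) 1 :=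
    add_mem (D.ia.map_parity hx1) (D.ib.map_parity hy1)
  have e : (D.ia x0 + D.ib y0) + (D.ia x1 + D.ib y1) = z := by
    rw [← D.ia_pa_add_ib_pb z, hx, hy, map_add, map_add]
    abel
  rcases parity_cases i with rfl | rfl
  · have hz1 : D.ia x1 + D.ib y1 = 0 := by
      refine hd _ ?_ h1
      rw [← eq_sub_iff_add_eq'] at e
      exact e ▸ sub_mem hz h0
    rw [hz1, add_zero] at e
    rw [(D.proj_eq e).1, (D.proj_eq e).2]
    exact ⟨hx0, hy0⟩
  · have hz1 : D.ia x0 + D.ib y0 = 0 := by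
      refine hd _ h0 ?_
      rw [← eq_sub_iff_add_eq] at e
      exact e ▸ sub_mem hz h1
    rw [hz1, zero_add] at e
    rw [(D.proj_eq e).1, (D.proj_eq e).2]
    exact ⟨hx1, hy1⟩

section Action

variable {N : Type*} [AddCommGroup N] [Module ℂ N] (L : Env a →ₐ[ℂ] Module.End ℂ N)

/-- Given a `U(a)`-module `N`, the space `N × Hom(b, N)` with the action of `a` for which the pairs
`(m, y ↦ y m)` form a submodule whenever `N` is a `g`-module. -/
noncomputable def jetAction : a →ₗ[ℂ] Module.End ℂ (N × (b →ₗ[ℂ] N)) :=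
  -- The halves of `x ± parityInv a x` are the even and the odd part of `x`. Pairing the odd part
  -- with `parityInv b` produces the sign (-1)^{p(x)p(y)} by a formula that is linear in `x` and
  -- `y`. The remaining terms come from [y, x]: its component in a acts on m, and its component in b
  -- is inserted into the function y ↦ y m.
  LinearMap.mk₂ ℂ (fun x q => (L (ι a x) q.1,
    (1 / 2 : ℂ) • (L (ι a (x + parityInv a x)) ∘ₗ q.2
      + L (ι a (x - parityInv a x)) ∘ₗ q.2 ∘ₗ parityInv b)
    + (LinearMap.applyₗ q.1) ∘ₗ L.toLinearMap ∘ₗ ι a ∘ₗ D.pa ∘ₗ bracket.flip (D.ia x) ∘ₗ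
        D.ib.toLinearMap
    + q.2 ∘ₗ D.pb ∘ₗ bracket.flip (D.ia x) ∘ₗ D.ib.toLinearMap))
    (by
      intro x x' q
      refine Prod.ext (by simp) (LinearMap.ext fun y => ?_)
      simp
      module)
    (by
      intro c x q
      refine Prod.ext (by simp) (LinearMap.ext fun y => ?_)
      simp
      module)
    (by
      intro x q q'
      refine Prod.ext (by simp) (LinearMap.ext fun y => ?_)
      simp
      module)
    (by
      intro c x q
      refine Prod.ext (by simp) (LinearMap.ext fun y => ?_)
      simp
      module)

theorem jetAction_fst (x : a) (q : N × (b →ₗ[ℂ] N)) :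
    (D.jetAction L x q).1 = L (ι a x) q.1 := rfl

/-- For q = (m, y ↦ y m) this is the rule y(xm) = ± x(ym) + [y, x]m. -/
theorem jetAction_snd {i j : ZMod 2} {x : a} {y : b} (hx : x ∈ parity (g := a) i)
    (hy : y ∈ parity (g := b) j) (q : N × (b →ₗ[ℂ] N)) :
    (D.jetAction L x q).2 y = superSign i j • L (ι a x) (q.2 y)
      + L (ι a (D.pa (bracket (D.ib y) (D.ia x)))) q.1
      + q.2 (D.pb (bracket (D.ib y) (D.ia x))) := by
  have : (D.jetAction L x q).2 y = (1 / 2 : ℂ) • (L (ι a (x + parityInv a x)) (q.2 y)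
      + L (ι a (x - parityInv a x)) (q.2 (parityInv b y)))
      + L (ι a (D.pa (bracket (D.ib y) (D.ia x)))) q.1
      + q.2 (D.pb (bracket (D.ib y) (D.ia x))) := rfl
  rw [this, parityInv_apply hx, parityInv_apply hy]
  congr 2
  rcases parity_cases i with rfl | rfl <;> rcases parity_cases j with rfl | rfl <;>
    simp [superSign] <;> module

/-- In the first component this is the relation in U(a). In the second it is the Jacobi identity for
y, x, x', after [y, x] and [y, x'] have been split into their components in a and b. -/
theorem jetAction_rel {i i' : ZMod 2} {x x' : a} (hx : x ∈ parity (g := a) i)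
    (hx' : x' ∈ parity (g := a) i') :
    D.jetAction L x * D.jetAction L x' - superSign i i' • (D.jetAction L x' * D.jetAction L x) =
      D.jetAction L (bracket x x') := by
  refine LinearMap.ext fun q => Prod.ext ?_ (LinearMap.ext fun y => ?_)
  · have h := congrArg (fun u => L u q.1) (ι_mul_ι hx hx')
    simp only [map_mul, map_add, map_smul, LinearMap.add_apply, LinearMap.smul_apply,
      Module.End.mul_apply] at h
    simp only [LinearMap.sub_apply, LinearMap.smul_apply, Module.End.mul_apply, Prod.fst_sub,
      Prod.smul_fst, jetAction_fst]
    rw [h]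
    abel
  · induction y using parity_induction with
    | hadd y y' h h' => rw [map_add, map_add, h, h']
    | hom j y hy =>
    have hyx := D.proj_mem (bracket_mem (D.ib.map_parity hy) (D.ia.map_parity hx))
    have hyx' := D.proj_mem (bracket_mem (D.ib.map_parity hy) (D.ia.map_parity hx'))
    have hb := bracket_mem hx hx'
    simp only [LinearMap.sub_apply, LinearMap.smul_apply, Module.End.mul_apply, Prod.snd_sub,
      Prod.smul_snd]
    rw [D.jetAction_snd L hx hy, D.jetAction_snd L hx' hy, D.jetAction_snd L hb hy,
      D.jetAction_snd L hx' hy, D.jetAction_snd L hx hy, D.jetAction_snd L hx' hyx.2,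
      D.jetAction_snd L hx hyx'.2, jetAction_fst, jetAction_fst, D.ia.map_bracket]
    have hJ := jacobi (D.ia x') (D.ib.map_parity hy) (D.ia.map_parity hx)
    have hm : ∀ {k k' : ZMod 2} {z z' : a} (_ : z ∈ parity (g := a) k)
        (_ : z' ∈ parity (g := a) k') (m : N), L (ι a z) (L (ι a z') m) =
        superSign k k' • L (ι a z') (L (ι a z) m) + L (ι a (bracket z z')) m := by
      intro k k' z z' hz hz' m
      have h := congrArg (fun u => L u m) (ι_mul_ι hz hz')
      simpa only [map_mul, map_add, map_smul, LinearMap.add_apply, LinearMap.smul_apply,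
        Module.End.mul_apply] using h
    have split : ∀ {k l : ZMod 2} {z : g} {w : a}, z ∈ parity (g := g) k →
        w ∈ parity (g := a) l → bracket z (D.ia w) =
          D.ia (bracket (D.pa z) w) + bracket (D.ib (D.pb z)) (D.ia w) := by
      intro k l z w hz hw
      conv_lhs => rw [← D.ia_pa_add_ib_pb z]
      rw [map_add, LinearMap.add_apply, D.ia.map_bracket]
    have hyx0 := bracket_mem (D.ib.map_parity hy) (D.ia.map_parity hx)
    have hyx0' := bracket_mem (D.ib.map_parity hy) (D.ia.map_parity hx')
    rw [skew (D.ia.map_parity hx) hyx0', split hyx0 hx', split hyx0' hx] at hJ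
    have hJa := congrArg D.pa hJ
    have hJb := congrArg D.pb hJ
    simp only [map_add, map_neg, map_smul, pa_ia, pb_ia, zero_add] at hJa hJb
    rw [hJa, hJb]
    simp only [map_add, map_smul, map_neg]
    rw [hm hx hx', hm hyx.1 hx', hm hyx'.1 hx]
    simp only [LinearMap.add_apply, LinearMap.smul_apply, LinearMap.neg_apply]
    rcases parity_cases i with rfl | rfl <;> rcases parity_cases i' with rfl | rfl <;>
      rcases parity_cases j with rfl | rfl <;>
      simp only [superSign, zero_add, add_zero, zero_ne_one, and_false, and_true,
        if_true, if_false, one_smul, neg_smul, CharTwo.add_self_eq_zero] <;> abel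

/-- The `U(a)`-module structure on `N × Hom(b, N)`. -/
noncomputable def jetRep : Env a →ₐ[ℂ] Module.End ℂ (N × (b →ₗ[ℂ] N)) :=
  envLift (D.jetAction L) (D.jetAction_rel L)

theorem jetRep_ι (x : a) : D.jetRep L (ι a x) = D.jetAction L x :=
  envLift_ι _ (D.jetAction_rel L) x

theorem jetRep_fst (p : Env a) (q : N × (b →ₗ[ℂ] N)) : (D.jetRep L p q).1 = L p q.1 := by
  induction p using env_induction with
  | one => simp
  | mul x u h =>
    rw [map_mul, map_mul, Module.End.mul_apply, Module.End.mul_apply, jetRep_ι, jetAction_fst, h]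
  | add u v h h' => simp [h, h']
  | smul c u h => simp [h]

end Action

section Induced

open TensorProduct

variable {W : Type*} [AddCommGroup W] [Module ℂ W] (β : Env b →ₐ[ℂ] Module.End ℂ W)

variable (a W) in
/-- `U(a)` acting on the left factor of `U(a) ⊗ W`. -/
noncomputable def leftRep : Env a →ₐ[ℂ] Module.End ℂ (Env a ⊗[ℂ] W) :=
  (Module.End.rTensorAlgHom ℂ (Env a) W).comp (Algebra.lmul ℂ (Env a))

@[simp] theorem leftRep_tmul (p q : Env a) (w : W) :
    leftRep a W p (q ⊗ₜ w) = (p * q) ⊗ₜ w := rfl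

/-- The pairs `(m, y ↦ y m)` for `m = 1 ⊗ w`. -/
noncomputable def jetBase : W →ₗ[ℂ] (Env a ⊗[ℂ] W) × (b →ₗ[ℂ] Env a ⊗[ℂ] W) :=
  (TensorProduct.mk ℂ (Env a) W 1).prod
    ((LinearMap.compRight ℂ (TensorProduct.mk ℂ (Env a) W 1)) ∘ₗ
      (β.toLinearMap ∘ₗ ι b).flip)

/-- The pairs `(m, y ↦ y m)` for all `m` in `U(a) ⊗ W`. -/
noncomputable def jet : Env a ⊗[ℂ] W →ₗ[ℂ] (Env a ⊗[ℂ] W) × (b →ₗ[ℂ] Env a ⊗[ℂ] W) :=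
  TensorProduct.lift (LinearMap.compl₂ (D.jetRep (leftRep a W)).toLinearMap (jetBase β))

theorem jet_tmul (p : Env a) (w : W) :
    D.jet β (p ⊗ₜ w) = D.jetRep (leftRep a W) p (jetBase β w) := rfl

theorem jet_fst (m : Env a ⊗[ℂ] W) : (D.jet β m).1 = m := by
  induction m using TensorProduct.induction_on with
  | zero => simp
  | tmul p w => rw [jet_tmul, jetRep_fst]; simp [jetBase]
  | add m m' h h' => rw [map_add, Prod.fst_add, h, h']

theorem jet_leftRep (x : a) (m : Env a ⊗[ℂ] W) :
    D.jet β (leftRep a W (ι a x) m) = D.jetAction (leftRep a W) x (D.jet β m) := by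
  induction m using TensorProduct.induction_on with
  | zero => simp
  | tmul p w => rw [leftRep_tmul, jet_tmul, map_mul, Module.End.mul_apply, jetRep_ι, jet_tmul]
  | add m m' h h' => rw [map_add, map_add, map_add, map_add, h, h']

/-- The action of `b` on `U(a) ⊗ W`. -/
noncomputable def rightAct : b →ₗ[ℂ] Module.End ℂ (Env a ⊗[ℂ] W) :=
  (LinearMap.snd ℂ _ _ ∘ₗ D.jet β).flip

theorem rightAct_one (y : b) (w : W) :
    D.rightAct β y ((1 : Env a) ⊗ₜ w) = 1 ⊗ₜ β (ι b y) w := by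
  have : D.rightAct β y ((1 : Env a) ⊗ₜ w) = (D.jet β (1 ⊗ₜ w)).2 y := rfl
  rw [this, jet_tmul, map_one]
  rfl

/-- The action of `g` on `U(a) ⊗ W`. -/
noncomputable def act : g →ₗ[ℂ] Module.End ℂ (Env a ⊗[ℂ] W) :=
  (leftRep a W).toLinearMap ∘ₗ ι a ∘ₗ D.pa + D.rightAct β ∘ₗ D.pb

theorem act_apply (z : g) (m : Env a ⊗[ℂ] W) :
    D.act β z m = leftRep a W (ι a (D.pa z)) m + D.rightAct β (D.pb z) m := rfl

theorem act_ia (x : a) : D.act β (D.ia x) = leftRep a W (ι a x) := by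
  exact LinearMap.ext fun m => by simp [act_apply]

theorem act_ib (y : b) : D.act β (D.ib y) = D.rightAct β y := by
  exact LinearMap.ext fun m => by simp [act_apply]

/-- The action of b is the second component of `jet`, and `jet` is compatible with the actions of a;
so the rule coded in `jetAction_snd` becomes a genuine commutation relation. -/
theorem act_ib_leftRep {i j : ZMod 2} {x : a} {y : b} (hx : x ∈ parity (g := a) i)
    (hy : y ∈ parity (g := b) j) (m : Env a ⊗[ℂ] W) :
    D.act β (D.ib y) (leftRep a W (ι a x) m) =
      superSign i j • leftRep a W (ι a x) (D.act β (D.ib y) m) +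
        D.act β (bracket (D.ib y) (D.ia x)) m := by
  have e : ∀ (y : b) (m : Env a ⊗[ℂ] W), D.act β (D.ib y) m = (D.jet β m).2 y := by
    intro y m
    rw [act_ib]
    rfl
  have e' : ∀ (y : b) (m : Env a ⊗[ℂ] W), D.rightAct β y m = (D.jet β m).2 y := fun _ _ => rfl
  rw [e, e, jet_leftRep, D.jetAction_snd _ hx hy, jet_fst, act_apply, e', add_assoc]

/-- The component of `z` in a is covered by `act_ib_leftRep`, so only relations inside b are needed,
and only at the vector `m`. This pointwise form is what the induction in `act_rel_ib` can supply,
where `z` is a bracket of elements of b and a. -/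
theorem act_rel_right {j k : ZMod 2} {y : b} {z : g} (hy : y ∈ parity (g := b) j)
    (hz : z ∈ parity (g := g) k) (m : Env a ⊗[ℂ] W)
    (hm : ∀ {k : ZMod 2} {y' : b}, y' ∈ parity (g := b) k →
      D.act β (D.ib y) (D.act β (D.ib y') m) =
        superSign j k • D.act β (D.ib y') (D.act β (D.ib y) m) +
          D.act β (bracket (D.ib y) (D.ib y')) m) :
    D.act β (D.ib y) (D.act β z m) = superSign j k • D.act β z (D.act β (D.ib y) m) +
      D.act β (bracket (D.ib y) z) m := by
  have hz' := D.proj_mem hz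
  have e : ∀ m, D.act β z m = leftRep a W (ι a (D.pa z)) m + D.act β (D.ib (D.pb z)) m := by
    intro m
    rw [act_ib, act_apply]
  have e2 : bracket (D.ib y) z = bracket (D.ib y) (D.ia (D.pa z)) +
      bracket (D.ib y) (D.ib (D.pb z)) := by
    rw [← map_add, ia_pa_add_ib_pb]
  rw [e, e, map_add, D.act_ib_leftRep β hz'.1 hy, hm hz'.2, e2, map_add, superSign_comm k j,
    LinearMap.add_apply, smul_add]
  abel

/-- The sign bookkeeping of `act_rel_ib`, with the vectors abstracted so that each choice of
parities leaves an identity in an abelian group. -/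
theorem superSign_jacobi_smul {M : Type*} [AddCommGroup M] [Module ℂ M] (i j k : ZMod 2)
    (n1 n2 n3 n4 n5 n6 : M) :
    superSign i k • (superSign i j • (superSign j k • n1 + n4) + n2) +
        (superSign j (k + i) • n3 + (n5 + superSign j k • n6)) =
      superSign j k • (superSign i j • (superSign i k • n1 + n3) +
        (superSign k (j + i) • n2 + n6)) + (superSign i (j + k) • n4 + n5) := by
  rcases parity_cases i with rfl | rfl <;> rcases parity_cases j with rfl | rfl <;>
    rcases parity_cases k with rfl | rfl <;>
    simp only [superSign, zero_add, add_zero, zero_ne_one, and_false, and_true,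
      if_true, if_false, one_smul, neg_smul, CharTwo.add_self_eq_zero] <;> abel

/-- Induction on the factor in U(a). At 1 ⊗ w it is the relation for the b-module W. From m to xm,
all operators are moved past x by `act_ib_leftRep`, and the bracket terms match by the Jacobi
identity for y, y', x. -/
theorem act_rel_ib {j k : ZMod 2} {y y' : b} (hy : y ∈ parity (g := b) j)
    (hy' : y' ∈ parity (g := b) k) (m : Env a ⊗[ℂ] W) :
    D.act β (D.ib y) (D.act β (D.ib y') m) =
      superSign j k • D.act β (D.ib y') (D.act β (D.ib y) m) +
        D.act β (bracket (D.ib y) (D.ib y')) m := by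
  induction m using TensorProduct.induction_on with
  | zero => simp
  | add m m' h h' => simp only [map_add, smul_add, h, h']; abel
  | tmul p w =>
  induction p using env_induction generalizing j k y y' w with
  | add u v h h' =>
    simp only [TensorProduct.add_tmul, map_add, smul_add, h hy hy', h' hy hy']; abel
  | smul c u h =>
    rw [← TensorProduct.smul_tmul']
    simp only [map_smul, h hy hy', smul_add]
    rw [smul_comm]
  | one =>
    rw [← D.ib.map_bracket]
    simp only [act_ib, rightAct_one]
    have h := congrArg (fun u => β u w) (ι_mul_ι hy hy')
    simp only [map_mul, map_add, map_smul, LinearMap.add_apply, LinearMap.smul_apply,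
      Module.End.mul_apply] at h
    rw [h, TensorProduct.tmul_add, TensorProduct.tmul_smul]
  | mul x u ih =>
    rw [← leftRep_tmul]
    set m : Env a ⊗[ℂ] W := u ⊗ₜ w
    induction x using parity_induction with
    | hadd x x' h h' =>
      simp only [map_add, LinearMap.add_apply, smul_add, h, h']; abel
    | hom i x hx =>
    have A := fun {j : ZMod 2} {y : b} (hy : y ∈ parity (g := b) j) m =>
      D.act_ib_leftRep β hx hy m
    have hyx := bracket_mem (D.ib.map_parity hy) (D.ia.map_parity hx)
    have hyx' := bracket_mem (D.ib.map_parity hy') (D.ia.map_parity hx)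
    have hyy : bracket (D.ib y) (D.ib y') = D.ib (bracket y y') := (D.ib.map_bracket _ _).symm
    have A3 := A (bracket_mem hy hy') m
    have hJ := congrArg (fun z => D.act β z m)
      (jacobi (D.ia x) (D.ib.map_parity hy) (D.ib.map_parity hy'))
    simp only [map_add, map_smul, LinearMap.add_apply, LinearMap.smul_apply] at hJ
    rw [A hy, A hy', map_add, map_smul, A hy, D.act_rel_right β hy hyx' m fun h => ih hy h w,
      show D.act β (D.ib y) (D.act β (D.ib y') m) = _ from ih hy hy' w,
      map_add (D.act β (D.ib y')), map_smul (D.act β (D.ib y')), A hy', D.act_rel_right β hy' hyx m fun h => ih hy' h w]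
    rw [hyy, A3, ← hyy, hJ]
    simp only [map_add, map_smul]
    generalize leftRep a W (ι a x) (D.act β (D.ib y') (D.act β (D.ib y) m)) = n1
    generalize D.act β (bracket (D.ib y) (D.ia x)) (D.act β (D.ib y') m) = n2
    generalize D.act β (bracket (D.ib y') (D.ia x)) (D.act β (D.ib y) m) = n3
    generalize leftRep a W (ι a x) (D.act β (bracket (D.ib y) (D.ib y')) m) = n4
    generalize D.act β (bracket (bracket (D.ib y) (D.ib y')) (D.ia x)) m = n5
    generalize D.act β (bracket (D.ib y') (bracket (D.ib y) (D.ia x))) m = n6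
    exact superSign_jacobi_smul i j k n1 n2 n3 n4 n5 n6

theorem act_rel {j k : ZMod 2} {z z' : g} (hz : z ∈ parity (g := g) j)
    (hz' : z' ∈ parity (g := g) k) :
    D.act β z * D.act β z' - superSign j k • (D.act β z' * D.act β z) =
      D.act β (bracket z z') := by
  refine LinearMap.ext fun m => ?_
  have h1 := D.proj_mem hz
  have h2 := D.proj_mem hz'
  have hbb : ∀ {l : ZMod 2} {w : g} (_ : w ∈ parity (g := g) l) {i : ZMod 2} {y : b}
      (_ : y ∈ parity (g := b) i), D.act β (D.ib y) (D.act β w m) =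
        superSign i l • D.act β w (D.act β (D.ib y) m) + D.act β (bracket (D.ib y) w) m :=
    fun hw _ _ hy => D.act_rel_right β hy hw m fun hy' => D.act_rel_ib β hy hy' m
  have haa : D.act β (D.ia (D.pa z)) (D.act β (D.ia (D.pa z')) m) =
      superSign j k • D.act β (D.ia (D.pa z')) (D.act β (D.ia (D.pa z)) m) +
        D.act β (bracket (D.ia (D.pa z)) (D.ia (D.pa z'))) m := by
    rw [← D.ia.map_bracket]
    simp only [act_ia]
    have h := congrArg (fun u => leftRep a W u m) (ι_mul_ι h1.1 h2.1)
    simpa only [map_mul, map_add, map_smul, LinearMap.add_apply, LinearMap.smul_apply,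
      Module.End.mul_apply] using h
  have hab : D.act β (D.ia (D.pa z)) (D.act β (D.ib (D.pb z')) m) =
      superSign j k • D.act β (D.ib (D.pb z')) (D.act β (D.ia (D.pa z)) m) +
        D.act β (bracket (D.ia (D.pa z)) (D.ib (D.pb z'))) m := by
    rw [D.act_ia, D.act_ib_leftRep β h1.1 h2.2,
      skew (D.ia.map_parity h1.1) (D.ib.map_parity h2.2), smul_add, smul_smul,
      superSign_mul_self, map_neg, map_smul]
    simp
  have hb := hbb hz' h1.2
  have e : ∀ n, D.act β z n = D.act β (D.ia (D.pa z)) n + D.act β (D.ib (D.pb z)) n := by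
    intro n
    rw [← LinearMap.add_apply, ← map_add, ia_pa_add_ib_pb]
  have e' : ∀ n, D.act β z' n = D.act β (D.ia (D.pa z')) n + D.act β (D.ib (D.pb z')) n := by
    intro n
    rw [← LinearMap.add_apply, ← map_add, ia_pa_add_ib_pb]
  have ez : bracket z z' = bracket (D.ia (D.pa z)) (D.ia (D.pa z')) +
      bracket (D.ia (D.pa z)) (D.ib (D.pb z')) + bracket (D.ib (D.pb z)) z' := by
    conv_lhs => rw [← D.ia_pa_add_ib_pb z]
    rw [map_add, LinearMap.add_apply, ← map_add, ia_pa_add_ib_pb]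
  simp only [LinearMap.sub_apply, LinearMap.smul_apply, Module.End.mul_apply]
  rw [e (D.act β z' m), e m, hb, map_add, e' m, map_add, haa, hab, ez, map_add, map_add, e',
    LinearMap.add_apply, LinearMap.add_apply, e']
  module

/-- The `g`-module `U(a) ⊗ W` induced from a `b`-module `W`. -/
noncomputable def induced : Env g →ₐ[ℂ] Module.End ℂ (Env a ⊗[ℂ] W) :=
  envLift (B := Module.End ℂ (Env a ⊗[ℂ] W)) (D.act β) (D.act_rel β)

theorem induced_ι (z : g) : D.induced β (ι g z) = D.act β z :=
  envLift_ι (B := Module.End ℂ (Env a ⊗[ℂ] W)) _ (D.act_rel β) z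

theorem induced_envMap_ia (p q : Env a) (w : W) :
    D.induced β (envMap D.ia p) (q ⊗ₜ w) = (p * q) ⊗ₜ w := by
  have h : (D.induced β).comp (envMap D.ia) = leftRep a W :=
    env_hom_ext fun x => by rw [AlgHom.comp_apply, envMap_ι, induced_ι, act_ia]
  rw [← leftRep_tmul, ← h]
  rfl

theorem induced_envMap_ib (q : Env b) (w : W) :
    D.induced β (envMap D.ib q) ((1 : Env a) ⊗ₜ w) = 1 ⊗ₜ β q w := by
  induction q using env_induction generalizing w with
  | one => simp
  | mul y u h =>
    rw [map_mul, map_mul (D.induced β), Module.End.mul_apply, h, envMap_ι, induced_ι, act_ib,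
      rightAct_one, map_mul β, Module.End.mul_apply]
  | add u v h h' => simp only [map_add, LinearMap.add_apply, h, h', TensorProduct.tmul_add]
  | smul c u h => simp only [map_smul, LinearMap.smul_apply, h, TensorProduct.tmul_smul]

end Induced

/-- `U(g)` is spanned by the products `p q` with `p ∈ U(a)` and `q ∈ U(b)`. -/
theorem span_mul_eq_top :
    Submodule.span ℂ {u | ∃ p q, u = envMap D.ia p * envMap D.ib q} = ⊤ := by
  set S := Submodule.span ℂ {u | ∃ p q, u = envMap D.ia p * envMap D.ib q} with hS
  have hmem : ∀ p q, envMap D.ia p * envMap D.ib q ∈ S := fun p q =>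
    Submodule.subset_span ⟨p, q, rfl⟩
  have hx : ∀ (x : a) (u : Env g), u ∈ S → ι g (D.ia x) * u ∈ S := by
    intro x u hu
    induction hu using Submodule.span_induction with
    | mem u hu =>
      obtain ⟨p, q, rfl⟩ := hu
      rw [← mul_assoc, ← envMap_ι, ← map_mul]
      exact hmem _ _
    | zero => simp
    | add u v _ _ hu hv => rw [mul_add]; exact add_mem hu hv
    | smul c u _ hu => rw [mul_smul_comm]; exact S.smul_mem c hu
  -- An element of b is moved to the right through U(a). Each commutator [y, x] has components in a
  -- and b again, so the induction on `p` is for all `y` simultaneously.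
  have hy : ∀ (p : Env a) (q : Env b) (y : b),
      ι g (D.ib y) * (envMap D.ia p * envMap D.ib q) ∈ S := by
    intro p q
    induction p using env_induction with
    | one =>
      intro y
      have := hmem 1 (ι b y * q)
      simpa using this
    | add u v hu hv => intro y; rw [map_add, add_mul, mul_add]; exact add_mem (hu y) (hv y)
    | smul c u hu =>
      intro y
      rw [map_smul, smul_mul_assoc, mul_smul_comm]
      exact S.smul_mem c (hu y)
    | mul x u hu =>
      intro y
      induction x using parity_induction with
      | hadd x x' h h' =>
        rw [map_add, add_mul, map_add, add_mul, mul_add]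
        exact add_mem h h'
      | hom i x hxi =>
      induction y using parity_induction with
      | hadd y y' h h' => rw [map_add, map_add, add_mul]; exact add_mem h h'
      | hom j y hyj =>
      rw [map_mul, envMap_ι, mul_assoc, ← mul_assoc,
        ι_mul_ι (D.ib.map_parity hyj) (D.ia.map_parity hxi), add_mul, smul_mul_assoc, mul_assoc]
      refine add_mem (S.smul_mem _ (hx _ _ (hu y))) ?_
      rw [← D.ia_pa_add_ib_pb (bracket (D.ib y) (D.ia x)), map_add, add_mul]
      exact add_mem (hx _ _ (hmem _ _)) (hu _)
  refine eq_top_of_ι_mul_mem S (by simpa using hmem 1 1) fun z u hu => ?_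
  rw [← D.ia_pa_add_ib_pb z, map_add, add_mul]
  refine add_mem (hx _ _ hu) ?_
  induction hu using Submodule.span_induction with
  | mem u hu => obtain ⟨p, q, rfl⟩ := hu; exact hy p q _
  | zero => simp
  | add u v _ _ hu hv => rw [mul_add]; exact add_mem hu hv
  | smul c u _ hu => rw [mul_smul_comm]; exact S.smul_mem c hu

end Splitting
end LieSuperalgebra

/-! ### Graded subalgebras, positivity of roots and the projection b⁺ → h -/

namespace LieSuperalgebra

section Subalgebras

variable {g : Type*} [AddCommGroup g] [Module ℂ g] [LieSuperalgebra g]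

/-- Graded subalgebras of a Lie superalgebra. -/
class IsSubalg (s : Submodule ℂ g) : Prop where
  graded : s ≤ (s ⊓ parity 0) ⊔ (s ⊓ parity 1)
  bracket_mem' : ∀ {x y : g}, x ∈ s → y ∈ s → bracket x y ∈ s

instance instSubalg (s : Submodule ℂ g) [hs : IsSubalg s] : LieSuperalgebra s where
  parity i := (parity i).comap s.subtype
  isCompl_parity := by
    refine ⟨?_, ?_⟩
    · rw [Submodule.disjoint_def]
      intro x h0 h1
      exact Subtype.ext (Submodule.disjoint_def.1 (isCompl_parity (g := g)).disjoint _ h0 h1)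
    · rw [codisjoint_iff, eq_top_iff]
      rintro ⟨x, hx⟩ -
      obtain ⟨x0, h0, x1, h1, rfl⟩ := Submodule.mem_sup.1 (hs.graded hx)
      exact Submodule.mem_sup.2 ⟨⟨x0, h0.1⟩, h0.2, ⟨x1, h1.1⟩, h1.2, rfl⟩
  bracket := LinearMap.mk₂ ℂ (fun x y => ⟨bracket (x : g) (y : g), hs.bracket_mem' x.2 y.2⟩)
    (fun x x' y => Subtype.ext (by simp)) (fun c x y => Subtype.ext (by simp))
    (fun x y y' => Subtype.ext (by simp)) (fun c x y => Subtype.ext (by simp))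
  bracket_mem := fun hx hy => bracket_mem (g := g) hx hy
  skew := fun hx hy => Subtype.ext (skew (g := g) hx hy)
  jacobi := fun z hx hy => Subtype.ext (jacobi (g := g) (z : g) hx hy)

/-- The inclusion of a graded subalgebra. -/
def incl (s : Submodule ℂ g) [IsSubalg s] : Hom s g where
  toLinearMap := s.subtype
  map_parity := fun h => h
  map_bracket := fun _ _ => rfl

@[simp] theorem incl_apply (s : Submodule ℂ g) [IsSubalg s] (x : s) : incl s x = (x : g) := rfl

/-- Two complementary graded subalgebras. -/
def Splitting.ofIsCompl (s t : Submodule ℂ g) [IsSubalg s] [IsSubalg t] (h : IsCompl s t) :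
    Splitting s t g where
  ia := incl s
  ib := incl t
  bij := (Submodule.prodEquivOfIsCompl s t h).bijective

end Subalgebras

namespace TriangularDecomposition

variable {g : Type*} [AddCommGroup g] [Module ℂ g] [LieSuperalgebra g]
  {Q : Type*} [AddCommGroup Q] (D : TriangularDecomposition g Q)

instance : IsSubalg D.h where
  graded := (D.wt_graded 0).le
  bracket_mem' hx hy := by
    have := D.bracket_mem_wt hx hy
    rwa [add_zero] at this

section Positivity

/-- Otherwise all multiples of `m` would be partitions of 0, and there are only finitely many of
these. -/
theorem sum_pos_ne_zero {m : Q →₀ ℕ} (hm : (m.support : Set Q) ⊆ D.pos) (h0 : m ≠ 0) :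
    m.sum (fun α k => k • α) ≠ 0 := by
  intro hs
  have hinj : Function.Injective fun k : ℕ => k • m := fun k l hkl => by
    obtain ⟨α, hα⟩ := Finsupp.ne_iff.1 h0
    have := DFunLike.congr_fun hkl α
    simpa [show m α ≠ 0 from hα] using this
  refine Set.infinite_of_injective_forall_mem hinj (fun k => ?_) (D.finite_partitions 0)
  refine ⟨fun α hα => hm ?_, ?_⟩
  · simp only [Finset.mem_coe, Finsupp.mem_support_iff, Finsupp.smul_apply] at hα ⊢
    exact fun h => hα (by simp [h])
  · rw [Finsupp.sum_smul_index' (by simp)]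
    simp only [smul_eq_mul, mul_smul]
    rw [← Finsupp.smul_sum, hs, smul_zero]

variable {D}

/-- Three summands suffice below: if the sum of two degrees left `pos`, `neg` or one of their
complements, then a sum of at most three positive roots would vanish. -/
theorem pos_add_pos_add_pos_ne_zero {α β γ : Q} (hα : α ∈ D.pos) (hβ : β ∈ D.pos)
    (hγ : γ ∈ D.pos) : α + β + γ ≠ 0 := by
  classical
  have := D.sum_pos_ne_zero
    (m := Finsupp.single α 1 + Finsupp.single β 1 + Finsupp.single γ 1) ?_ ?_
  · rw [Finsupp.sum_add_index' (by simp) (by intros; rw [add_smul]),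
      Finsupp.sum_add_index' (by simp) (by intros; rw [add_smul])] at this
    simpa using this
  · intro x hx
    have := Finsupp.support_add (Finset.mem_coe.1 hx)
    rcases Finset.mem_union.1 this with h | h
    · rcases Finset.mem_union.1 (Finsupp.support_add h) with h | h
      · rw [Finset.mem_singleton.1 (Finsupp.support_single_subset h)]; exact hα
      · rw [Finset.mem_singleton.1 (Finsupp.support_single_subset h)]; exact hβ
    · rw [Finset.mem_singleton.1 (Finsupp.support_single_subset h)]; exact hγ
  · intro h
    have := DFunLike.congr_fun h γ
    simp at this

theorem pos_ne_zero {α : Q} (hα : α ∈ D.pos) : α ≠ 0 := fun h =>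
  pos_add_pos_add_pos_ne_zero hα hα hα (by simp [h])

theorem pos_add_pos_ne_zero {α β : Q} (hα : α ∈ D.pos) (hβ : β ∈ D.pos) : α + β ≠ 0 := by
  intro h
  refine D.sum_pos_ne_zero (m := Finsupp.single α 1 + Finsupp.single β 1) ?_ ?_ ?_
  · classical
    intro x hx
    rcases Finset.mem_union.1 (Finsupp.support_add (Finset.mem_coe.1 hx)) with h | h
    · rw [Finset.mem_singleton.1 (Finsupp.support_single_subset h)]; exact hα
    · rw [Finset.mem_singleton.1 (Finsupp.support_single_subset h)]; exact hβ
  · intro h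
    have := DFunLike.congr_fun h β
    simp at this
  · rw [Finsupp.sum_add_index' (by simp) (by intros; rw [add_smul])]
    simpa using h

end Positivity

/-- The negatives of the positive roots. -/
def neg : Set Q := {α | -α ∈ D.pos}

/-- The sum of the components with degree in `T`. -/
def sub (T : Set Q) : Submodule ℂ g := ⨆ α ∈ T, D.wt α

theorem wt_le_sub {T : Set Q} {α : Q} (hα : α ∈ T) : D.wt α ≤ D.sub T :=
  le_iSup₂_of_le α hα le_rfl

variable {D} in
theorem sub_induction {T : Set Q} {p : g → Prop} (hadd : ∀ x y, p x → p y → p (x + y))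
    (hzero : p 0) (hom : ∀ α ∈ T, ∀ i, ∀ x ∈ D.wt α, x ∈ parity (g := g) i → p x) {x : g}
    (hx : x ∈ D.sub T) : p x := by
  refine Submodule.iSup_induction _ (motive := p) hx (fun α x hx => ?_) hzero hadd
  by_cases hα : α ∈ T
  · rw [iSup_pos hα, D.wt_graded α] at hx
    obtain ⟨x0, h0, x1, h1, rfl⟩ := Submodule.mem_sup.1 hx
    exact hadd _ _ (hom α hα 0 _ h0.1 h0.2) (hom α hα 1 _ h1.1 h1.2)
  · rw [iSup_neg hα] at hx
    rwa [(Submodule.mem_bot ℂ).1 hx]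

/-- Sets of degrees that define subalgebras. -/
class IsClosedSet (T : Set Q) : Prop where
  -- Only degrees with nonzero components count; a set such as the complement of `pos` need not be
  -- closed under addition in Q.
  add_mem' : ∀ {α β : Q}, α ∈ T → β ∈ T → D.wt α ≠ ⊥ → D.wt β ≠ ⊥ → D.wt (α + β) ≠ ⊥ → α + β ∈ T

instance (T : Set Q) [hT : D.IsClosedSet T] : IsSubalg (D.sub T) where
  graded := iSup₂_le fun α hα => by
    rw [D.wt_graded α]
    exact sup_le_sup (inf_le_inf_right _ (D.wt_le_sub hα)) (inf_le_inf_right _ (D.wt_le_sub hα))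
  bracket_mem' {x y} hx hy := by
    refine sub_induction (p := fun x => bracket x y ∈ D.sub T) (fun x x' h h' => ?_) (by simp) ?_ hx
    · rw [map_add]
      exact add_mem h h'
    intro α hα _ x hxα _
    refine sub_induction (p := fun y => bracket x y ∈ D.sub T) (fun x x' h h' => ?_) (by simp) ?_ hy
    · rw [map_add]
      exact add_mem h h'
    intro β hβ _ y hyβ _
    have hb := D.bracket_mem_wt hxα hyβ
    by_cases h0 : bracket x y = 0
    · rw [h0]
      exact zero_mem _
    refine D.wt_le_sub (hT.add_mem' hα hβ ?_ ?_ ?_) hb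
    · rintro h
      rw [h, Submodule.mem_bot] at hxα
      simp [hxα] at h0
    · rintro h
      rw [h, Submodule.mem_bot] at hyβ
      simp [hyβ] at h0
    · rintro h
      rw [h, Submodule.mem_bot] at hb
      exact h0 hb

variable {D} in
theorem pos_or_neg {α : Q} (h : D.wt α ≠ ⊥) : α = 0 ∨ α ∈ D.pos ∨ α ∈ D.neg := D.root_cases α h

instance : D.IsClosedSet D.pos where
  add_mem' {α β} hα hβ _ _ h := by
    rcases pos_or_neg h with h | h | h
    · exact absurd h (pos_add_pos_ne_zero hα hβ)
    · exact h
    · exact absurd (add_neg_cancel (α + β)) (pos_add_pos_add_pos_ne_zero hα hβ h)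

instance : D.IsClosedSet D.neg where
  add_mem' {α β} hα hβ _ _ h := by
    rcases pos_or_neg h with h | h | h
    · exact absurd (by rw [← neg_add, h, neg_zero]) (pos_add_pos_ne_zero hα hβ)
    · exact absurd (by abel) (pos_add_pos_add_pos_ne_zero hα hβ h)
    · exact h

instance : D.IsClosedSet D.posᶜ where
  add_mem' {α β} hα hβ h1 h2 h := by
    intro hp
    rcases pos_or_neg h1 with rfl | h1 | h1
    · exact hβ (by rwa [zero_add] at hp)
    · exact hα h1
    rcases pos_or_neg h2 with rfl | h2 | h2
    · exact hα (by rwa [add_zero] at hp)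
    · exact hβ h2
    · exact absurd (by abel) (pos_add_pos_add_pos_ne_zero h1 h2 hp)

instance : D.IsClosedSet D.negᶜ where
  add_mem' {α β} hα hβ h1 h2 h := by
    intro hp
    rcases pos_or_neg h1 with rfl | h1 | h1
    · exact hβ (by rwa [zero_add] at hp)
    · rcases pos_or_neg h2 with rfl | h2 | h2
      · exact hα (by rwa [add_zero] at hp)
      · exact absurd (by abel) (pos_add_pos_add_pos_ne_zero h1 h2 hp)
      · exact hβ h2
    · exact hα h1

theorem isCompl_sub (T : Set Q) : IsCompl (D.sub T) (D.sub Tᶜ) := by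
  refine ⟨D.iSupIndep_wt.disjoint_biSup_biSup disjoint_compl_right, ?_⟩
  rw [codisjoint_iff, eq_top_iff, ← D.iSup_wt]
  refine iSup_le fun α => ?_
  by_cases hα : α ∈ T
  · exact le_sup_of_le_left (D.wt_le_sub hα)
  · exact le_sup_of_le_right (D.wt_le_sub hα)

theorem isCompl_sub' (T : Set Q) : IsCompl (D.sub Tᶜ) (D.sub T) := (D.isCompl_sub T).symm

theorem nminus_eq : D.nminus = D.sub D.neg := by
  refine le_antisymm (iSup₂_le fun α hα => D.wt_le_sub ?_) (iSup₂_le fun α hα => ?_)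
  · simpa [neg] using hα
  · refine le_iSup₂_of_le (-α) hα ?_
    rw [neg_neg]

theorem isCompl_h : IsCompl D.h (D.sub {0}ᶜ) := by
  have h := D.isCompl_sub {0}
  rwa [show D.sub {0} = D.h from iSup_singleton] at h

/-- The projection onto `h`. -/
noncomputable def projH : g →ₗ[ℂ] D.h := Submodule.projectionOnto _ _ D.isCompl_h

theorem projH_coe (x : D.h) : D.projH x = x := Submodule.projectionOnto_apply_left _ x

theorem projH_of_ne {α : Q} (hα : α ≠ 0) {x : g} (hx : x ∈ D.wt α) : D.projH x = 0 :=
  (Submodule.projectionOnto_apply_eq_zero_iff D.isCompl_h).2 (D.wt_le_sub (T := {0}ᶜ) hα hx)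

theorem projH_of_zero {x : g} (hx : x ∈ D.wt 0) : D.projH x = ⟨x, hx⟩ := D.projH_coe ⟨x, hx⟩

/-- Each component of the Q-grading is stable under `parityInv`, which therefore commutes with
`projH`. The part of the wrong parity then equals its own negative. -/
theorem projH_parity {i : ZMod 2} {x : g} (hx : x ∈ parity (g := g) i) :
    (D.projH x : g) ∈ parity (g := g) i := by
  have key : ∀ x : g, parityInv g (D.projH x : g) = D.projH (parityInv g x) := by
    intro x
    have hx : x ∈ ⨆ α, D.wt α := D.iSup_wt ▸ Submodule.mem_top
    refine Submodule.iSup_induction D.wt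
      (motive := fun x => parityInv g (D.projH x : g) = D.projH (parityInv g x)) hx ?_ (by simp) ?_
    · intro α x hx
      by_cases hα : α = 0
      · subst hα
        rw [D.projH_of_zero hx, D.projH_of_zero (parityInv_mem_wt hx)]
      · rw [D.projH_of_ne hα hx, D.projH_of_ne hα (parityInv_mem_wt hx)]
        simp
    · intro x y hx hy
      simp only [map_add, Submodule.coe_add, hx, hy]
  have h := key x
  rw [parityInv_apply hx, map_smul] at h
  obtain ⟨y0, h0, y1, h1, e⟩ := exists_parity_add (D.projH x : g)
  rw [Submodule.coe_smul, e, map_add, parityInv_even h0, parityInv_odd h1] at h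
  rw [e]
  rcases parity_cases i with rfl | rfl
  · have : y1 = 0 := by
      have h' : (2 : ℂ) • y1 = 0 := by
        simp only [superSign, zero_ne_one, and_false, if_false, one_smul] at h
        rw [two_smul]
        have := congrArg (fun z => y0 + y1 - z) h
        simp only [sub_self] at this
        rw [← this]
        abel
      exact (smul_eq_zero.1 h').resolve_left two_ne_zero
    rw [this, add_zero]
    exact h0
  · have : y0 = 0 := by
      have h' : (2 : ℂ) • y0 = 0 := by
        simp only [superSign, and_self, if_true, neg_smul, one_smul] at h
        rw [two_smul]
        have := congrArg (fun z => z + (y0 + y1)) h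
        simp only [neg_add_cancel] at this
        rw [← this]
        abel
      exact (smul_eq_zero.1 h').resolve_left two_ne_zero
    rw [this, zero_add]
    exact h1

/-- The only obstruction would be a bracket of two nonzero degrees that lands in degree 0. `hT`
excludes it; for b⁺ it holds because opposite roots do not both occur. -/
theorem projH_bracket_aux {T : Set Q} (hT : ∀ α ∈ T, ∀ β ∈ T, D.wt α ≠ ⊥ → D.wt β ≠ ⊥ → α + β = 0 →
    α = 0) {x y : g} (hx : x ∈ D.sub T) (hy : y ∈ D.sub T) :
    D.projH (bracket x y) = bracket (D.projH x) (D.projH y) := by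
  refine sub_induction (p := fun x => D.projH (bracket x y) = bracket (D.projH x) (D.projH y))
    (fun x x' h h' => ?_) (by simp) ?_ hx
  · simp only [map_add, LinearMap.add_apply, h, h']
  intro α hα _ x hxα _
  refine sub_induction (p := fun y => D.projH (bracket x y) = bracket (D.projH x) (D.projH y))
    (fun x x' h h' => ?_) (by simp) ?_ hy
  · simp only [map_add, h, h']
  intro β hβ _ y hyβ _
  by_cases hx0 : x = 0
  · simp [hx0]
  by_cases hy0 : y = 0
  · simp [hy0]
  have hα' : D.wt α ≠ ⊥ := fun h => hx0 (by rwa [h, Submodule.mem_bot] at hxα)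
  have hβ' : D.wt β ≠ ⊥ := fun h => hy0 (by rwa [h, Submodule.mem_bot] at hyβ)
  have hb := D.bracket_mem_wt hxα hyβ
  by_cases h0 : α + β = 0
  · have hα0 := hT α hα β hβ hα' hβ' h0
    subst hα0
    rw [zero_add] at h0
    subst h0
    rw [zero_add] at hb
    rw [D.projH_of_zero hb, D.projH_of_zero hxα, D.projH_of_zero hyβ]
    rfl
  · rw [D.projH_of_ne h0 hb]
    by_cases hα0 : α = 0
    · have hβ0 : β ≠ 0 := by
        rintro rfl
        exact h0 (by simp [hα0])
      rw [D.projH_of_ne hβ0 hyβ, map_zero]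
    · rw [D.projH_of_ne hα0 hxα, map_zero, LinearMap.zero_apply]

/-- The projection `b⁺ → h`. -/
noncomputable def bplusToH : Hom (D.sub D.negᶜ) D.h where
  toLinearMap := D.projH ∘ₗ (D.sub D.negᶜ).subtype
  map_parity := fun hx => D.projH_parity hx
  map_bracket := fun x y => D.projH_bracket_aux (by
    intro α hα β hβ h1 h2 h
    by_contra h0
    have hα' : α ∈ D.pos := ((pos_or_neg h1).resolve_left h0).resolve_right hα
    rcases pos_or_neg h2 with rfl | h2 | h2
    · exact h0 (by simpa using h)
    · exact pos_add_pos_ne_zero hα' h2 h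
    · exact hβ h2) x.2 y.2

theorem h_le_bplus : D.h ≤ D.sub D.negᶜ := D.wt_le_sub (α := 0) (T := D.negᶜ)
  fun h => pos_ne_zero (D := D) (α := -0) h neg_zero

theorem h_le_bminus : D.h ≤ D.sub D.posᶜ := D.wt_le_sub (α := 0) (T := D.posᶜ)
  fun h => pos_ne_zero (D := D) h rfl

theorem nplus_le_bplus : D.sub D.pos ≤ D.sub D.negᶜ := iSup₂_le fun _ hα => D.wt_le_sub
  (T := D.negᶜ) fun h => pos_add_pos_ne_zero hα h (add_neg_cancel _)

end TriangularDecomposition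

/-- The inclusion of nested subalgebras. -/
def inclOfLE {g : Type*} [AddCommGroup g] [Module ℂ g] [LieSuperalgebra g] {s t : Submodule ℂ g}
    [IsSubalg s] [IsSubalg t] (h : s ≤ t) : Hom s t where
  toLinearMap := Submodule.inclusion h
  map_parity := fun hx => hx
  map_bracket := fun _ _ => rfl

end LieSuperalgebra

/-! ### U(h) as a Clifford algebra over A -/

namespace LieSuperalgebra
namespace TriangularDecomposition

variable {g : Type*} [AddCommGroup g] [Module ℂ g] [LieSuperalgebra g]
  {Q : Type*} [AddCommGroup Q] (D : TriangularDecomposition g Q)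

/-- The enveloping algebra `U(h)`. -/
abbrev H : Type _ := Env D.h

/-- The canonical map `U(h) → U(g)`. -/
noncomputable def κ : D.H →ₐ[ℂ] Env g := envMap (incl D.h)

@[simp] theorem κ_ι (x : D.h) : D.κ (ι D.h x) = ι g (x : g) := envMap_ι _ x

/-- An even element of `h` as an element of `h`. -/
def evenToCartan : D.hEven →ₗ[ℂ] D.h := Submodule.inclusion inf_le_left

/-- The assumption [h_0, h] = 0 makes h_0 central, and this turns U(h) into an algebra over A. -/
theorem commute_evenToCartan (x : D.hEven) (u : D.H) :
    ι D.h (D.evenToCartan x) * u = u * ι D.h (D.evenToCartan x) := by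
  induction u using env_induction with
  | one => simp
  | add u v hu hv => rw [mul_add, add_mul, hu, hv]
  | smul c u hu => rw [mul_smul_comm, smul_mul_assoc, hu]
  | mul y u hu =>
    rw [mul_assoc, ← hu, ← mul_assoc, ← mul_assoc]
    congr 1
    induction y using parity_induction with
    | hadd y y' h h' => rw [map_add, mul_add, add_mul, h, h']
    | hom j y hy =>
      have hx : D.evenToCartan x ∈ parity (g := D.h) 0 := x.2.2
      have hb : bracket (D.evenToCartan x) y = 0 := Subtype.ext (D.cartan_comm x.2 y.2)
      rw [ι_mul_ι hx hy, hb]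
      simp [superSign]

/-- The canonical map `A = S(h_0) → U(h)`. -/
noncomputable def toH : D.A →ₐ[ℂ] D.H :=
  (Subalgebra.center ℂ D.H).val.comp (SymmetricAlgebra.lift
    ((ι D.h ∘ₗ D.evenToCartan).codRestrict (Subalgebra.toSubmodule (Subalgebra.center ℂ D.H))
      fun x => (Subalgebra.mem_center_iff (R := ℂ)).2 fun u => (D.commute_evenToCartan x u).symm))

theorem toH_ι (x : D.hEven) :
    D.toH (SymmetricAlgebra.ι ℂ D.hEven x) = ι D.h (D.evenToCartan x) := by
  simp only [toH, AlgHom.comp_apply, SymmetricAlgebra.lift_ι_apply]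
  rfl

theorem toH_commute (a : D.A) (u : D.H) : D.toH a * u = u * D.toH a := by
  have h : D.toH a ∈ Subalgebra.center ℂ D.H := SetLike.coe_mem _
  exact (Subalgebra.mem_center_iff.1 h u).symm

noncomputable instance : Algebra D.A D.H := D.toH.toRingHom.toAlgebra' D.toH_commute

theorem algebraMap_H (a : D.A) : algebraMap D.A D.H a = D.toH a := rfl

instance : IsScalarTower ℂ D.A D.H := IsScalarTower.of_algebraMap_eq fun c => by
  rw [algebraMap_H, AlgHom.commutes]

theorem κ_toH (a : D.A) : D.κ (D.toH a) = D.toEnv a := by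
  induction a using SymmetricAlgebra.induction with
  | algebraMap r => simp
  | ι x => rw [toH_ι, toEnv_ι, κ_ι]; rfl
  | mul a b ha hb => rw [map_mul, map_mul, map_mul, ha, hb]
  | add a b ha hb => rw [map_add, map_add, map_add, ha, hb]

theorem κ_smul (a : D.A) (r : D.H) : D.κ (a • r) = a • D.κ r := by
  rw [Algebra.smul_def, algebraMap_H, toH_commute, map_mul, κ_toH]
  rfl

section Clifford

/-- The even part of an element of `h`. -/
noncomputable def evenPart : D.h →ₗ[ℂ] D.hEven where
  toFun x := ⟨Submodule.projection _ _ (isCompl_parity (g := D.h)) x,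
    (Submodule.projection _ _ (isCompl_parity (g := D.h)) x).2,
    Submodule.projection_apply_mem (isCompl_parity (g := D.h)) x⟩
  map_add' x y := Subtype.ext (by simp)
  map_smul' c x := Subtype.ext (by simp)

/-- The odd part of an element of `h`. -/
noncomputable def oddPart : D.h →ₗ[ℂ] D.hOdd where
  toFun x := ⟨Submodule.projection _ _ (isCompl_parity (g := D.h)).symm x,
    (Submodule.projection _ _ (isCompl_parity (g := D.h)).symm x).2,
    Submodule.projection_apply_mem (isCompl_parity (g := D.h)).symm x⟩
  map_add' x y := Subtype.ext (by simp)
  map_smul' c x := Subtype.ext (by simp)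

variable {D} in
theorem part_even {x : D.h} (hx : x ∈ parity (g := D.h) 0) :
    D.evenPart x = ⟨x, x.2, hx⟩ ∧ D.oddPart x = 0 := by
  constructor
  · exact Subtype.ext (congrArg (fun z : D.h => (z : g))
      (Submodule.projection_apply_of_mem_left (isCompl_parity (g := D.h)) hx))
  · exact Subtype.ext (congrArg (fun z : D.h => (z : g))
      ((Submodule.projection_apply_eq_zero_iff (isCompl_parity (g := D.h)).symm).2 hx))

variable {D} in
theorem part_odd {x : D.h} (hx : x ∈ parity (g := D.h) 1) :
    D.evenPart x = 0 ∧ D.oddPart x = ⟨x, x.2, hx⟩ := by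
  constructor
  · exact Subtype.ext (congrArg (fun z : D.h => (z : g))
      ((Submodule.projection_apply_eq_zero_iff (isCompl_parity (g := D.h))).2 hx))
  · exact Subtype.ext (congrArg (fun z : D.h => (z : g))
      (Submodule.projection_apply_of_mem_left (isCompl_parity (g := D.h)).symm hx))

instance : Module.Finite ℂ D.hOdd := D.finite_odd_cartan

/-- The bracket of odd elements of `h`. -/
noncomputable def oddBracket : D.hOdd →ₗ[ℂ] D.hOdd →ₗ[ℂ] D.hEven :=
  LinearMap.mk₂ ℂ (fun x y => ⟨bracket (x : g) (y : g),
      by simpa [TriangularDecomposition.h] using D.bracket_mem_wt x.2.1 y.2.1,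
      by simpa [CharTwo.add_self_eq_zero] using bracket_mem x.2.2 y.2.2⟩)
    (fun x x' y => Subtype.ext (by simp)) (fun c x y => Subtype.ext (by simp))
    (fun x y y' => Subtype.ext (by simp)) (fun c x y => Subtype.ext (by simp))

theorem oddBracket_comm (x y : D.hOdd) : D.oddBracket x y = D.oddBracket y x :=
  Subtype.ext (show bracket (x : g) (y : g) = bracket (y : g) (x : g) by
    have := skew x.2.2 y.2.2
    simpa [superSign] using this)

theorem ι_odd_mul (x y : D.hOdd) : ι D.h (D.oddToCartan x) * ι D.h (D.oddToCartan y) +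
    ι D.h (D.oddToCartan y) * ι D.h (D.oddToCartan x) =
      algebraMap D.A D.H (SymmetricAlgebra.ι ℂ D.hEven (D.oddBracket x y)) := by
  have hx : D.oddToCartan x ∈ parity (g := D.h) 1 := x.2.2
  have hy : D.oddToCartan y ∈ parity (g := D.h) 1 := y.2.2
  have h := ι_mul_ι hx hy
  rw [h, algebraMap_H, toH_ι]
  simp only [superSign, and_self, if_true, neg_smul, one_smul]
  have : bracket (D.oddToCartan x) (D.oddToCartan y) = D.evenToCartan (D.oddBracket x y) := rfl
  rw [this]
  abel

/-- The number of odd dimensions of `h`. -/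
noncomputable abbrev oddDim : ℕ := Module.finrank ℂ D.hOdd

/-- A basis of `h_1`. -/
noncomputable abbrev oddBasis : Module.Basis (Fin D.oddDim) ℂ D.hOdd := Module.finBasis ℂ D.hOdd

/-- The symmetric form on `A ⊗ h_1` given by the bracket. -/
noncomputable def oddForm : LinearMap.BilinForm D.A (Fin D.oddDim → D.A) :=
  Matrix.toBilin' (Matrix.of fun i j =>
    SymmetricAlgebra.ι ℂ D.hEven (D.oddBracket (D.oddBasis i) (D.oddBasis j)))

noncomputable instance : Invertible (2 : D.A) :=
  (Invertible.map (algebraMap ℂ D.A) 2).copy 2 (map_ofNat _ 2).symm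

/-- Half of the quadratic form of `oddForm`. -/
noncomputable def oddQuad : QuadraticForm D.A (Fin D.oddDim → D.A) :=
  -- The factor 1/2 is dictated by x² = [x, x]/2 in U(h) for odd x.
  ((⅟2 : D.A) • D.oddForm).toQuadraticMap

theorem oddForm_comm (u v : Fin D.oddDim → D.A) : D.oddForm u v = D.oddForm v u := by
  rw [oddForm, Matrix.toBilin'_apply, Matrix.toBilin'_apply, Finset.sum_comm]
  refine Finset.sum_congr rfl fun i _ => Finset.sum_congr rfl fun j _ => ?_
  rw [Matrix.of_apply, Matrix.of_apply, oddBracket_comm]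
  ring

theorem polar_oddQuad (u v : Fin D.oddDim → D.A) :
    QuadraticMap.polar D.oddQuad u v = D.oddForm u v := by
  rw [oddQuad, LinearMap.BilinMap.polar_toQuadraticMap]
  simp only [LinearMap.smul_apply, smul_eq_mul]
  rw [D.oddForm_comm v u, ← two_mul, ← mul_assoc, mul_invOf_self, one_mul]

/-- The coordinates of an element of `h_1`. -/
noncomputable def oddCoord : D.hOdd →ₗ[ℂ] (Fin D.oddDim → D.A) :=
  (LinearMap.pi fun i => Algebra.linearMap ℂ D.A ∘ₗ D.oddBasis.coord i)

theorem oddCoord_basis (i : Fin D.oddDim) : D.oddCoord (D.oddBasis i) = Pi.single i 1 := by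
  ext j
  simp only [oddCoord, LinearMap.pi_apply, LinearMap.comp_apply, Module.Basis.coord_apply,
    Module.Basis.repr_self, Algebra.linearMap_apply, Finsupp.single_apply, Pi.single_apply]
  simp only [eq_comm]
  split_ifs <;> simp

theorem oddForm_oddCoord (x y : D.hOdd) : D.oddForm (D.oddCoord x) (D.oddCoord y) =
    SymmetricAlgebra.ι ℂ D.hEven (D.oddBracket x y) := by
  conv_rhs => rw [← D.oddBasis.sum_repr x, ← D.oddBasis.sum_repr y]
  rw [oddForm, Matrix.toBilin'_apply]
  simp only [map_sum, LinearMap.sum_apply, map_smul, LinearMap.smul_apply, Matrix.of_apply,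
    Finset.smul_sum]
  rw [Finset.sum_comm]
  refine Finset.sum_congr rfl fun i _ => Finset.sum_congr rfl fun j _ => ?_
  simp only [oddCoord, LinearMap.pi_apply, LinearMap.comp_apply, Module.Basis.coord_apply,
    Algebra.linearMap_apply, Algebra.smul_def]
  ring

/-- The map from `h` to the Clifford algebra. -/
noncomputable def toCliffordLin : D.h →ₗ[ℂ] CliffordAlgebra D.oddQuad :=
  (Algebra.linearMap D.A (CliffordAlgebra D.oddQuad)).restrictScalars ℂ ∘ₗ
      SymmetricAlgebra.ι ℂ D.hEven ∘ₗ D.evenPart +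
    (CliffordAlgebra.ι D.oddQuad).restrictScalars ℂ ∘ₗ D.oddCoord ∘ₗ D.oddPart

variable {D} in
theorem toCliffordLin_even {x : D.h} (hx : x ∈ parity (g := D.h) 0) :
    D.toCliffordLin x = algebraMap D.A _ (SymmetricAlgebra.ι ℂ D.hEven ⟨x, x.2, hx⟩) := by
  simp [toCliffordLin, part_even hx]

variable {D} in
theorem toCliffordLin_odd {x : D.h} (hx : x ∈ parity (g := D.h) 1) :
    D.toCliffordLin x = CliffordAlgebra.ι D.oddQuad (D.oddCoord ⟨x, x.2, hx⟩) := by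
  simp [toCliffordLin, part_odd hx]

theorem toCliffordLin_rel {i j : ZMod 2} {x y : D.h} (hx : x ∈ parity (g := D.h) i)
    (hy : y ∈ parity (g := D.h) j) :
    D.toCliffordLin x * D.toCliffordLin y
      - superSign i j • (D.toCliffordLin y * D.toCliffordLin x) =
        D.toCliffordLin (bracket x y) := by
  rcases parity_cases i with rfl | rfl
  · have hb : bracket x y = 0 := Subtype.ext (D.cartan_comm ⟨x.2, hx⟩ y.2)
    rw [hb, toCliffordLin_even hx, Algebra.commutes]
    simp [superSign]
  rcases parity_cases j with rfl | rfl
  · have hb : bracket x y = 0 := by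
      rw [skew hx hy, show bracket y x = 0 from Subtype.ext (D.cartan_comm ⟨y.2, hy⟩ x.2)]
      simp
    rw [hb, toCliffordLin_even hy, Algebra.commutes]
    simp [superSign]
  · have hb : bracket x y ∈ parity (g := D.h) 0 := by
      simpa [CharTwo.add_self_eq_zero] using bracket_mem hx hy
    rw [toCliffordLin_even hb, toCliffordLin_odd hx, toCliffordLin_odd hy]
    simp only [superSign, and_self, if_true, neg_smul, one_smul, sub_neg_eq_add]
    rw [CliffordAlgebra.ι_mul_ι_add_swap, polar_oddQuad, oddForm_oddCoord]
    rfl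

/-- The homomorphism from `U(h)` to the Clifford algebra. -/
noncomputable def toClifford : D.H →ₐ[ℂ] CliffordAlgebra D.oddQuad :=
  envLift D.toCliffordLin D.toCliffordLin_rel

theorem toClifford_ι (x : D.h) : D.toClifford (ι D.h x) = D.toCliffordLin x :=
  envLift_ι _ D.toCliffordLin_rel x

theorem toClifford_toH (a : D.A) : D.toClifford (D.toH a) = algebraMap D.A _ a := by
  induction a using SymmetricAlgebra.induction with
  | algebraMap r =>
    rw [AlgHom.commutes, AlgHom.commutes, ← IsScalarTower.algebraMap_apply]
  | ι x => rw [toH_ι, toClifford_ι, toCliffordLin_even (x := D.evenToCartan x) x.2.2]; rfl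
  | mul a b ha hb => rw [map_mul, map_mul, map_mul, ha, hb]
  | add a b ha hb => rw [map_add, map_add, map_add, ha, hb]

/-- The map from `A ⊗ h_1` to `U(h)`. -/
noncomputable def fromCliffordLin : (Fin D.oddDim → D.A) →ₗ[D.A] D.H :=
  Fintype.linearCombination D.A fun i => ι D.h (D.oddToCartan (D.oddBasis i))

theorem fromCliffordLin_oddCoord (x : D.hOdd) :
    D.fromCliffordLin (D.oddCoord x) = ι D.h (D.oddToCartan x) := by
  have : D.oddToCartan x = ∑ i, D.oddBasis.repr x i • D.oddToCartan (D.oddBasis i) := by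
    refine Subtype.ext ?_
    have h := congrArg (fun z : D.hOdd => (z : g)) (D.oddBasis.sum_repr x)
    simp only [AddSubmonoidClass.coe_finsetSum, Submodule.coe_smul] at h ⊢
    exact h.symm
  rw [this, map_sum]
  simp only [map_smul, fromCliffordLin, Fintype.linearCombination_apply]
  refine Finset.sum_congr rfl fun i _ => ?_
  simp [oddCoord]

/-- Adding the expansion of the square to itself with the two indices exchanged gives
anticommutators, which lie in A; then 2 is inverted. -/
theorem fromCliffordLin_mul_self (u : Fin D.oddDim → D.A) :
    D.fromCliffordLin u * D.fromCliffordLin u = algebraMap D.A D.H (D.oddQuad u) := by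
  have h2 : D.fromCliffordLin u * D.fromCliffordLin u + D.fromCliffordLin u * D.fromCliffordLin u
      = algebraMap D.A D.H (D.oddForm u u) := by
    have e1 : D.fromCliffordLin u * D.fromCliffordLin u = ∑ i, ∑ j, (u i * u j) •
        (ι D.h (D.oddToCartan (D.oddBasis i)) * ι D.h (D.oddToCartan (D.oddBasis j))) := by
      simp only [fromCliffordLin, Fintype.linearCombination_apply, Finset.sum_mul_sum,
        smul_mul_smul_comm]
    have e2 : D.fromCliffordLin u * D.fromCliffordLin u = ∑ i, ∑ j, (u i * u j) •
        (ι D.h (D.oddToCartan (D.oddBasis j)) * ι D.h (D.oddToCartan (D.oddBasis i))) := by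
      rw [e1, Finset.sum_comm]
      simp only [mul_comm]
    conv_lhs => rw [e1]
    rw [← e1]
    nth_rewrite 1 [e1]
    rw [e2, ← Finset.sum_add_distrib, oddForm, Matrix.toBilin'_apply, map_sum]
    refine Finset.sum_congr rfl fun i _ => ?_
    rw [← Finset.sum_add_distrib, map_sum]
    refine Finset.sum_congr rfl fun j _ => ?_
    rw [← smul_add, ι_odd_mul, Matrix.of_apply, Algebra.smul_def, ← map_mul]
    congr 1
    ring
  have h3 : D.oddQuad u = ⅟2 * D.oddForm u u := rfl
  have h4 := congrArg (algebraMap D.A D.H) (invOf_mul_self (2 : D.A))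
  rw [map_mul, map_ofNat, map_one] at h4
  rw [h3, map_mul, ← h2, ← two_mul, ← mul_assoc, h4, one_mul]

/-- The homomorphism from the Clifford algebra to `U(h)`. -/
noncomputable def fromClifford : CliffordAlgebra D.oddQuad →ₐ[D.A] D.H :=
  CliffordAlgebra.lift D.oddQuad ⟨D.fromCliffordLin, D.fromCliffordLin_mul_self⟩

theorem fromClifford_toClifford (r : D.H) : D.fromClifford (D.toClifford r) = r := by
  have h : (D.fromClifford.restrictScalars ℂ).comp D.toClifford = AlgHom.id ℂ D.H := by
    refine env_hom_ext fun x => ?_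
    simp only [AlgHom.comp_apply, AlgHom.restrictScalars_apply, AlgHom.id_apply, toClifford_ι]
    induction x using parity_induction with
    | hadd x y hx hy => simp only [map_add, hx, hy]
    | hom i x hx =>
    rcases parity_cases i with rfl | rfl
    · rw [toCliffordLin_even hx, AlgHom.commutes, algebraMap_H, toH_ι]
      rfl
    · rw [toCliffordLin_odd hx, fromClifford, CliffordAlgebra.lift_ι_apply,
        fromCliffordLin_oddCoord]
      rfl
  exact DFunLike.congr_fun h r

theorem toClifford_smul (a : D.A) (r : D.H) : D.toClifford (a • r) = a • D.toClifford r := by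
  rw [Algebra.smul_def, map_mul, algebraMap_H, toClifford_toH, Algebra.smul_def]

theorem toClifford_fromClifford (c : CliffordAlgebra D.oddQuad) :
    D.toClifford (D.fromClifford c) = c := by
  let f : D.H →ₐ[D.A] CliffordAlgebra D.oddQuad :=
    { D.toClifford with commutes' := D.toClifford_toH }
  have h : f.comp D.fromClifford = AlgHom.id D.A _ := by
    refine CliffordAlgebra.hom_ext (LinearMap.pi_ext' fun i => LinearMap.ext_ring ?_)
    change D.toClifford (D.fromClifford (CliffordAlgebra.ι D.oddQuad (Pi.single i 1))) =
      CliffordAlgebra.ι D.oddQuad (Pi.single i 1)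
    rw [fromClifford, CliffordAlgebra.lift_ι_apply, ← oddCoord_basis, fromCliffordLin_oddCoord,
      toClifford_ι, toCliffordLin_odd (x := D.oddToCartan (D.oddBasis i)) (D.oddBasis i).2.2]
    rfl
  exact DFunLike.congr_fun h c

/-- `U(h)` is a Clifford algebra over `A`. -/
noncomputable def cliffordEquiv : D.H ≃ₗ[D.A] CliffordAlgebra D.oddQuad where
  toFun := D.toClifford
  map_add' := map_add _
  map_smul' := D.toClifford_smul
  invFun := D.fromClifford
  left_inv := D.fromClifford_toClifford
  right_inv := D.toClifford_fromClifford

/-- A basis of `U(h)` over `A`. -/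
noncomputable def basisH : Module.Basis (Finset (Fin D.oddDim)) D.A D.H :=
  (Pi.basisFun D.A (Fin D.oddDim)).ExteriorAlgebra.map
    (D.cliffordEquiv.trans (CliffordAlgebra.equivExterior D.oddQuad)).symm

instance : Module.Free D.A D.H := Module.Free.of_basis D.basisH

instance : Module.Finite D.A D.H := Module.Finite.of_basis D.basisH

/-- Since 2 is invertible, the Clifford algebra is isomorphic as a module to the exterior algebra,
with a basis indexed by the subsets of a basis of h_1. -/
theorem finrank_H : Module.finrank D.A D.H = 2 ^ D.oddDim := by
  rw [Module.finrank_eq_card_basis D.basisH]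
  simp

end Clifford

end TriangularDecomposition
end LieSuperalgebra

/-! ### The trace of U(h) over A and its naturality -/

namespace LieSuperalgebra

theorem envParity_envParity {g : Type*} [AddCommGroup g] [Module ℂ g] [LieSuperalgebra g]
    (u : Env g) : envParity g (envParity g u) = u := by
  induction u using env_induction with
  | one => simp
  | mul x u h =>
    rw [map_mul, map_mul, h, envParity_ι, envParity_ι,
      TriangularDecomposition.parityInv_parityInv]
  | add u v hu hv => rw [map_add, map_add, hu, hv]
  | smul c u h => rw [map_smul, map_smul, h]

namespace TriangularDecomposition

instance {g Q : Type*} [AddCommGroup g] [Module ℂ g] [LieSuperalgebra g] [AddCommGroup Q]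
    (D : TriangularDecomposition g Q) : CharZero D.A :=
  charZero_of_injective_algebraMap (algebraMap ℂ D.A).injective

instance {g Q : Type*} [AddCommGroup g] [Module ℂ g] [LieSuperalgebra g] [AddCommGroup Q]
    (D : TriangularDecomposition g Q) : IsAddTorsionFree D.A :=
  IsDomain.instIsAddTorsionFreeOfCharZero _

section Trace

variable {g : Type*} [AddCommGroup g] [Module ℂ g] [LieSuperalgebra g]
  {Q : Type*} [AddCommGroup Q] (D : TriangularDecomposition g Q)

theorem envParity_toH (a : D.A) : envParity D.h (D.toH a) = D.toH a := by
  induction a using SymmetricAlgebra.induction with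
  | algebraMap r => simp
  | ι y =>
    have hy : D.evenToCartan y ∈ parity (g := D.h) 0 := y.2.2
    rw [toH_ι, envParity_ι, parityInv_even hy]
  | mul a b ha hb => rw [map_mul, map_mul, ha, hb]
  | add a b ha hb => rw [map_add, map_add, ha, hb]

/-- The parity involution of `U(h)`. -/
noncomputable def parityEquivH : D.H ≃ₗ[D.A] D.H where
  toFun := envParity D.h
  map_add' := map_add _
  map_smul' a u := by
    rw [Algebra.smul_def, map_mul, algebraMap_H, envParity_toH, Algebra.smul_def]
    rfl
  invFun := envParity D.h
  left_inv := envParity_envParity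
  right_inv := envParity_envParity

/-- The trace of the left multiplications on `U(h)`. -/
noncomputable def traceH : D.H →ₗ[D.A] D.A :=
  LinearMap.trace D.A D.H ∘ₗ LinearMap.mul D.A D.H

theorem traceH_apply (r : D.H) : D.traceH r = LinearMap.trace D.A D.H (LinearMap.mulLeft D.A r) :=
  rfl

theorem traceH_mul_comm (r s : D.H) : D.traceH (r * s) = D.traceH (s * r) := by
  rw [traceH_apply, traceH_apply, LinearMap.mulLeft_mul, LinearMap.mulLeft_mul,
    LinearMap.trace_comp_comm']

theorem traceH_one : D.traceH 1 = 2 ^ D.oddDim := by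
  rw [traceH_apply, LinearMap.mulLeft_one, LinearMap.trace_id, finrank_H]
  simp

/-- The two left multiplications are conjugate under the parity involution, which is A-linear. -/
theorem traceH_envParity (r : D.H) : D.traceH (envParity D.h r) = D.traceH r := by
  rw [traceH_apply, traceH_apply, ← LinearMap.trace_conj' (LinearMap.mulLeft D.A r) D.parityEquivH]
  congr 1
  refine LinearMap.ext fun s => ?_
  change envParity D.h r * s = envParity D.h (r * envParity D.h s)
  rw [map_mul, envParity_envParity]

/-- The parity involution negates a word of odd length but preserves the trace. -/
theorem traceH_of_odd (l : List D.hOdd) (hl : Odd l.length) :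
    D.traceH (l.map fun x => ι D.h (D.oddToCartan x)).prod = 0 := by
  have h : ∀ l : List D.hOdd, envParity D.h (l.map fun x => ι D.h (D.oddToCartan x)).prod =
      (-1) ^ l.length * (l.map fun x => ι D.h (D.oddToCartan x)).prod := by
    intro l
    induction l with
    | nil => simp
    | cons x l ih =>
      have hx : D.oddToCartan x ∈ parity (g := D.h) 1 := x.2.2
      rw [List.map_cons, List.prod_cons, map_mul, ih, envParity_ι, parityInv_odd hx, map_neg,
        List.length_cons, pow_succ]
      rcases neg_one_pow_eq_or D.H l.length with e | e <;> rw [e] <;> simp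
  have h1 := D.traceH_envParity (l.map fun x => ι D.h (D.oddToCartan x)).prod
  rw [h, hl.neg_one_pow, neg_one_mul, map_neg] at h1
  exact self_eq_neg.1 h1.symm

end Trace

section Functoriality

variable {g g' Q : Type*} [AddCommGroup g] [Module ℂ g] [LieSuperalgebra g]
  [AddCommGroup g'] [Module ℂ g'] [LieSuperalgebra g'] [AddCommGroup Q]
  (D : TriangularDecomposition g Q) (D' : TriangularDecomposition g' Q)
  (ψ : Hom g g') (hψ : ∀ (α : Q) (x : g), x ∈ D.wt α → ψ x ∈ D'.wt α)

/-- The restriction of `ψ` to `h`. -/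
def homH : Hom D.h D'.h where
  toLinearMap := ψ.toLinearMap.restrict (hψ 0)
  map_parity := fun hx => ψ.map_parity hx
  map_bracket := fun x y => Subtype.ext (ψ.map_bracket x y)

/-- The homomorphism `U(h) → U(h')` induced by `ψ`. -/
noncomputable def mapH : D.H →ₐ[ℂ] D'.H := envMap (homH D D' ψ hψ)

theorem mapH_toH (a : D.A) : mapH D D' ψ hψ (D.toH a) = D'.toH (mapA D D' ψ hψ a) := by
  induction a using SymmetricAlgebra.induction with
  | algebraMap r => simp
  | ι x =>
    rw [toH_ι, mapH, envMap_ι, mapA, SymmetricAlgebra.lift_ι_apply, LinearMap.comp_apply, toH_ι]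
    rfl
  | mul a b ha hb => rw [map_mul, map_mul, map_mul, map_mul, ha, hb]
  | add a b ha hb => rw [map_add, map_add, map_add, map_add, ha, hb]

theorem mapH_κ (r : D.H) : D'.κ (mapH D D' ψ hψ r) = envMap ψ (D.κ r) := by
  have h : D'.κ.comp (mapH D D' ψ hψ) = (envMap ψ).comp D.κ := env_hom_ext fun x => by
    simp only [AlgHom.comp_apply, mapH, envMap_ι, κ_ι]
    rfl
  exact DFunLike.congr_fun h r

/-- The normalized traces of `U(h)` and `U(h')` agree. -/
theorem traceH_mapH (r : D.H) : (2 ^ D.oddDim : D'.A) * D'.traceH (mapH D D' ψ hψ r) =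
    2 ^ D'.oddDim * mapA D D' ψ hψ (D.traceH r) := by
  -- `T` is the difference of the two sides. It is semilinear over A, and on words in h_1 it
  -- satisfies the conditions of `eq_zero_of_tracial`; the two powers of 2 are chosen so that T(1) =
  -- 0.
  let T : D.H →+ D'.A :=
    (AddMonoidHom.mulLeft (2 ^ D.oddDim : D'.A)).comp
        (D'.traceH.toAddMonoidHom.comp (mapH D D' ψ hψ : D.H →+ D'.H)) -
      (AddMonoidHom.mulLeft (2 ^ D'.oddDim : D'.A)).comp
        ((mapA D D' ψ hψ : D.A →+ D'.A).comp D.traceH.toAddMonoidHom)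
  have hTdef : ∀ r, T r = (2 ^ D.oddDim : D'.A) * D'.traceH (mapH D D' ψ hψ r) -
    2 ^ D'.oddDim * mapA D D' ψ hψ (D.traceH r) := fun r => rfl
  have hz : ∀ (a : D.A) (r : D.H), T (algebraMap D.A D.H a * r) = mapA D D' ψ hψ a * T r := by
    intro a r
    rw [hTdef, hTdef, map_mul, algebraMap_H, mapH_toH, ← algebraMap_H, ← algebraMap_H,
      ← Algebra.smul_def, ← Algebra.smul_def, map_smul, map_smul, smul_eq_mul, smul_eq_mul, map_mul]
    ring
  have hword : ∀ l : List D.hOdd, T (l.map fun x => ι D.h (D.oddToCartan x)).prod = 0 := by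
    intro l
    refine eq_zero_of_tracial _ T (algebraMap D.A D.H).range ?_ ?_ ?_ ?_ ?_ ?_ l
    · intro r s
      rw [hTdef, hTdef, map_mul (mapH D D' ψ hψ), map_mul (mapH D D' ψ hψ), traceH_mul_comm,
        D.traceH_mul_comm r]
    · intro v w
      rw [ι_odd_mul]
      exact ⟨_, rfl⟩
    · rintro _ ⟨a, rfl⟩ r
      exact Algebra.commutes a r
    · rintro r hr _ ⟨a, rfl⟩
      rw [hz, hr, mul_zero]
    · rw [hTdef, map_one, traceH_one, traceH_one, map_pow, map_ofNat]
      ring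
    · intro l hl
      have e : mapH D D' ψ hψ (l.map fun x => ι D.h (D.oddToCartan x)).prod =
          ((l.map fun x : D.hOdd => (⟨ψ (x : g), hψ 0 _ x.2.1, ψ.map_parity x.2.2⟩ : D'.hOdd)).map
            fun x => ι D'.h (D'.oddToCartan x)).prod := by
        rw [map_list_prod, List.map_map, List.map_map]
        congr 1
        refine List.map_congr_left fun x _ => ?_
        simp only [Function.comp_apply, mapH, envMap_ι]
        rfl
      rw [hTdef, D.traceH_of_odd l hl, e, D'.traceH_of_odd _ (by simpa using hl)]
      simp
  -- Passage from words in h_1 to all of U(h): an even letter is central and comes out as a scalar,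
  -- an odd letter is appended to the word.
  have key : ∀ l : List D.hOdd, T ((l.map fun x => ι D.h (D.oddToCartan x)).prod * r) = 0 := by
    induction r using env_induction with
    | one => intro l; rw [mul_one]; exact hword l
    | add u v hu hv => intro l; rw [mul_add, map_add, hu, hv, add_zero]
    | smul c u hu =>
      intro l
      rw [← algebraMap_smul D.A c u, Algebra.smul_def, ← mul_assoc, ← Algebra.commutes, mul_assoc,
        hz, hu, mul_zero]
    | mul x u hu =>
      induction x using parity_induction with
      | hadd x y hx hy =>
        intro l
        rw [map_add, add_mul, mul_add, map_add, hx, hy, add_zero]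
      | hom i x hx =>
      intro l
      rcases parity_cases i with rfl | rfl
      · have : ι D.h x = algebraMap D.A D.H (SymmetricAlgebra.ι ℂ D.hEven ⟨x, x.2, hx⟩) := by
          rw [algebraMap_H, toH_ι]
          rfl
        rw [this, ← mul_assoc, ← Algebra.commutes, mul_assoc, hz, hu, mul_zero]
      · have := hu (l ++ [⟨x, x.2, hx⟩])
        rw [List.map_append, List.prod_append, List.map_singleton, List.prod_singleton,
          mul_assoc] at this
        exact this
  have := key []
  rw [List.map_nil, List.prod_nil, one_mul, hTdef] at this
  exact sub_eq_zero.1 this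

/-- Comparison of the determinants of matrices over `U(h)` and of their images over `U(h')`. -/
theorem det_mulVecAlg_mapH {J : Type*} [Fintype J] [DecidableEq J] (B : Matrix J J D.H) :
    LinearMap.det ((B.map (mapH D D' ψ hψ)).mulVecAlg D'.A) ^ 2 ^ D.oddDim =
      mapA D D' ψ hψ (LinearMap.det (B.mulVecAlg D.A)) ^ 2 ^ D'.oddDim :=
  Matrix.det_mulVecAlg_map (mapA D D' ψ hψ : D.A →+* D'.A) (mapH D D' ψ hψ : D.H →+* D'.H) _ _
    (fun r => by simpa [traceH_apply] using traceH_mapH D D' ψ hψ r) B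

end Functoriality

end TriangularDecomposition
end LieSuperalgebra

/-! ### Weight components of U(n^±) and of U(b^±) -/

namespace LieSuperalgebra
namespace TriangularDecomposition

variable {g : Type*} [AddCommGroup g] [Module ℂ g] [LieSuperalgebra g]
  {Q : Type*} [AddCommGroup Q] (D : TriangularDecomposition g Q)

theorem submodule_mul_mono {B : Type*} [Ring B] [Algebra ℂ B] {M M' N N' : Submodule ℂ B}
    (h : M ≤ M') (h' : N ≤ N') : M * N ≤ M' * N' := by gcongr

section WeightSpaces

/-- The component of degree `α` of `g`, as a subspace of `U(g)`. -/
noncomputable def wtU (α : Q) : Submodule ℂ (Env g) := (D.wt α).map (ι g)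

/-- `U(h)` as a subspace of `U(g)`. -/
noncomputable def cartanU : Submodule ℂ (Env g) := LinearMap.range D.κ.toLinearMap

/-- The products of the components with degrees in `l`. -/
noncomputable def listU (l : List Q) : Submodule ℂ (Env g) := (l.map D.wtU).prod

/-- The span of the products of degree `ν` of elements with degrees in `T`. -/
noncomputable def wts (T : Set Q) (ν : Q) : Submodule ℂ (Env g) :=
  ⨆ l ∈ {l : List Q | (∀ α ∈ l, α ∈ T) ∧ l.sum = ν}, D.listU l

theorem κ_mem (r : D.H) : D.κ r ∈ D.cartanU := ⟨r, rfl⟩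

theorem one_mem_cartanU : (1 : Env g) ∈ D.cartanU := ⟨1, map_one D.κ⟩

theorem cartanU_mul_self : D.cartanU * D.cartanU = D.cartanU := by
  refine le_antisymm (Submodule.mul_le.2 ?_) fun u hu => ?_
  · rintro _ ⟨r, rfl⟩ _ ⟨s, rfl⟩
    exact ⟨r * s, map_mul D.κ r s⟩
  · simpa using Submodule.mul_mem_mul hu D.one_mem_cartanU

theorem wtU_zero_le : D.wtU 0 ≤ D.cartanU := by
  rintro _ ⟨x, hx, rfl⟩
  exact ⟨ι D.h ⟨x, hx⟩, D.κ_ι ⟨x, hx⟩⟩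

theorem wtU_mul_wtU_le (α β : Q) : D.wtU α * D.wtU β ≤ D.wtU β * D.wtU α ⊔ D.wtU (α + β) := by
  refine Submodule.mul_le.2 ?_
  rintro _ ⟨x, hx, rfl⟩ _ ⟨y, hy, rfl⟩
  have key : ∀ i x, x ∈ D.wt α → x ∈ parity (g := g) i → ∀ j y, y ∈ D.wt β →
      y ∈ parity (g := g) j → ι g x * ι g y ∈ D.wtU β * D.wtU α ⊔ D.wtU (α + β) := by
    intro i x hx hi j y hy hj
    rw [ι_mul_ι hi hj]
    exact Submodule.add_mem_sup (Submodule.smul_mem _ _ (Submodule.mul_mem_mul ⟨y, hy, rfl⟩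
      ⟨x, hx, rfl⟩)) ⟨_, D.bracket_mem_wt hx hy, rfl⟩
  rw [SetLike.mem_coe, D.wt_graded α] at hx
  rw [SetLike.mem_coe, D.wt_graded β] at hy
  obtain ⟨x0, hx0, x1, hx1, rfl⟩ := Submodule.mem_sup.1 hx
  obtain ⟨y0, hy0, y1, hy1, rfl⟩ := Submodule.mem_sup.1 hy
  simp only [map_add, mul_add, add_mul]
  exact add_mem (add_mem (key _ _ hx0.1 hx0.2 _ _ hy0.1 hy0.2) (key _ _ hx1.1 hx1.2 _ _ hy0.1 hy0.2))
    (add_mem (key _ _ hx0.1 hx0.2 _ _ hy1.1 hy1.2) (key _ _ hx1.1 hx1.2 _ _ hy1.1 hy1.2))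

theorem le_cartanU_mul (N : Submodule ℂ (Env g)) : N ≤ D.cartanU * N := fun u hu => by
  simpa using Submodule.mul_mem_mul D.one_mem_cartanU hu

theorem le_mul_cartanU (N : Submodule ℂ (Env g)) : N ≤ N * D.cartanU := fun u hu => by
  simpa using Submodule.mul_mem_mul hu D.one_mem_cartanU

/-- Because h normalizes the component of degree α, the two products of subspaces coincide, although
elements need not commute. This allows U(h) to be collected on the right (for M) or on the left (for
`P`). -/
theorem cartanU_commute_wtU (α : Q) : Commute D.cartanU (D.wtU α) := by
  have h1 : D.wtU 0 * D.wtU α ≤ D.wtU α * D.cartanU := by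
    refine (D.wtU_mul_wtU_le 0 α).trans (sup_le (submodule_mul_mono le_rfl D.wtU_zero_le) ?_)
    rw [zero_add]
    exact D.le_mul_cartanU _
  have h2 : D.wtU α * D.wtU 0 ≤ D.cartanU * D.wtU α := by
    refine (D.wtU_mul_wtU_le α 0).trans (sup_le (submodule_mul_mono D.wtU_zero_le le_rfl) ?_)
    rw [add_zero]
    exact D.le_cartanU_mul _
  refine le_antisymm (Submodule.mul_le.2 ?_) (Submodule.mul_le.2 ?_)
  · rintro _ ⟨r, rfl⟩ n hn
    induction r using env_induction generalizing n with
    | one => simpa using D.le_mul_cartanU _ hn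
    | add u v hu hv =>
      rw [map_add, add_mul]
      exact add_mem (hu n hn) (hv n hn)
    | smul c u hu =>
      rw [map_smul, smul_mul_assoc]
      exact Submodule.smul_mem _ _ (hu n hn)
    | mul x u hu =>
      have hx : ι g (x : g) ∈ D.wtU 0 := ⟨x, x.2, rfl⟩
      have := Submodule.mul_mem_mul hx (hu n hn)
      rw [← mul_assoc] at this
      have := submodule_mul_mono h1 le_rfl this
      rw [mul_assoc (D.wtU α), cartanU_mul_self] at this
      simpa [mul_assoc] using this
  · rintro n hn _ ⟨r, rfl⟩
    have key : ∀ m ∈ D.cartanU * D.wtU α, m * D.κ r ∈ D.cartanU * D.wtU α := by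
      induction r using env_induction with
      | one => simp
      | add u v hu hv =>
        intro m hm
        rw [map_add, mul_add]
        exact add_mem (hu m hm) (hv m hm)
      | smul c u hu =>
        intro m hm
        rw [map_smul, mul_smul_comm]
        exact Submodule.smul_mem _ _ (hu m hm)
      | mul x u hu =>
        intro m hm
        have hx : ι g (x : g) ∈ D.wtU 0 := ⟨x, x.2, rfl⟩
        have := Submodule.mul_mem_mul hm hx
        rw [mul_assoc] at this
        have := submodule_mul_mono le_rfl h2 this
        rw [← mul_assoc, cartanU_mul_self] at this
        rw [map_mul, κ_ι, ← mul_assoc]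
        exact hu _ this
    exact key n (D.le_cartanU_mul _ hn)

theorem cartanU_commute_wts (T : Set Q) (ν : Q) : Commute D.cartanU (D.wts T ν) := by
  have h : ∀ l, Commute D.cartanU (D.listU l) := fun l =>
    Commute.list_prod_right _ _ fun N hN => by
      obtain ⟨α, _, rfl⟩ := List.mem_map.1 hN
      exact D.cartanU_commute_wtU α
  simp only [wts, Commute, SemiconjBy, Submodule.mul_iSup, Submodule.iSup_mul]
  exact iSup_congr fun l => iSup_congr fun _ => h l

theorem listU_le_wts {T : Set Q} {l : List Q} (hl : ∀ α ∈ l, α ∈ T) :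
    D.listU l ≤ D.wts T l.sum :=
  le_iSup₂_of_le (f := fun l (_ : l ∈ {l' : List Q | (∀ α ∈ l', α ∈ T) ∧ l'.sum = _}) =>
    D.listU l) l ⟨hl, rfl⟩ le_rfl

theorem wtU_mul_wts_le {T : Set Q} {α : Q} (hα : α ∈ T) (ν : Q) :
    D.wtU α * D.wts T ν ≤ D.wts T (α + ν) := by
  simp only [wts, Submodule.mul_iSup]
  refine iSup₂_le fun l hl => ?_
  have h := D.listU_le_wts (T := T) (l := α :: l) (by
    intro β hβ
    rcases List.mem_cons.1 hβ with rfl | hβ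
    · exact hα
    · exact hl.1 β hβ)
  rw [List.sum_cons, hl.2] at h
  exact h

theorem one_mem_wts (T : Set Q) : (1 : Env g) ∈ D.wts T 0 :=
  D.listU_le_wts (T := T) (l := []) (by simp) (Submodule.one_le.1 le_rfl)

theorem wts_mul_cartanU_mul (T : Set Q) (ν : Q) :
    D.cartanU * (D.wts T ν * D.cartanU) = D.wts T ν * D.cartanU := by
  rw [← mul_assoc, (D.cartanU_commute_wts T ν).eq, mul_assoc, cartanU_mul_self]

theorem toEnv_mem (a : D.A) : D.toEnv a ∈ D.cartanU := D.κ_toH a ▸ D.κ_mem _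

theorem comp_mul_mem {T : Set Q} {ν : Q} {u : Env g} (hu : u ∈ D.comp T ν) {k : Env g}
    (hk : k ∈ D.cartanU) : u * k ∈ D.comp T ν := by
  obtain ⟨r, rfl⟩ := hk
  induction r using env_induction generalizing u with
  | one => simpa using hu
  | add r s hr hs => rw [map_add, mul_add]; exact add_mem (hr hu) (hs hu)
  | smul c r hr => rw [map_smul, mul_smul_comm]; exact Submodule.smul_of_tower_mem _ c (hr hu)
  | mul x r hr =>
    have : u * ι g (x : g) ∈ D.comp T ν := (D.rmul T ν x ⟨u, hu⟩).2
    have := hr this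
    simpa [mul_assoc] using this

theorem mul_comp_mem {T : Set Q} {α ν : Q} (hα : α = 0 ∨ α ∈ T) {x : g} (hx : x ∈ D.wt α)
    {u : Env g} (hu : u ∈ D.comp T ν) : ι g x * u ∈ D.comp T (α + ν) := by
  have : D.comp T ν ≤ (D.comp T (α + ν)).comap (D.lmulU x) :=
    Submodule.span_le.2 fun u hu => Submodule.subset_span (IsMonomial.mul hα hx hu)
  exact this hu

theorem listU_le_comp {T : Set Q} {l : List Q} (hl : ∀ α ∈ l, α ∈ T) :
    ∀ u ∈ D.listU l, u ∈ D.comp T l.sum := by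
  induction l with
  | nil =>
    intro u hu
    obtain ⟨c, rfl⟩ := Submodule.mem_one.1 hu
    rw [Algebra.algebraMap_eq_smul_one]
    exact Submodule.smul_of_tower_mem _ c (Submodule.subset_span IsMonomial.one)
  | cons α l ih =>
    have ih := ih fun β hβ => hl β (List.mem_cons_of_mem _ hβ)
    have : D.wtU α * D.listU l ≤ (D.comp T (α :: l).sum).restrictScalars ℂ := by
      refine Submodule.mul_le.2 ?_
      rintro _ ⟨x, hx, rfl⟩ m hm
      rw [List.sum_cons]
      exact D.mul_comp_mem (Or.inr (hl α List.mem_cons_self)) hx (ih m hm)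
    exact fun u hu => this hu

/-- All factors from h can be moved to the right end of a monomial. What remains is a product of
root vectors, and these span a finite-dimensional space. -/
theorem mem_comp_iff {T : Set Q} {ν : Q} {u : Env g} :
    u ∈ D.comp T ν ↔ u ∈ D.wts T ν * D.cartanU := by
  constructor
  · intro hu
    induction hu using Submodule.span_induction with
    | zero => exact zero_mem _
    | add u v _ _ hu hv => exact add_mem hu hv
    | smul a u _ hu =>
      have := Submodule.mul_mem_mul hu (D.toEnv_mem a)
      rwa [mul_assoc, cartanU_mul_self] at this
    | mem u hu =>
      induction hu with
      | one => simpa using Submodule.mul_mem_mul (D.one_mem_wts T) D.one_mem_cartanU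
      | mul hα hx _ ih =>
        rename_i α ν x u _
        rcases hα with rfl | hα
        · have := Submodule.mul_mem_mul (D.wtU_zero_le ⟨x, hx, rfl⟩) ih
          rwa [wts_mul_cartanU_mul, ← zero_add ν] at this
        · have hx' : ι g x ∈ D.wtU α := ⟨x, hx, rfl⟩
          have := Submodule.mul_mem_mul hx' ih
          rw [← mul_assoc] at this
          exact submodule_mul_mono (D.wtU_mul_wts_le hα ν) le_rfl this
  · have : D.wts T ν * D.cartanU ≤ (D.comp T ν).restrictScalars ℂ := by
      refine Submodule.mul_le.2 fun m hm k hk => D.comp_mul_mem ?_ hk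
      have : D.wts T ν ≤ (D.comp T ν).restrictScalars ℂ := by
        refine iSup₂_le fun l hl m hm => ?_
        have := D.listU_le_comp hl.1 m hm
        rwa [hl.2] at this
      exact this hm
    exact fun hu => this hu

theorem mem_comp_iff' {T : Set Q} {ν : Q} {u : Env g} :
    u ∈ D.comp T ν ↔ u ∈ D.cartanU * D.wts T ν := by
  rw [mem_comp_iff, (D.cartanU_commute_wts T ν).eq]

theorem wts_le_comp {T : Set Q} {ν : Q} {u : Env g} (hu : u ∈ D.wts T ν) : u ∈ D.comp T ν :=
  D.mem_comp_iff.2 (D.le_mul_cartanU _ hu)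

theorem mem_R_iff {u : Env g} : u ∈ D.R ↔ u ∈ D.cartanU := by
  have h : D.wts ∅ 0 = 1 := by
    refine le_antisymm (iSup₂_le fun l hl => ?_) (Submodule.one_le.2 (D.one_mem_wts ∅))
    cases l with
    | nil => exact le_rfl
    | cons α l => exact absurd (hl.1 α List.mem_cons_self) (Set.notMem_empty α)
  rw [mem_comp_iff, h, one_mul]

/-- Such a list is an ordering of one of the finitely many partitions of ν. -/
theorem finite_lists (ν : Q) : {l : List Q | (∀ α ∈ l, α ∈ D.pos) ∧ l.sum = ν}.Finite := by
  classical
  refine ((D.finite_partitions ν).biUnion (t := fun m =>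
    {l : List Q | l.Perm m.toMultiset.toList}) fun m _ => ?_).subset ?_
  · refine (List.finite_toSet m.toMultiset.toList.permutations).subset fun l hl => ?_
    exact List.mem_permutations.2 hl
  · rintro l ⟨hl, hs⟩
    refine Set.mem_biUnion (x := Multiset.toFinsupp (l : Multiset Q)) ⟨?_, ?_⟩ ?_
    · intro α hα
      simp only [Multiset.toFinsupp_support, Finset.mem_coe, Multiset.mem_toFinset,
        Multiset.mem_coe] at hα
      exact hl α hα
    · rw [← hs]
      rw [← Multiset.sum_coe, Finset.sum_multiset_count]
      rfl
    · change l.Perm _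
      rw [Multiset.toFinsupp_toMultiset, ← Multiset.coe_eq_coe, Multiset.coe_toList]

theorem wtU_fg {α : Q} (hα : α ∈ D.pos ∨ α ∈ D.neg) : (D.wtU α).FG :=
  (Module.Finite.iff_fg.1 (D.finite_root α hα)).map _

theorem listU_fg {l : List Q} (hl : ∀ α ∈ l, α ∈ D.pos ∨ α ∈ D.neg) : (D.listU l).FG := by
  induction l with
  | nil =>
    change (1 : Submodule ℂ (Env g)).FG
    rw [Submodule.one_eq_span]
    exact Submodule.fg_span_singleton _
  | cons α l ih =>
    exact Submodule.FG.mul (D.wtU_fg (hl α List.mem_cons_self))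
      (ih fun β hβ => hl β (List.mem_cons_of_mem _ hβ))

theorem finite_wts {T : Set Q} {ν : Q} (hT : ∀ α ∈ T, α ∈ D.pos ∨ α ∈ D.neg)
    (h : {l : List Q | (∀ α ∈ l, α ∈ T) ∧ l.sum = ν}.Finite) : Module.Finite ℂ (D.wts T ν) := by
  rw [Module.Finite.iff_fg, wts, ← h.coe_toFinset]
  exact Submodule.fg_biSup _ _ fun l hl =>
    D.listU_fg fun α hα => hT α (((h.mem_toFinset).1 hl).1 α hα)

theorem finite_wts_pos (ν : Q) : Module.Finite ℂ (D.wts D.pos ν) :=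
  D.finite_wts (fun _ => Or.inl) (D.finite_lists ν)

theorem finite_wts_neg (ν : Q) : Module.Finite ℂ (D.wts D.neg ν) := by
  refine D.finite_wts (fun _ => Or.inr) ?_
  refine ((D.finite_lists (-ν)).preimage (f := List.map Neg.neg)
    (List.map_injective_iff.2 neg_injective).injOn).subset ?_
  rintro l ⟨hl, rfl⟩
  refine ⟨fun α hα => ?_, ?_⟩
  · obtain ⟨β, hβ, rfl⟩ := List.mem_map.1 hα
    exact hl β hβ
  · induction l with
    | nil => simp
    | cons α l ih =>
      rw [List.map_cons, List.sum_cons, ih fun β hβ => hl β (List.mem_cons_of_mem _ hβ),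
        List.sum_cons, neg_add]

theorem wts_le_range {T : Set Q} [D.IsClosedSet T] (ν : Q) :
    D.wts T ν ≤ LinearMap.range (envMap (incl (D.sub T))).toLinearMap := by
  refine iSup₂_le fun l hl => ?_
  have h := hl.1
  clear hl
  induction l with
  | nil => exact Submodule.one_le.2 ⟨1, map_one (envMap (incl (D.sub T)))⟩
  | cons α l ih =>
    refine Submodule.mul_le.2 ?_
    rintro _ ⟨x, hx, rfl⟩ m hm
    obtain ⟨q, rfl⟩ := ih (fun β hβ => h β (List.mem_cons_of_mem _ hβ)) hm
    refine ⟨ι _ ⟨x, D.wt_le_sub (h α List.mem_cons_self) hx⟩ * q, ?_⟩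
    simp

end WeightSpaces

end TriangularDecomposition
end LieSuperalgebra

/-! ### The Harish-Chandra projection through the Verma module -/

namespace LieSuperalgebra
namespace TriangularDecomposition

open TensorProduct

variable {g : Type*} [AddCommGroup g] [Module ℂ g] [LieSuperalgebra g]
  {Q : Type*} [AddCommGroup Q] (D : TriangularDecomposition g Q)

section HarishChandra

/-- The decomposition `g = n⁻ ⊕ b⁺`. -/
def splitNeg : Splitting (D.sub D.neg) (D.sub D.negᶜ) g :=
  Splitting.ofIsCompl _ _ (D.isCompl_sub D.neg)

/-- The decomposition `g = b⁻ ⊕ n⁺`. -/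
def splitPos : Splitting (D.sub D.posᶜ) (D.sub D.pos) g :=
  Splitting.ofIsCompl _ _ (D.isCompl_sub' D.pos)

/-- The augmentation of an enveloping algebra. -/
noncomputable def _root_.LieSuperalgebra.augmentation (a : Type*) [AddCommGroup a] [Module ℂ a]
    [LieSuperalgebra a] : Env a →ₐ[ℂ] ℂ :=
  envLift 0 (by simp)

@[simp] theorem _root_.LieSuperalgebra.augmentation_ι {a : Type*} [AddCommGroup a] [Module ℂ a]
    [LieSuperalgebra a] (x : a) : augmentation a (ι a x) = 0 :=
  envLift_ι (0 : a →ₗ[ℂ] ℂ) (by simp) x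

/-- The action of `U(b⁺)` on `U(h)`. -/
noncomputable def bplusRep : Env (D.sub D.negᶜ) →ₐ[ℂ] Module.End ℂ D.H :=
  (Algebra.lmul ℂ D.H).comp (envMap D.bplusToH)

/-- The Harish-Chandra projection with values in `U(h)`, defined by the action of `U(g)` on the
Verma module `U(n⁻) ⊗ U(h)`. -/
noncomputable def chi : Env g →ₗ[ℂ] D.H :=
  -- The element acts on 1 ⊗ 1, and the augmentation of U(n⁻) then extracts the coefficient in U(h).
  (TensorProduct.lid ℂ D.H).toLinearMap ∘ₗ
    (augmentation (D.sub D.neg)).toLinearMap.rTensor D.H ∘ₗ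
      LinearMap.applyₗ (1 ⊗ₜ 1) ∘ₗ (D.splitNeg.induced D.bplusRep).toLinearMap

theorem chi_mul (p : Env (D.sub D.neg)) (q : Env (D.sub D.negᶜ)) :
    D.chi (envMap (incl _) p * envMap (incl _) q) = augmentation _ p • envMap D.bplusToH q := by
  have h1 := D.splitNeg.induced_envMap_ib D.bplusRep q 1
  have h2 := D.splitNeg.induced_envMap_ia D.bplusRep p 1 (D.bplusRep q 1)
  have : D.chi (envMap (incl _) p * envMap (incl _) q) = TensorProduct.lid ℂ D.H
      ((augmentation (D.sub D.neg)).toLinearMap.rTensor D.H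
        ((D.splitNeg.induced D.bplusRep (envMap D.splitNeg.ia p * envMap D.splitNeg.ib q))
          (1 ⊗ₜ 1))) := rfl
  rw [this, map_mul, Module.End.mul_apply, h1, h2, mul_one, LinearMap.rTensor_tmul,
    TensorProduct.lid_tmul]
  simp [bplusRep]

theorem chi_induction {p : Env g → Prop} (hadd : ∀ u v, p u → p v → p (u + v))
    (hsmul : ∀ (c : ℂ) u, p u → p (c • u))
    (hmul : ∀ (a : Env (D.sub D.neg)) (b : Env (D.sub D.negᶜ)),
      p (envMap (incl _) a * envMap (incl _) b)) (u : Env g) : p u := by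
  have hu : u ∈ (⊤ : Submodule ℂ (Env g)) := Submodule.mem_top
  rw [← D.splitNeg.span_mul_eq_top] at hu
  induction hu using Submodule.span_induction with
  | mem u hu => obtain ⟨a, b, rfl⟩ := hu; exact hmul a b
  | zero => simpa using hsmul 0 _ (hmul 1 1)
  | add u v _ _ hu hv => exact hadd u v hu hv
  | smul c u _ hu => exact hsmul c u hu

/-- The inclusion `U(h) → U(b⁺)`. -/
noncomputable def hToBplus : D.H →ₐ[ℂ] Env (D.sub D.negᶜ) := envMap (inclOfLE D.h_le_bplus)

theorem envMap_hToBplus (r : D.H) : envMap (incl _) (D.hToBplus r) = D.κ r := by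
  have h : (envMap (incl _)).comp D.hToBplus = D.κ := env_hom_ext fun x => by
    simp only [AlgHom.comp_apply, hToBplus, envMap_ι, κ_ι]
    rfl
  exact DFunLike.congr_fun h r

theorem bplusToH_hToBplus (r : D.H) : envMap D.bplusToH (D.hToBplus r) = r := by
  have h : (envMap D.bplusToH).comp D.hToBplus = AlgHom.id ℂ _ := env_hom_ext fun x => by
    simp only [AlgHom.comp_apply, hToBplus, envMap_ι, AlgHom.id_apply]
    exact congrArg _ (D.projH_coe x)
  exact DFunLike.congr_fun h r

theorem chi_mul_κ (u : Env g) (r : D.H) : D.chi (u * D.κ r) = D.chi u * r := by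
  induction u using D.chi_induction with
  | hadd u v hu hv => rw [add_mul, map_add, map_add, add_mul, hu, hv]
  | hsmul c u hu => rw [smul_mul_assoc, map_smul, map_smul, smul_mul_assoc, hu]
  | hmul p q =>
    rw [← envMap_hToBplus, mul_assoc, ← map_mul, chi_mul, chi_mul, map_mul, bplusToH_hToBplus,
      smul_mul_assoc]

@[simp] theorem chi_one : D.chi 1 = 1 := by
  simpa using D.chi_mul 1 1

@[simp] theorem chi_κ (r : D.H) : D.chi (D.κ r) = r := by
  simpa using D.chi_mul_κ 1 r

theorem κ_injective : Function.Injective D.κ := fun r s h => by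
  rw [← D.chi_κ r, h, chi_κ]

theorem chi_nminus_mul {y : g} (hy : y ∈ D.nminus) (u : Env g) : D.chi (ι g y * u) = 0 := by
  induction u using D.chi_induction with
  | hadd u v hu hv => rw [mul_add, map_add, hu, hv, add_zero]
  | hsmul c u hu => rw [mul_smul_comm, map_smul, hu, smul_zero]
  | hmul p q =>
    rw [nminus_eq] at hy
    have : ι g y = envMap (incl (D.sub D.neg)) (ι _ ⟨y, hy⟩) := by simp
    rw [this, ← mul_assoc, ← map_mul, chi_mul, map_mul]
    simp

theorem chi_mul_nplus {x : g} (hx : x ∈ D.nplus) (u : Env g) : D.chi (u * ι g x) = 0 := by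
  induction u using D.chi_induction with
  | hadd u v hu hv => rw [add_mul, map_add, hu, hv, add_zero]
  | hsmul c u hu => rw [smul_mul_assoc, map_smul, hu, smul_zero]
  | hmul p q =>
    have hx' := D.nplus_le_bplus hx
    have h0 : D.bplusToH ⟨x, hx'⟩ = 0 := by
      change D.projH x = 0
      refine sub_induction (D := D) (T := D.pos) (p := fun x => D.projH x = 0) ?_ (map_zero _) ?_ hx
      · intro x y hx hy
        rw [map_add, hx, hy, add_zero]
      · intro α hα _ x hx _
        exact D.projH_of_ne (pos_ne_zero hα) hx
    have : ι g x = envMap (incl (D.sub D.negᶜ)) (ι _ ⟨x, hx'⟩) := by simp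
    rw [this, mul_assoc, ← map_mul, chi_mul, map_mul, envMap_ι, h0]
    simp

theorem smul_eq_mul_κ (a : D.A) (u : Env g) : a • u = u * D.κ (D.toH a) := by
  rw [κ_toH]
  rfl

theorem chi_smul (a : D.A) (u : Env g) : D.chi (a • u) = a • D.chi u := by
  rw [smul_eq_mul_κ, chi_mul_κ, Algebra.smul_def, algebraMap_H, toH_commute]

theorem chi_of_mem_hcKernel {u : Env g} (hu : u ∈ D.hcKernel) : D.chi u = 0 := by
  induction hu using Submodule.span_induction with
  | zero => exact map_zero _
  | add u v _ _ hu hv => rw [map_add, hu, hv, add_zero]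
  | smul a u _ hu => rw [chi_smul, hu, smul_zero]
  | mem u hu =>
    rcases hu with ⟨y, hy, u, rfl⟩ | ⟨x, hx, u, rfl⟩
    · exact D.chi_nminus_mul hy u
    · exact D.chi_mul_nplus hx u

theorem top_mul_nplus_le : ∀ u ∈ (⊤ : Submodule ℂ (Env g)) * D.nplus.map (ι g),
    u ∈ D.hcKernel := by
  have : (⊤ : Submodule ℂ (Env g)) * D.nplus.map (ι g) ≤ D.hcKernel.restrictScalars ℂ := by
    refine Submodule.mul_le.2 ?_
    rintro u - _ ⟨x, hx, rfl⟩
    exact Submodule.subset_span (Or.inr ⟨x, hx, u, rfl⟩)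
  exact fun u hu => this hu

theorem nminus_mul_top_le : ∀ u ∈ D.nminus.map (ι g) * (⊤ : Submodule ℂ (Env g)),
    u ∈ D.hcKernel := by
  have : D.nminus.map (ι g) * (⊤ : Submodule ℂ (Env g)) ≤ D.hcKernel.restrictScalars ℂ := by
    refine Submodule.mul_le.2 ?_
    rintro _ ⟨x, hx, rfl⟩ u -
    exact Submodule.subset_span (Or.inl ⟨x, hx, u, rfl⟩)
  exact fun u hu => this hu

/-- Applying b⁺ → h to all letters drops only terms with a letter of n⁺, and such a letter can be
moved to the right end past U(h). -/
theorem envMap_bplus_sub_mem (q : Env (D.sub D.negᶜ)) :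
    envMap (incl _) q - D.κ (envMap D.bplusToH q) ∈
      (⊤ : Submodule ℂ (Env g)) * D.nplus.map (ι g) := by
  set N := (⊤ : Submodule ℂ (Env g)) * D.nplus.map (ι g) with hN
  have hmul : ∀ (u v : Env g), v ∈ N → u * v ∈ N := fun u v hv => by
    have := Submodule.mul_mem_mul (Submodule.mem_top (R := ℂ) (x := u)) hv
    rw [hN, ← mul_assoc] at this
    exact submodule_mul_mono le_top le_rfl this
  induction q using env_induction with
  | one => simp
  | add u v hu hv =>
    simp only [map_add]
    rw [add_sub_add_comm]
    exact add_mem hu hv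
  | smul c u hu =>
    simp only [map_smul]
    rw [← smul_sub]
    exact N.smul_mem c hu
  | mul z q hq =>
    obtain ⟨z, hz⟩ := z
    simp only [map_mul, envMap_ι, incl_apply]
    have e : ι g z * envMap (incl _) q - D.κ (ι D.h (D.bplusToH ⟨z, hz⟩)) *
        D.κ (envMap D.bplusToH q) = ι g z * (envMap (incl _) q - D.κ (envMap D.bplusToH q)) +
          (ι g z - ι g (D.projH z : g)) * D.κ (envMap D.bplusToH q) := by
      rw [κ_ι, mul_sub, sub_mul]
      change _ - ι g (D.projH z : g) * _ = _
      abel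
    rw [e]
    refine add_mem (hmul _ _ hq) ?_
    refine sub_induction (D := D) (T := D.negᶜ)
      (p := fun z => (ι g z - ι g (D.projH z : g)) * D.κ (envMap D.bplusToH q) ∈ N) ?_ (by simp) ?_ hz
    · intro x y hx hy
      simp only [map_add, Submodule.coe_add]
      rw [add_sub_add_comm, add_mul]
      exact add_mem hx hy
    · intro α hα _ z hzα _
      by_cases h0 : z = 0
      · simp [h0]
      have hα' : D.wt α ≠ ⊥ := fun h => h0 (by rwa [h, Submodule.mem_bot] at hzα)
      rcases pos_or_neg hα' with rfl | hp | hn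
      · rw [D.projH_of_zero hzα, sub_self, zero_mul]
        exact zero_mem _
      · rw [D.projH_of_ne (pos_ne_zero hp) hzα, Submodule.coe_zero, map_zero, sub_zero]
        have hz' : ι g z ∈ D.wtU α := ⟨z, hzα, rfl⟩
        have := Submodule.mul_mem_mul hz' (D.κ_mem (envMap D.bplusToH q))
        rw [← (D.cartanU_commute_wtU α).eq] at this
        exact submodule_mul_mono le_top (Submodule.map_mono (D.wt_le_sub hp)) this
      · exact absurd hn hα

/-- For a product pq with p in U(n⁻) and q in U(b⁺), replacing q by its image in U(h) costs an
element of U(g)n⁺, and replacing p by its augmentation costs an element of n⁻U(g). -/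
theorem sub_κ_chi_mem (u : Env g) : u - D.κ (D.chi u) ∈ D.hcKernel := by
  induction u using D.chi_induction with
  | hadd u v hu hv =>
    simp only [map_add]
    rw [add_sub_add_comm]
    exact add_mem hu hv
  | hsmul c u hu =>
    simp only [map_smul]
    rw [← smul_sub]
    exact Submodule.smul_of_tower_mem _ c hu
  | hmul p q =>
    have e : envMap (incl _) p * envMap (incl _) q
        - D.κ (D.chi (envMap (incl _) p * envMap (incl _) q)) =
        envMap (incl _) p * (envMap (incl _) q - D.κ (envMap D.bplusToH q)) +
        (envMap (incl _) p - algebraMap ℂ _ (augmentation _ p)) * D.κ (envMap D.bplusToH q) := by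
      rw [chi_mul, map_smul, mul_sub, sub_mul, Algebra.smul_def]
      abel
    rw [e]
    refine add_mem (D.top_mul_nplus_le _ ?_) (D.nminus_mul_top_le _ ?_)
    · have := Submodule.mul_mem_mul (Submodule.mem_top (R := ℂ) (x := envMap (incl _) p))
        (D.envMap_bplus_sub_mem q)
      rw [← mul_assoc] at this
      exact submodule_mul_mono le_top le_rfl this
    · have hp : envMap (incl (D.sub D.neg)) p - algebraMap ℂ _ (augmentation _ p) ∈
          D.nminus.map (ι g) * (⊤ : Submodule ℂ (Env g)) := by
        clear e
        induction p using env_induction with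
        | one => simp
        | add u v hu hv =>
          simp only [map_add]
          rw [add_sub_add_comm]
          exact add_mem hu hv
        | smul c u hu =>
          simp only [map_smul, smul_eq_mul, map_mul]
          rw [← Algebra.smul_def, ← smul_sub]
          exact Submodule.smul_mem _ c hu
        | mul y u _ =>
          simp only [map_mul, envMap_ι, augmentation_ι, zero_mul, map_zero, sub_zero]
          exact Submodule.mul_mem_mul ⟨y, by rw [nminus_eq]; exact y.2, rfl⟩ Submodule.mem_top
      have := Submodule.mul_mem_mul hp
        (Submodule.mem_top (R := ℂ) (x := D.κ (envMap D.bplusToH q)))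
      rw [mul_assoc] at this
      exact submodule_mul_mono le_rfl le_top this

/-- `chi` kills `hcKernel` and inverts `κ`, hence the intersection is 0; the sum is everything by
`sub_κ_chi_mem`. So the first case in the definition of `HC` is the one that occurs. -/
theorem isCompl_R_hcKernel : IsCompl D.R D.hcKernel := by
  refine ⟨Submodule.disjoint_def.2 fun u hu hk => ?_, ?_⟩
  · obtain ⟨r, rfl⟩ := D.mem_R_iff.1 hu
    have := D.chi_of_mem_hcKernel hk
    change D.κ r = 0
    rw [show r = 0 from (D.chi_κ r).symm.trans this, map_zero]
  · rw [codisjoint_iff, eq_top_iff]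
    rintro u -
    rw [← add_sub_cancel (D.κ (D.chi u)) u]
    exact Submodule.add_mem_sup (D.mem_R_iff.2 (D.κ_mem _)) (D.sub_κ_chi_mem u)

/-- The Harish-Chandra projection is given by the action on the Verma module. -/
theorem HC_eq (u : Env g) : (D.HC u : Env g) = D.κ (D.chi u) := by
  have h : D.HC u = ⟨D.κ (D.chi u), D.mem_R_iff.2 (D.κ_mem _)⟩ := by
    have H := D.isCompl_R_hcKernel
    rw [HC, dif_pos H]
    conv_lhs => rw [← add_sub_cancel (D.κ (D.chi u)) u]
    rw [map_add, (Submodule.projectionOnto_apply_eq_zero_iff H).2 (D.sub_κ_chi_mem u), add_zero,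
      Submodule.projectionOnto_apply_of_mem_left H (D.mem_R_iff.2 (D.κ_mem _))]
  rw [h]

end HarishChandra

end TriangularDecomposition
end LieSuperalgebra

/-! ### Coordinates on M_{-ν} and N_{-ν}, and the matrix of S_ν -/

open TensorProduct in
theorem LinearIndependent.eq_zero_of_sum_tmul_left {J V W : Type*} [Fintype J] [AddCommGroup V]
    [Module ℂ V] [AddCommGroup W] [Module ℂ W] {p : J → V} (hp : LinearIndependent ℂ p) (r : J → W)
    (h : ∑ j, p j ⊗ₜ[ℂ] r j = 0) : r = 0 := by
  classical
  obtain ⟨f, hf⟩ := LinearMap.exists_leftInverse_of_injective (Finsupp.linearCombination ℂ p)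
    (LinearMap.ker_eq_bot.2 hp)
  have hfp : ∀ j, f (p j) = Finsupp.single j 1 := fun j => by
    have := LinearMap.congr_fun hf (Finsupp.single j 1)
    simpa using this
  funext i
  have := congrArg ((TensorProduct.lid ℂ W).toLinearMap ∘ₗ (Finsupp.lapply i ∘ₗ f).rTensor W) h
  simpa [hfp, Finsupp.single_apply, ite_smul] using this

open TensorProduct in
theorem LinearIndependent.eq_zero_of_sum_tmul_right {J V W : Type*} [Fintype J] [AddCommGroup V]
    [Module ℂ V] [AddCommGroup W] [Module ℂ W] {p : J → V} (hp : LinearIndependent ℂ p) (r : J → W)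
    (h : ∑ j, r j ⊗ₜ[ℂ] p j = 0) : r = 0 := by
  refine hp.eq_zero_of_sum_tmul_left r ?_
  have := congrArg (TensorProduct.comm ℂ W V) h
  simpa using this

namespace LieSuperalgebra
namespace TriangularDecomposition

open TensorProduct

variable {g : Type*} [AddCommGroup g] [Module ℂ g] [LieSuperalgebra g]
  {Q : Type*} [AddCommGroup Q] (D : TriangularDecomposition g Q)

/-- The identification of `U(h)` with `R`. -/
noncomputable def equivR : D.H ≃ₗ[D.A] D.R :=
  LinearEquiv.ofBijective
    { toFun := fun r => (⟨D.κ r, D.mem_R_iff.2 (D.κ_mem r)⟩ : D.R)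
      map_add' := fun r s => Subtype.ext (map_add D.κ r s)
      map_smul' := fun a r => Subtype.ext (D.κ_smul a r) }
    ⟨fun _ _ h => D.κ_injective (congrArg Subtype.val h), fun ⟨u, hu⟩ => by
      obtain ⟨r, rfl⟩ := D.mem_R_iff.1 hu
      exact ⟨r, rfl⟩⟩

@[simp] theorem equivR_coe (r : D.H) : (D.equivR r : Env g) = D.κ r := rfl

section CoordinatesM

variable {J : Type*} [Fintype J] (u : J → Env g)

/-- The map `(r_j) ↦ ∑ u_j r_j`. -/
noncomputable def combM : (J → D.H) →ₗ[D.A] Env g where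
  toFun r := ∑ j, u j * D.κ (r j)
  map_add' r s := by simp [mul_add, Finset.sum_add_distrib]
  map_smul' a r := by
    simp only [Pi.smul_apply, κ_smul, RingHom.id_apply, Finset.smul_sum, smul_def, mul_assoc]

variable {u}

/-- The sum of the u_j r_j maps 1 ⊗ 1 in the Verma module to the sum of the p_j ⊗ r_j, where the p_j
in U(n⁻) lift the u_j and are independent. -/
theorem combM_injective (hu : LinearIndependent ℂ u)
    (hr : ∀ j, u j ∈ LinearMap.range (envMap (incl (D.sub D.neg))).toLinearMap) :
    Function.Injective (D.combM u) := by
  refine (injective_iff_map_eq_zero _).2 fun r h => ?_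
  choose p hp using hr
  have hp' : LinearIndependent ℂ p :=
    LinearIndependent.of_comp (envMap (incl (D.sub D.neg))).toLinearMap (by
      convert hu using 1
      exact funext hp)
  refine hp'.eq_zero_of_sum_tmul_left r ?_
  have h2 := congrArg (fun w => D.splitNeg.induced D.bplusRep w (1 ⊗ₜ 1)) h
  simp only [combM, LinearMap.coe_mk, AddHom.coe_mk, map_sum, LinearMap.sum_apply, map_mul,
    Module.End.mul_apply, map_zero, LinearMap.zero_apply] at h2
  rw [← h2]
  refine Finset.sum_congr rfl fun j _ => ?_
  rw [← envMap_hToBplus, ← hp]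
  have e1 := D.splitNeg.induced_envMap_ib D.bplusRep (D.hToBplus (r j)) 1
  have e2 := D.splitNeg.induced_envMap_ia D.bplusRep (p j) 1 (r j)
  have e3 : D.bplusRep (D.hToBplus (r j)) 1 = r j := by
    simp [bplusRep, bplusToH_hToBplus]
  rw [e3] at e1
  rw [mul_one] at e2
  exact ((congrArg _ e1).trans e2).symm

theorem range_combM {ν : Q} (hspan : Submodule.span ℂ (Set.range u) = D.wts D.neg ν) {w : Env g} :
    w ∈ LinearMap.range (D.combM u) ↔ w ∈ D.comp D.neg ν := by
  constructor
  · rintro ⟨r, rfl⟩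
    refine sum_mem fun j _ => D.comp_mul_mem (D.wts_le_comp ?_) (D.κ_mem _)
    rw [← hspan]
    exact Submodule.subset_span ⟨j, rfl⟩
  · intro hw
    have : D.wts D.neg ν * D.cartanU ≤ (LinearMap.range (D.combM u)).restrictScalars ℂ := by
      refine Submodule.mul_le.2 ?_
      rintro m hm _ ⟨r, rfl⟩
      rw [← hspan] at hm
      obtain ⟨c, rfl⟩ := (Submodule.mem_span_range_iff_exists_fun ℂ).1 hm
      refine ⟨fun j => c j • r, ?_⟩
      simp [combM, Finset.sum_mul]
    exact this (D.mem_comp_iff.1 hw)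

/-- Coordinates on `M_{-ν}`. -/
noncomputable def coordM {ν : Q} (hu : LinearIndependent ℂ u)
    (hspan : Submodule.span ℂ (Set.range u) = D.wts D.neg (-ν)) : (J → D.H) ≃ₗ[D.A] D.M ν :=
  LinearEquiv.ofBijective
    ((D.combM u).codRestrict (D.M ν) fun r => (D.range_combM hspan).1 ⟨r, rfl⟩)
    ⟨fun r s h => D.combM_injective hu (fun j => D.wts_le_range (-ν)
        (hspan ▸ Submodule.subset_span ⟨j, rfl⟩)) (congrArg Subtype.val h),
      fun ⟨w, hw⟩ => by
        obtain ⟨r, rfl⟩ := (D.range_combM hspan).2 hw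
        exact ⟨r, rfl⟩⟩

theorem coordM_coe {ν : Q} (hu : LinearIndependent ℂ u)
    (hspan : Submodule.span ℂ (Set.range u) = D.wts D.neg (-ν)) (r : J → D.H) :
    (D.coordM hu hspan r : Env g) = ∑ j, u j * D.κ (r j) := rfl

end CoordinatesM

section CoordinatesN

variable {I : Type*} [Fintype I] (v : I → Env g)

/-- The map `(r_i) ↦ ∑ r_i v_i`. -/
noncomputable def combP : (I → D.H) →ₗ[ℂ] Env g where
  toFun r := ∑ i, D.κ (r i) * v i
  map_add' r s := by simp [add_mul, Finset.sum_add_distrib]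
  map_smul' a r := by simp [Finset.smul_sum]

variable {v}

/-- The inclusion `U(h) → U(b⁻)`. -/
noncomputable def hToBminus : D.H →ₐ[ℂ] Env (D.sub D.posᶜ) := envMap (inclOfLE D.h_le_bminus)

theorem envMap_hToBminus (r : D.H) : envMap (incl _) (D.hToBminus r) = D.κ r := by
  have h : (envMap (incl _)).comp D.hToBminus = D.κ := env_hom_ext fun x => by
    simp only [AlgHom.comp_apply, hToBminus, envMap_ι, κ_ι]
    rfl
  exact DFunLike.congr_fun h r

/-- For the opposite order of factors the decomposition g = b⁻ ⊕ n⁺ is used, with the module induced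
from the regular representation of U(n⁺): the sum of the r_i v_i maps 1 ⊗ 1 to the sum of the r_i ⊗
q_i. -/
theorem combP_injective (hv : LinearIndependent ℂ v)
    (hr : ∀ i, v i ∈ LinearMap.range (envMap (incl (D.sub D.pos))).toLinearMap) :
    Function.Injective (D.combP v) := by
  refine (injective_iff_map_eq_zero _).2 fun r h => ?_
  choose q hq using hr
  have hq' : LinearIndependent ℂ q :=
    LinearIndependent.of_comp (envMap (incl (D.sub D.pos))).toLinearMap (by
      convert hv using 1
      exact funext hq)
  have key : (fun i => D.hToBminus (r i)) = 0 := by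
    refine hq'.eq_zero_of_sum_tmul_right _ ?_
    let β := Algebra.lmul ℂ (Env (D.sub D.pos))
    have h2 := congrArg (fun w => D.splitPos.induced β w (1 ⊗ₜ 1)) h
    simp only [combP, LinearMap.coe_mk, AddHom.coe_mk, map_sum, LinearMap.sum_apply, map_mul,
      Module.End.mul_apply, map_zero, LinearMap.zero_apply] at h2
    rw [← h2]
    refine Finset.sum_congr rfl fun i _ => ?_
    rw [← envMap_hToBminus, ← hq]
    have e1 := D.splitPos.induced_envMap_ib β (q i) 1
    have e2 := D.splitPos.induced_envMap_ia β (D.hToBminus (r i)) 1 (q i)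
    have e3 : β (q i) 1 = q i := mul_one _
    rw [e3] at e1
    rw [mul_one] at e2
    exact ((congrArg _ e1).trans e2).symm
  funext i
  apply D.κ_injective
  rw [← envMap_hToBminus, congrFun key i]
  simp

theorem range_combP {ν : Q} (hspan : Submodule.span ℂ (Set.range v) = D.wts D.pos ν) {w : Env g} :
    w ∈ LinearMap.range (D.combP v) ↔ w ∈ D.comp D.pos ν := by
  constructor
  · rintro ⟨r, rfl⟩
    refine sum_mem fun i _ => D.mem_comp_iff'.2 (Submodule.mul_mem_mul (D.κ_mem _) ?_)
    rw [← hspan]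
    exact Submodule.subset_span ⟨i, rfl⟩
  · intro hw
    have : D.cartanU * D.wts D.pos ν ≤ LinearMap.range (D.combP v) := by
      refine Submodule.mul_le.2 ?_
      rintro _ ⟨r, rfl⟩ m hm
      rw [← hspan] at hm
      obtain ⟨c, rfl⟩ := (Submodule.mem_span_range_iff_exists_fun ℂ).1 hm
      refine ⟨fun j => c j • r, ?_⟩
      simp [combP, Finset.mul_sum]
    exact this (D.mem_comp_iff'.1 hw)

/-- Coordinates on `U(b⁺)_ν`. -/
noncomputable def coordP {ν : Q} (hv : LinearIndependent ℂ v)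
    (hspan : Submodule.span ℂ (Set.range v) = D.wts D.pos ν) : (I → D.H) ≃ₗ[ℂ] D.P ν :=
  LinearEquiv.ofBijective
    ((D.combP v).codRestrict ((D.P ν).restrictScalars ℂ) fun r => (D.range_combP hspan).1 ⟨r, rfl⟩)
    ⟨fun r s h => D.combP_injective hv (fun j => D.wts_le_range ν
        (hspan ▸ Submodule.subset_span ⟨j, rfl⟩)) (congrArg Subtype.val h),
      fun ⟨w, hw⟩ => by
        obtain ⟨r, rfl⟩ := (D.range_combP hspan).2 hw
        exact ⟨r, rfl⟩⟩

theorem coordP_coe {ν : Q} (hv : LinearIndependent ℂ v)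
    (hspan : Submodule.span ℂ (Set.range v) = D.wts D.pos ν) (r : I → D.H) :
    (D.coordP hv hspan r : Env g) = ∑ i, D.κ (r i) * v i := rfl

theorem κ_mul_mem {T : Set Q} {ν : Q} (r : D.H) {w : Env g} (hw : w ∈ D.comp T ν) :
    D.κ r * w ∈ D.comp T ν := by
  have := Submodule.mul_mem_mul (D.κ_mem r) (D.mem_comp_iff'.1 hw)
  rw [← mul_assoc, cartanU_mul_self] at this
  exact D.mem_comp_iff'.2 this

/-- The elements of `N_{-ν}` are homomorphisms of `U(h)`-modules. -/
theorem N_κ {ν : Q} (F : D.N ν) (r : D.H) (w : D.P ν) :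
    (F.1 ⟨D.κ r * w, D.κ_mul_mem r w.2⟩ : Env g) = D.κ r * (F.1 w : Env g) := by
  induction r using env_induction with
  | one => simp
  | add r s hr hs =>
    have e : (⟨D.κ (r + s) * w, D.κ_mul_mem (r + s) w.2⟩ : D.P ν) =
        ⟨D.κ r * w, D.κ_mul_mem r w.2⟩ + ⟨D.κ s * w, D.κ_mul_mem s w.2⟩ :=
      Subtype.ext (by simp [add_mul])
    rw [e, map_add, Submodule.coe_add, hr, hs, map_add, add_mul]
  | smul c r hr =>
    have e : (⟨D.κ (c • r) * w, D.κ_mul_mem (c • r) w.2⟩ : D.P ν) =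
        c • ⟨D.κ r * w, D.κ_mul_mem r w.2⟩ := Subtype.ext (by simp)
    rw [e, map_smul, Submodule.coe_smul_of_tower, hr, map_smul, smul_mul_assoc]
  | mul x r hr =>
    have e : (⟨D.κ (ι D.h x * r) * w, D.κ_mul_mem (ι D.h x * r) w.2⟩ : D.P ν) =
        D.lmul _ _ x ⟨D.κ r * w, D.κ_mul_mem r w.2⟩ := Subtype.ext (by
      change D.κ (ι D.h x * r) * w = ι g (x : g) * (D.κ r * w)
      rw [map_mul, κ_ι, mul_assoc])
    rw [e, F.2]
    change ι g (x : g) * (F.1 ⟨D.κ r * w, D.κ_mul_mem r w.2⟩ : Env g) = _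
    rw [hr, map_mul, κ_ι, mul_assoc]

omit [Fintype I] in
theorem mem_P {ν : Q} (hspan : Submodule.span ℂ (Set.range v) = D.wts D.pos ν) (i : I) :
    v i ∈ D.P ν := D.wts_le_comp (hspan ▸ Submodule.subset_span ⟨i, rfl⟩)

/-- Evaluation of the elements of `N_{-ν}` at the `v_i`. -/
noncomputable def evalN {ν : Q} (hspan : Submodule.span ℂ (Set.range v) = D.wts D.pos ν) :
    D.N ν →ₗ[D.A] (I → D.H) where
  toFun F i := D.equivR.symm (F.1 ⟨v i, D.mem_P hspan i⟩)
  map_add' _ _ := funext fun _ => map_add D.equivR.symm _ _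
  map_smul' a _ := funext fun _ => map_smul D.equivR.symm a _

omit [Fintype I] in
theorem κ_evalN {ν : Q} (hspan : Submodule.span ℂ (Set.range v) = D.wts D.pos ν) (F : D.N ν)
    (i : I) : D.κ (D.evalN hspan F i) = F.1 ⟨v i, D.mem_P hspan i⟩ := by
  rw [← equivR_coe]
  exact congrArg Subtype.val (D.equivR.apply_symm_apply _)

/-- Coordinates on `N_{-ν}`. -/
noncomputable def coordN {ν : Q} (hv : LinearIndependent ℂ v)
    (hspan : Submodule.span ℂ (Set.range v) = D.wts D.pos ν) : D.N ν ≃ₗ[D.A] (I → D.H) :=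
  LinearEquiv.ofBijective (D.evalN hspan) (by
    classical
    constructor
    -- U(b⁺)_ν is free as a left U(h)-module on the v_i, so a homomorphism is determined by its
    -- values there, and these can be prescribed arbitrarily.
    · intro F G hFG
      refine Subtype.ext (LinearMap.ext fun w => Subtype.ext ?_)
      obtain ⟨r, rfl⟩ := (D.coordP hv hspan).surjective w
      have e : D.coordP hv hspan r =
          ∑ i, (⟨D.κ (r i) * v i, D.κ_mul_mem (r i) (D.mem_P hspan i)⟩ : D.P ν) :=
        Subtype.ext (by rw [coordP_coe, AddSubmonoidClass.coe_finsetSum])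
      rw [e, map_sum, map_sum, AddSubmonoidClass.coe_finsetSum, AddSubmonoidClass.coe_finsetSum]
      refine Finset.sum_congr rfl fun i _ => ?_
      rw [D.N_κ F (r i) ⟨v i, D.mem_P hspan i⟩, D.N_κ G (r i) ⟨v i, D.mem_P hspan i⟩,
        ← D.κ_evalN hspan, ← D.κ_evalN hspan, hFG]
    · intro s
      let F₀ : (I → D.H) →ₗ[ℂ] D.R :=
        { toFun := fun r => D.equivR (∑ i, r i * s i)
          map_add' := fun r r' => by simp [add_mul, Finset.sum_add_distrib]
          map_smul' := fun c r => by
            rw [RingHom.id_apply, ← algebraMap_smul D.A c (D.equivR _), ← map_smul,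
              algebraMap_smul, Finset.smul_sum]
            simp }
      have hF : ∀ (x : D.h) (w : D.P ν), (F₀ ∘ₗ (D.coordP hv hspan).symm.toLinearMap)
          (D.lmul _ _ x w) = D.lmul _ _ x ((F₀ ∘ₗ (D.coordP hv hspan).symm.toLinearMap) w) := by
        intro x w
        obtain ⟨r, rfl⟩ := (D.coordP hv hspan).surjective w
        have e : D.lmul _ _ x (D.coordP hv hspan r) =
            D.coordP hv hspan (fun i => ι D.h x * r i) := Subtype.ext (by
          change ι g (x : g) * (D.coordP hv hspan r : Env g) = _
          rw [coordP_coe, coordP_coe, Finset.mul_sum]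
          simp [mul_assoc])
        rw [e]
        simp only [LinearMap.comp_apply, LinearEquiv.coe_coe, LinearEquiv.symm_apply_apply]
        refine Subtype.ext ?_
        change D.κ (∑ i, ι D.h x * r i * s i) = ι g (x : g) * D.κ (∑ i, r i * s i)
        rw [← κ_ι, ← map_mul, Finset.mul_sum]
        simp only [mul_assoc]
      refine ⟨⟨_, hF⟩, funext fun i => ?_⟩
      apply D.κ_injective
      rw [κ_evalN]
      have e : (⟨v i, D.mem_P hspan i⟩ : D.P ν) = D.coordP hv hspan (Pi.single i 1) :=
        Subtype.ext (by
          rw [coordP_coe, Finset.sum_eq_single i]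
          · simp
          · intro j _ hj
            simp [hj]
          · simp)
      rw [e]
      simp only [LinearMap.comp_apply, LinearEquiv.coe_coe, LinearEquiv.symm_apply_apply]
      change D.κ (∑ j, (Pi.single i 1 : I → D.H) j * s j) = _
      rw [Finset.sum_eq_single i]
      · simp
      · intro j _ hj
        simp [hj]
      · simp)

theorem κ_coordN {ν : Q} (hv : LinearIndependent ℂ v)
    (hspan : Submodule.span ℂ (Set.range v) = D.wts D.pos ν) (F : D.N ν) (i : I) :
    D.κ (D.coordN hv hspan F i) = F.1 ⟨v i, D.mem_P hspan i⟩ :=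
  D.κ_evalN hspan F i

end CoordinatesN

/-- The Shapovalov map in coordinates. -/
theorem coordN_S_coordM {I J : Type*} [Fintype I] [Fintype J] {u : J → Env g} {v : I → Env g}
    {ν : Q} (hu : LinearIndependent ℂ u)
    (huspan : Submodule.span ℂ (Set.range u) = D.wts D.neg (-ν)) (hv : LinearIndependent ℂ v)
    (hvspan : Submodule.span ℂ (Set.range v) = D.wts D.pos ν) (r : J → D.H) :
    D.coordN hv hvspan (D.S ν (D.coordM hu huspan r)) =
      (Matrix.of fun i j => D.chi (v i * u j)).mulVecAlg D.A r := by
  funext i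
  apply D.κ_injective
  rw [κ_coordN, Matrix.mulVecAlg_apply]
  change (D.HC (v i * (D.coordM hu huspan r : Env g)) : Env g) = _
  rw [HC_eq, coordM_coe, Finset.mul_sum, map_sum]
  congr 1
  refine Finset.sum_congr rfl fun j _ => ?_
  -- The coordinate r_j stands to the right of v_i u_j and comes out of the projection, which is
  -- linear for right multiplication by U(h).
  rw [← mul_assoc, chi_mul_κ, Matrix.of_apply]

end TriangularDecomposition
end LieSuperalgebra

/-! ### Transport of bases and of the Harish-Chandra projection along ψ -/

namespace LieSuperalgebra

/-- The composition of homomorphisms. -/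
def Hom.comp {a g g' : Type*} [AddCommGroup a] [Module ℂ a] [LieSuperalgebra a]
    [AddCommGroup g] [Module ℂ g] [LieSuperalgebra g]
    [AddCommGroup g'] [Module ℂ g'] [LieSuperalgebra g'] (ψ : Hom g g') (f : Hom a g) :
    Hom a g' where
  toLinearMap := ψ.toLinearMap ∘ₗ f.toLinearMap
  map_parity hx := ψ.map_parity (f.map_parity hx)
  map_bracket x y := (congrArg ψ (f.map_bracket x y)).trans (ψ.map_bracket _ _)

theorem envMap_comp {a g g' : Type*} [AddCommGroup a] [Module ℂ a] [LieSuperalgebra a]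
    [AddCommGroup g] [Module ℂ g] [LieSuperalgebra g]
    [AddCommGroup g'] [Module ℂ g'] [LieSuperalgebra g'] (ψ : Hom g g') (f : Hom a g) (p : Env a) :
    envMap (ψ.comp f) p = envMap ψ (envMap f p) := by
  have h : envMap (ψ.comp f) = (envMap ψ).comp (envMap f) := env_hom_ext fun x => by
    simp only [AlgHom.comp_apply, envMap_ι]
    rfl
  exact DFunLike.congr_fun h p

/-- In the module induced from the trivial b-module, the image of p maps 1 ⊗ 1 to p ⊗ 1. -/
theorem Splitting.envMap_ia_injective {a b g : Type*} [AddCommGroup a] [Module ℂ a]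
    [LieSuperalgebra a] [AddCommGroup b] [Module ℂ b] [LieSuperalgebra b] [AddCommGroup g]
    [Module ℂ g] [LieSuperalgebra g] (D : Splitting a b g) : Function.Injective (envMap D.ia) := by
  intro p q h
  let β : Env b →ₐ[ℂ] Module.End ℂ ℂ := (Algebra.lmul ℂ ℂ).comp (augmentation b)
  have h1 : p ⊗ₜ[ℂ] (1 : ℂ) = q ⊗ₜ[ℂ] (1 : ℂ) := by
    have e1 := D.induced_envMap_ia β p 1 1
    have e2 := D.induced_envMap_ia β q 1 1
    rw [mul_one] at e1 e2
    rw [← e1, ← e2, h]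
  simpa using congrArg (TensorProduct.rid ℂ (Env a)) h1

namespace TriangularDecomposition

variable {g g' : Type*} [AddCommGroup g] [Module ℂ g] [LieSuperalgebra g]
  [AddCommGroup g'] [Module ℂ g'] [LieSuperalgebra g'] {Q : Type*} [AddCommGroup Q]
  {D : TriangularDecomposition g Q} {D' : TriangularDecomposition g' Q} {ψ : Hom g g'}

section Functoriality

variable {T T' : Set Q}

theorem disjoint_wt_sub {α : Q} (hα : α ∉ T) : Disjoint (D.wt α) (D.sub T) :=
  (D.iSupIndep_wt α).mono_right (iSup₂_le fun β hβ =>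
    le_iSup₂_of_le β (fun h : β = α => hα (h ▸ hβ)) le_rfl)

/-- The root sets of g and g' may differ as subsets of Q. As ψ respects degrees, a preimage can be
replaced by its component of degree α; if α is not in `T`, that component is 0. -/
theorem wt_le_map_wt (hψ : ∀ (α : Q) (x : g), x ∈ D.wt α → ψ x ∈ D'.wt α)
    (hT : Set.BijOn ψ (D.sub T) (D'.sub T')) {α : Q} (hα : α ∈ T') :
    D'.wt α ≤ (D.wt α).map ψ.toLinearMap ∧ (α ∉ T → D'.wt α = ⊥) := by
  classical
  have key : ∀ y ∈ D'.wt α, ∃ x ∈ D.wt α, ψ x = y ∧ (α ∉ T → x = 0) := by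
    intro y hy
    obtain ⟨x, hx, rfl⟩ := hT.surjOn (D'.wt_le_sub hα hy)
    have hsup : D.sub T ≤ (if α ∈ T then D.wt α else ⊥) ⊔ D.sub (T \ {α}) := by
      refine iSup₂_le fun β hβ => ?_
      by_cases h : β = α
      · subst h
        rw [if_pos hβ]
        exact le_sup_left
      · exact le_sup_of_le_right (D.wt_le_sub (T := T \ {α}) ⟨hβ, h⟩)
    obtain ⟨a, ha, b, hb, rfl⟩ := Submodule.mem_sup.1 (hsup hx)
    have ha' : a ∈ D.wt α ∧ (α ∉ T → a = 0) := by
      split_ifs at ha with h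
      · exact ⟨ha, fun h' => absurd h h'⟩
      · rw [(Submodule.mem_bot ℂ).1 ha]
        exact ⟨zero_mem _, fun _ => rfl⟩
    refine ⟨a, ha'.1, ?_, ha'.2⟩
    have hb1 : ψ b ∈ D'.wt α := by
      have := sub_mem hy (hψ α a ha'.1)
      rwa [map_add, add_sub_cancel_left] at this
    have hb2 : D.sub (T \ {α}) ≤ (D'.sub (T \ {α})).comap ψ.toLinearMap :=
      iSup₂_le fun β hβ x hx => D'.wt_le_sub hβ (hψ β x hx)
    have := Submodule.disjoint_def.1 (D'.disjoint_wt_sub (T := T \ {α}) (by simp)) _ hb1 (hb2 hb)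
    rw [map_add, this, add_zero]
  refine ⟨fun y hy => ?_, fun h => ?_⟩
  · obtain ⟨x, hx, hxy, -⟩ := key y hy
    exact ⟨x, hx, hxy⟩
  · refine (Submodule.eq_bot_iff _).2 fun y hy => ?_
    obtain ⟨x, -, rfl, hx⟩ := key y hy
    rw [hx h, map_zero]

theorem wt_eq_bot (hψ : ∀ (α : Q) (x : g), x ∈ D.wt α → ψ x ∈ D'.wt α)
    (hT : Set.BijOn ψ (D.sub T) (D'.sub T')) {α : Q} (hα : α ∈ T) (hα' : α ∉ T') :
    D.wt α = ⊥ := by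
  refine (Submodule.eq_bot_iff _).2 fun x hx => ?_
  have hx' := D.wt_le_sub hα hx
  refine hT.injOn hx' (zero_mem _) ?_
  rw [map_zero]
  exact Submodule.disjoint_def.1 (D'.disjoint_wt_sub hα') _ (hψ α x hx) (hT.mapsTo hx')

theorem listU_eq_bot {l : List Q} {α : Q} (hα : α ∈ l) (h : D.wt α = ⊥) : D.listU l = ⊥ := by
  refine List.prod_eq_zero (List.mem_map.2 ⟨α, hα, ?_⟩)
  rw [wtU, h, Submodule.map_bot]
  rfl

theorem map_wts (hψ : ∀ (α : Q) (x : g), x ∈ D.wt α → ψ x ∈ D'.wt α)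
    (hT : Set.BijOn ψ (D.sub T) (D'.sub T')) (ν : Q) :
    (D.wts T ν).map (envMap ψ).toLinearMap = D'.wts T' ν := by
  have hmap : ∀ l : List Q, (D.listU l).map (envMap ψ).toLinearMap =
      (l.map fun α => (D.wtU α).map (envMap ψ).toLinearMap).prod := by
    intro l
    induction l with
    | nil => exact Submodule.map_one _
    | cons α l ih =>
      rw [List.map_cons, List.prod_cons, ← ih, ← Submodule.map_mul]
      rfl
  have hwt : ∀ α, (D.wtU α).map (envMap ψ).toLinearMap =
      ((D.wt α).map ψ.toLinearMap).map (ι g') := by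
    intro α
    rw [wtU, ← Submodule.map_comp, ← Submodule.map_comp]
    congr 1
    exact LinearMap.ext fun x => envMap_ι ψ x
  refine le_antisymm ?_ (iSup₂_le fun l hl => ?_)
  · rw [wts, Submodule.map_iSup]
    refine iSup_le fun l => ?_
    rw [Submodule.map_iSup]
    refine iSup_le fun hl => ?_
    by_cases h : ∀ α ∈ l, α ∈ T'
    · refine le_trans ?_ (le_iSup₂_of_le (f := fun l (_ : l ∈ {l' : List Q | (∀ α ∈ l', α ∈ T') ∧
        l'.sum = ν}) => D'.listU l) l ⟨h, hl.2⟩ le_rfl)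
      rw [hmap, listU]
      clear hl h
      induction l with
      | nil => exact le_rfl
      | cons α l ih =>
        refine submodule_mul_mono ?_ ih
        beta_reduce
        rw [hwt]
        refine Submodule.map_mono ?_
        rintro _ ⟨x, hx, rfl⟩
        exact hψ α x hx
    · push Not at h
      obtain ⟨α, hα, hα'⟩ := h
      rw [listU_eq_bot hα (wt_eq_bot hψ hT (hl.1 α hα) hα'), Submodule.map_bot]
      exact bot_le
  · by_cases h : ∀ α ∈ l, α ∈ T
    · refine le_trans ?_ (Submodule.map_mono (le_iSup₂_of_le (f := fun l (_ : l ∈ {l' : List Q |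
        (∀ α ∈ l', α ∈ T) ∧ l'.sum = ν}) => D.listU l) l ⟨h, hl.2⟩ le_rfl))
      rw [hmap, listU]
      have hl' := hl.1
      clear hl h
      induction l with
      | nil => exact le_rfl
      | cons α l ih =>
        refine submodule_mul_mono ?_ (ih fun β hβ => hl' β (List.mem_cons_of_mem _ hβ))
        beta_reduce
        rw [hwt]
        exact Submodule.map_mono (wt_le_map_wt hψ hT (hl' α List.mem_cons_self)).1
    · push Not at h
      obtain ⟨α, hα, hα'⟩ := h
      rw [listU_eq_bot hα ((wt_le_map_wt hψ hT (hl.1 α hα)).2 hα')]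
      exact bot_le

/-- Through ψ the subalgebra `D.sub T` becomes a summand of g' with complementary subalgebra `D'.sub
T'ᶜ`. By `Splitting.envMap_ia_injective` its enveloping algebra embeds in U(g'), and this embedding
factors through U(g). -/
theorem envMap_injOn_wts [D.IsClosedSet T] [D'.IsClosedSet T'ᶜ]
    (hT : Set.BijOn ψ (D.sub T) (D'.sub T')) (ν : Q) : Set.InjOn (envMap ψ) (D.wts T ν) := by
  let e : D.sub T ≃ₗ[ℂ] D'.sub T' := LinearEquiv.ofBijective
    (ψ.toLinearMap.restrict fun x hx => hT.mapsTo hx)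
    ⟨fun x y h => Subtype.ext (hT.injOn x.2 y.2 (congrArg Subtype.val h)), fun ⟨y, hy⟩ => by
      obtain ⟨x, hx, rfl⟩ := hT.surjOn hy
      exact ⟨⟨x, hx⟩, rfl⟩⟩
  let s : Splitting (D.sub T) (D'.sub T'ᶜ) g' :=
    { ia := ψ.comp (incl _)
      ib := incl _
      bij := ((e.prodCongr (LinearEquiv.refl ℂ _)).trans
        (Submodule.prodEquivOfIsCompl _ _ (D'.isCompl_sub T'))).bijective }
  intro u hu w hw h
  obtain ⟨p, rfl⟩ := D.wts_le_range ν hu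
  obtain ⟨q, rfl⟩ := D.wts_le_range ν hw
  have : envMap s.ia p = envMap s.ia q := by
    change envMap (ψ.comp _) p = envMap (ψ.comp _) q
    rw [envMap_comp, envMap_comp]
    exact h
  rw [s.envMap_ia_injective this]

theorem linearIndependent_envMap [D.IsClosedSet T] [D'.IsClosedSet T'ᶜ]
    (hT : Set.BijOn ψ (D.sub T) (D'.sub T')) {ν : Q} {J : Type*} {u : J → Env g}
    (hu : LinearIndependent ℂ u) (hspan : Submodule.span ℂ (Set.range u) = D.wts T ν) :
    LinearIndependent ℂ fun j => envMap ψ (u j) :=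
  hu.map_injOn (envMap ψ).toLinearMap (by
    rw [hspan]
    exact envMap_injOn_wts hT ν)

theorem span_envMap (hψ : ∀ (α : Q) (x : g), x ∈ D.wt α → ψ x ∈ D'.wt α)
    (hT : Set.BijOn ψ (D.sub T) (D'.sub T')) {ν : Q} {J : Type*} {u : J → Env g}
    (hspan : Submodule.span ℂ (Set.range u) = D.wts T ν) :
    Submodule.span ℂ (Set.range fun j => envMap ψ (u j)) = D'.wts T' ν := by
  rw [← map_wts hψ hT, ← hspan, Submodule.map_span, ← Set.range_comp]
  rfl

theorem envMap_mem_hcKernel (hψ : ∀ (α : Q) (x : g), x ∈ D.wt α → ψ x ∈ D'.wt α)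
    (hplus : Set.MapsTo ψ D.nplus D'.nplus) (hminus : Set.MapsTo ψ D.nminus D'.nminus) {w : Env g}
    (hw : w ∈ D.hcKernel) : envMap ψ w ∈ D'.hcKernel := by
  induction hw using Submodule.span_induction with
  | zero => rw [map_zero]; exact zero_mem _
  | add u v _ _ hu hv => rw [map_add]; exact add_mem hu hv
  | smul a u _ hu =>
    rw [smul_eq_mul_κ, map_mul, ← mapH_κ D D' ψ hψ, mapH_toH, ← smul_eq_mul_κ]
    exact Submodule.smul_mem _ _ hu
  | mem u hu =>
    rcases hu with ⟨y, hy, u, rfl⟩ | ⟨x, hx, u, rfl⟩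
    · rw [map_mul, envMap_ι]
      exact Submodule.subset_span (Or.inl ⟨_, hminus hy, _, rfl⟩)
    · rw [map_mul, envMap_ι]
      exact Submodule.subset_span (Or.inr ⟨_, hplus hx, _, rfl⟩)

/-- ψ maps U(h) to U(h') and `hcKernel` to `hcKernel`, so it respects the two decompositions. -/
theorem chi_envMap (hψ : ∀ (α : Q) (x : g), x ∈ D.wt α → ψ x ∈ D'.wt α)
    (hplus : Set.MapsTo ψ D.nplus D'.nplus) (hminus : Set.MapsTo ψ D.nminus D'.nminus)
    (w : Env g) : D'.chi (envMap ψ w) = mapH D D' ψ hψ (D.chi w) := by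
  have h := D'.chi_of_mem_hcKernel (envMap_mem_hcKernel hψ hplus hminus (D.sub_κ_chi_mem w))
  rw [map_sub, map_sub, ← mapH_κ D D' ψ hψ, chi_κ, sub_eq_zero] at h
  exact h

end Functoriality

end TriangularDecomposition
end LieSuperalgebra

/-! ### Roots of proportional powers, and units of A -/

/-- With c₀^N = c, the difference x^N - (c₀ y)^N is the product of the x - η c₀ y over the N-th
roots of unity η, all of which are in ℂ. In a domain one factor vanishes. -/
theorem exists_eq_smul_of_pow_eq_smul {B : Type*} [CommRing B] [IsDomain B] [Algebra ℂ B] {x y : B}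
    {N : ℕ} (hN : N ≠ 0) {c : ℂ} (hc : c ≠ 0) (h : x ^ N = c • y ^ N) :
    ∃ c' : ℂ, c' ≠ 0 ∧ x = c' • y := by
  obtain ⟨c₀, rfl⟩ := IsAlgClosed.exists_pow_nat_eq c (Nat.pos_of_ne_zero hN)
  have hc₀ : c₀ ≠ 0 := fun h0 => hc (by rw [h0, zero_pow hN])
  have : NeZero N := ⟨hN⟩
  have hζ := Complex.isPrimitiveRoot_exp N hN
  set ζ := Complex.exp (2 * Real.pi * Complex.I / N)
  have hζ' : IsPrimitiveRoot (algebraMap ℂ B ζ) N :=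
    hζ.map_of_injective (algebraMap ℂ B).injective
  have h0 := hζ'.pow_sub_pow_eq_prod_sub_mul x (c₀ • y) (Nat.pos_of_ne_zero hN)
  rw [smul_pow, h, sub_self] at h0
  obtain ⟨η, hη, hx⟩ := Finset.prod_eq_zero_iff.1 h0.symm
  rw [Polynomial.mem_nthRootsFinset (Nat.pos_of_ne_zero hN)] at hη
  obtain ⟨i, -, rfl⟩ := hζ'.eq_pow_of_pow_eq_one hη
  refine ⟨ζ ^ i * c₀, mul_ne_zero (pow_ne_zero _ (Complex.exp_ne_zero _)) hc₀, ?_⟩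
  rw [sub_eq_zero.1 hx, ← map_pow, ← Algebra.smul_def, smul_smul]

theorem SymmetricAlgebra.exists_eq_algebraMap_of_isUnit {V : Type*} [AddCommGroup V] [Module ℂ V]
    {a : SymmetricAlgebra ℂ V} (ha : IsUnit a) : ∃ c : ℂ, c ≠ 0 ∧ a = algebraMap ℂ _ c := by
  let e := SymmetricAlgebra.equivMvPolynomial (Module.Basis.ofVectorSpace ℂ V)
  obtain ⟨c, hc, h⟩ := MvPolynomial.isUnit_iff_eq_C_of_isReduced.1 (ha.map e)
  refine ⟨c, hc.ne_zero, e.injective ?_⟩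
  rw [h, AlgEquiv.commutes]
  rfl

/-! ### The determinant of the Shapovalov map and the comparison of norms -/

namespace LieSuperalgebra
namespace TriangularDecomposition

section Determinant

variable {g : Type*} [AddCommGroup g] [Module ℂ g] [LieSuperalgebra g]
  {Q : Type*} [AddCommGroup Q] (D : TriangularDecomposition g Q)

/-- The matrix of the Shapovalov map. -/
noncomputable def shapovalovMatrix {J : Type*} (u v : J → Env g) : Matrix J J D.H :=
  Matrix.of fun i j => D.chi (v i * u j)

/-- In coordinates Ψ⁻¹ ∘ S_ν is the matrix operator followed by an A-linear automorphism of U(h)^J.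
The determinant of the automorphism is a unit of A, hence a nonzero constant. -/
theorem exists_det_eq_smul {J : Type*} [Fintype J] [DecidableEq J] {u v : J → Env g} {ν : Q}
    (hu : LinearIndependent ℂ u)
    (huspan : Submodule.span ℂ (Set.range u) = D.wts D.neg (-ν)) (hv : LinearIndependent ℂ v)
    (hvspan : Submodule.span ℂ (Set.range v) = D.wts D.pos ν) (Ψ : D.M ν ≃ₗ[D.A] D.N ν) :
    ∃ c : ℂ, c ≠ 0 ∧ LinearMap.det (Ψ.symm.toLinearMap ∘ₗ D.S ν) =
      c • LinearMap.det ((D.shapovalovMatrix u v).mulVecAlg D.A) := by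
  let f := D.coordM hu huspan
  let k := D.coordN hv hvspan
  let E : (J → D.H) ≃ₗ[D.A] (J → D.H) := k.symm.trans (Ψ.symm.trans f.symm)
  have h1 : f.symm.toLinearMap ∘ₗ (Ψ.symm.toLinearMap ∘ₗ D.S ν) ∘ₗ f.toLinearMap =
      E.toLinearMap ∘ₗ (D.shapovalovMatrix u v).mulVecAlg D.A := by
    refine LinearMap.ext fun r => ?_
    have := D.coordN_S_coordM hu huspan hv hvspan r
    simp only [LinearMap.comp_apply, LinearEquiv.coe_coe]
    rw [shapovalovMatrix, ← this]
    simp [E, f, k]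
  obtain ⟨c, hc, hcE⟩ := SymmetricAlgebra.exists_eq_algebraMap_of_isUnit E.isUnit_det'
  refine ⟨c, hc, ?_⟩
  have h2 := LinearMap.det_conj (Ψ.symm.toLinearMap ∘ₗ D.S ν) f.symm
  rw [LinearEquiv.symm_symm, h1, LinearMap.det_comp, hcE, ← Algebra.smul_def] at h2
  exact h2.symm

/-- The existence of Ψ forces both bases to have the same length, by comparison of ranks over A; so
the matrix of S_ν is square. -/
theorem exists_bases {ν : Q} (Ψ : D.M ν ≃ₗ[D.A] D.N ν) : ∃ (m : ℕ) (u v : Fin m → Env g),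
    LinearIndependent ℂ u ∧ Submodule.span ℂ (Set.range u) = D.wts D.neg (-ν) ∧
    LinearIndependent ℂ v ∧ Submodule.span ℂ (Set.range v) = D.wts D.pos ν := by
  have hfin := D.finite_wts_neg (-ν)
  have hfin' := D.finite_wts_pos ν
  have key : ∀ (W : Submodule ℂ (Env g)) [Module.Finite ℂ W], ∃ (m : ℕ) (u : Fin m → Env g),
      LinearIndependent ℂ u ∧ Submodule.span ℂ (Set.range u) = W := by
    intro W _
    let b := Module.finBasis ℂ W
    refine ⟨_, W.subtype ∘ b, b.linearIndependent.map' _ W.ker_subtype, ?_⟩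
    rw [Set.range_comp, Submodule.span_image, b.span_eq, Submodule.map_subtype_top]
  obtain ⟨m, u, hu, huspan⟩ := key (D.wts D.neg (-ν))
  obtain ⟨m', v, hv, hvspan⟩ := key (D.wts D.pos ν)
  have hm : m = m' := by
    have := (((D.coordM hu huspan).trans Ψ).trans (D.coordN hv hvspan)).finrank_eq
    rw [Module.finrank_pi_fintype, Module.finrank_pi_fintype, finrank_H] at this
    simpa using this
  subst hm
  exact ⟨m, u, v, hu, huspan, hv, hvspan⟩

theorem IsReducedNorm.exists_pow_eq {D : TriangularDecomposition g Q} {ν : Q} {n : D.A}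
    (hn : D.IsReducedNorm ν n) : ∃ Ψ : D.M ν ≃ₗ[D.A] D.N ν,
      LinearMap.det (Ψ.symm.toLinearMap ∘ₗ D.S ν) = n ^ 2 ^ D.oddDim := by
  obtain ⟨Ψ, Nm, φ, -, hN, hφ, rfl⟩ := hn
  exact ⟨Ψ, by rw [← hφ, hN φ, oddDim]⟩

end Determinant

end TriangularDecomposition
end LieSuperalgebra

open LieSuperalgebra TriangularDecomposition in
theorem LieSuperalgebra.TriangularDecomposition.exists_reducedNorm_pow_eq {g g' Q : Type*}
    [AddCommGroup g] [Module ℂ g] [LieSuperalgebra g]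
    [AddCommGroup g'] [Module ℂ g'] [LieSuperalgebra g'] [AddCommGroup Q]
    {D : TriangularDecomposition g Q} {D' : TriangularDecomposition g' Q} {ψ : Hom g g'}
    (hψ : ∀ (α : Q) (x : g), x ∈ D.wt α → ψ x ∈ D'.wt α)
    (hplus : Set.BijOn ψ D.nplus D'.nplus) (hminus : Set.BijOn ψ D.nminus D'.nminus)
    {ν : Q} {n : D.A} {n' : D'.A} (hn : D.IsReducedNorm ν n) (hn' : D'.IsReducedNorm ν n') :
    ∃ c : ℂ, c ≠ 0 ∧ n' ^ (2 ^ D'.oddDim * 2 ^ D.oddDim) =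
      c • D.mapA D' ψ hψ n ^ (2 ^ D'.oddDim * 2 ^ D.oddDim) := by
  obtain ⟨Ψ, hΨ⟩ := hn.exists_pow_eq
  obtain ⟨Ψ', hΨ'⟩ := hn'.exists_pow_eq
  obtain ⟨m, u, v, hu, huspan, hv, hvspan⟩ := D.exists_bases Ψ
  have hminus' : Set.BijOn ψ (D.sub D.neg) (D'.sub D'.neg) := by
    rwa [← nminus_eq, ← nminus_eq]
  have hu' := linearIndependent_envMap hminus' hu huspan
  have hv' := linearIndependent_envMap (T := D.pos) (T' := D'.pos) hplus hv hvspan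
  obtain ⟨c, hc, h⟩ := D.exists_det_eq_smul hu huspan hv hvspan Ψ
  obtain ⟨c', hc', h'⟩ := D'.exists_det_eq_smul hu' (span_envMap hψ hminus' huspan) hv'
    (span_envMap (T := D.pos) (T' := D'.pos) hψ hplus hvspan) Ψ'
  -- With the images of the two bases chosen as bases for g', the matrix of S'_ν is the image of the
  -- matrix of S_ν.
  have hB : D'.shapovalovMatrix (fun j => envMap ψ (u j)) (fun j => envMap ψ (v j)) =
      (D.shapovalovMatrix u v).map (mapH D D' ψ hψ) := by
    ext i j
    simp only [shapovalovMatrix, Matrix.of_apply, Matrix.map_apply]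
    rw [← map_mul, chi_envMap hψ hplus.mapsTo hminus.mapsTo]
  have hdet := det_mulVecAlg_mapH D D' ψ hψ (D.shapovalovMatrix u v)
  rw [← hB] at hdet
  rw [hΨ] at h
  rw [hΨ'] at h'
  -- From n'^(2^d') = c' det B', det B = c⁻¹ n^(2^d) and (det B')^(2^d) = ψ(det B)^(2^d').
  refine ⟨c' ^ 2 ^ D.oddDim * (c⁻¹) ^ 2 ^ D'.oddDim,
    mul_ne_zero (pow_ne_zero _ hc') (pow_ne_zero _ (inv_ne_zero hc)), ?_⟩
  rw [pow_mul, h', smul_pow, hdet, mul_comm (2 ^ D'.oddDim), pow_mul _ (2 ^ D.oddDim),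
    ← map_pow _ n, h, map_smul, smul_pow, smul_smul, mul_assoc, ← mul_pow, inv_mul_cancel₀ hc, one_pow, mul_one]

theorem mainTheorem10 {g g' Q : Type*}
    [AddCommGroup g] [Module ℂ g] [LieSuperalgebra g]
    [AddCommGroup g'] [Module ℂ g'] [LieSuperalgebra g'] [AddCommGroup Q]
    (D : LieSuperalgebra.TriangularDecomposition g Q)
    (D' : LieSuperalgebra.TriangularDecomposition g' Q)
    (ψ : LieSuperalgebra.Hom g g')
    (hψ : ∀ (α : Q) (x : g), x ∈ D.wt α → ψ x ∈ D'.wt α)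
    (hplus : Set.BijOn ψ D.nplus D'.nplus)
    (hminus : Set.BijOn ψ D.nminus D'.nminus)
    (ν : Q) (n : D.A) (n' : D'.A)
    (hn : D.IsReducedNorm ν n) (hn' : D'.IsReducedNorm ν n') :
    ∃ c : ℂ, c ≠ 0 ∧ n' = c • D.mapA D' ψ hψ n := by
  obtain ⟨c, hc, h⟩ := LieSuperalgebra.TriangularDecomposition.exists_reducedNorm_pow_eq hψ hplus
    hminus hn hn'
  exact exists_eq_smul_of_pow_eq_smul (by positivity) hc h
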